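/- Let $\tau_1,\tau_2,\tau_3\in\mathbb C$ be such that the imaginary part of the symmetric matrix $\begin{pmatrix}\tau_1&\tau_3\\ \tau_3&\tau_2\end{pmatrix}$ is positive definite, and put $Q(u_1,u_2)=\tau_1u_1^2+\tau_2u_2^2+2\tau_3u_1u_2$. Let $T=\mathbb R^4/\mathbb Z^4$ with coordinates $x_1,y_1,x_2,y_2$ and the complex symplectic form $$\omega=\tau_1\,dx_1\wedge dy_1+\tau_2\,dx_2\wedge dy_2+\tau_3\,(dx_1\wedge dy_2+dx_2\wedge dy_1),$$ let $\iota=-\mathrm{id}$ and let $K=T/\iota$ be the symplectic Kummer surface. Let $L=\{y_1=y_2=0\}$ and $\rho(x_1,y_1,x_2,y_2)=(x_1,y_1+2x_1,x_2,y_2+2x_2)$. The Fukaya ring $\mathcal R(T)=\bigoplus_{l\ge0}\mathrm{Hom}(L,\rho^lL)$ has degree-zero part $\mathbb C\cdot 1$; for $l\ge 1$ its part of degree $l$ has the basis $y^l_{a}$, $a\in(\mathbb Z/2l\mathbb Z)^2$, consisting of the intersection points $(a_1/2l,0,a_2/2l,0)$ of $L$ and $\rho^lL$. The product counts the holomorphic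 triangles bounded by $L,\rho^lL,\rho^{l+m}L$, each weighted by $\exp(2\pi i\int\omega)$, i.e. $$y^l_{a}\,y^m_{c}=\sum_{n\in\mathbb Z^2}\exp\Big(2\pi i\,\tfrac{lm}{l+m}\,Q\big(\tfrac{c}{2m}+n-\tfrac{a}{2l}\big)\Big)\,y^{l+m}_{a+c+2mn}.$$ The orbifold Fukaya ring $\mathcal R(K)$ is the graded subring of elements of $\mathcal R(T)$ invariant under $\iota\colon y^l_a\mapsto y^l_{-a}$; in $\mathcal R(K)$ we write $y^l_a$ for the sum of the $\iota$-orbit of $y^l_a$ (so $y^l_a=y^l_{-a}$ in $\mathcal R(K)$). Put $$X_0=y^1_{0,0},\quad X_1=y^1_{1,0},\quad X_2=y^1_{0,1},\quad X_3=y^1_{1,1}.$$ Let $$\theta(a,b,l)=\sum_{m,n\in\mathbb Z}e^{4l\pi i\tau_1(\frac a{4l}+m)^2}\,e^{4l\pi i\tau_2(\frac b{4l}+n)^2}\,e^{8l\pi i\tau_3(\frac a{4l}+m)(\frac b{4l}+n)},$$ $$g=\tfrac12\big(\theta(0,0,2)+\theta(4,0,2)+\theta(0,4,2)+\theta(4,4,2)\big),\qquad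 h=\theta(2,0,2)+\theta(2,4,2),$$ $$j=\theta(0,2,2)+\theta(4,2,2),\qquad k=\theta(2,2,2)+\theta(6,2,2),$$ and assume that $(g:h:j:k)$ satisfies the conditions under which such points parametrize Kummer surfaces in $\mathbb P^3$: $$gh\ne\pm jk,\quad gj\ne\pm hk,\quad gk\ne\pm hj,\quad g^2+h^2\ne j^2+k^2,\quad g^2+j^2\ne h^2+k^2,\quad g^2+k^2\ne h^2+j^2,\quad g^2+h^2+j^2+k^2\ne0.$$ Put $$A=\frac{j^4+k^4-h^4-g^4}{h^2g^2-j^2k^2},\quad B=\frac{k^4+h^4-j^4-g^4}{j^2g^2-h^2k^2},\quad C=\frac{h^4+j^4-k^4-g^4}{k^2g^2-j^2h^2},$$ $$D=2\,\frac{hjkg\,(g^2+h^2-j^2-k^2)(g^2+j^2-k^2-h^2)(g^2-h^2-j^2+k^2)(h^2+j^2+k^2+g^2)}{(h^2g^2-j^2k^2)(j^2g^2-h^2k^2)(k^2g^2-j^2h^2)}$$ and let $F$ be the Kummer quartic $$F=\sum_{i=0}^3X_i^4+A(X_0^2X_1^2+X_2^2X_3^2)+B(X_0^2X_2^2+X_1^2X_3^2)+C(X_0^2X_3^2+X_1^2X_2^2)+D\,X_0X_1X_2X_3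 .$$ Then: 1. $\mathcal R(K)$ is generated as a $\mathbb C$-algebra by the four degree-one elements $X_0,\dots,X_3$. 2. The ideal of relations between $X_0,\dots,X_3$ in $\mathcal R(K)$ is generated by the single quartic relation $F(X_0,X_1,X_2,X_3)=0$. 3. Let $$W_0=\sum_iX_i^4,\quad W_1=X_0^2X_1^2+X_2^2X_3^2,\quad W_2=X_0^2X_2^2+X_1^2X_3^2,\quad W_3=X_0^2X_3^2+X_1^2X_2^2,\quad W_4=X_0X_1X_2X_3,$$ $$Z_0=y^4_{0,0}+y^4_{4,0}+y^4_{0,4}+y^4_{4,4},\quad Z_1=y^4_{2,0}+y^4_{2,4},\quad Z_2=y^4_{0,2}+y^4_{4,2},\quad Z_3=y^4_{2,2}+y^4_{2,6}.$$ Then in $\mathcal R(K)$ one has $W_i=\sum_{r=0}^3M_{ri}Z_r$ for $0\le i\le 4$, where $$M=\begin{pmatrix}8g^3&4h^2g&4j^2g&4k^2g&2jkh\\8h^3&4g^2h&4k^2h&4j^2h&2jkg\\8j^3&4k^2j&4g^2j&4h^2j&2hgk\\8k^3&4j^2k&4h^2k&4g^2k&2hgj\end{pmatrix}.$$ 4.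 The kernel of $M\colon\mathbb C^5\to\mathbb C^4$ is spanned by $(1,A,B,C,D)^{T}$. 5. $\{F=0\}\subset\mathbb P^3$ is a singular Kummer surface in $\mathbb P^3$, that is, a quartic surface whose only singularities are sixteen (ordinary) double points. 6. The mirror of $K$, defined as $\operatorname{Proj}\mathcal R(K)$, is realized as this surface: the homomorphism of graded rings from the homogeneous coordinate ring of $\mathbb P^3$ to $\mathcal R(K)$ given by $X_0,\dots,X_3$ induces a closed immersion $\operatorname{Proj}\mathcal R(K)\hookrightarrow\mathbb P^3$ with image $\{F=0\}$. -/

import Mathlib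

noncomputable section

namespace KummerMirror

/-- Absolutely summable functions on `ℤ²`. -/
def SummableFun : Type := {F : ℤ × ℤ → ℂ // Summable F}

namespace SummableFun

/-- The vector space of absolutely summable functions on `ℤ²`. -/
def toSubmodule : Submodule ℂ (ℤ × ℤ → ℂ) where
  carrier := {F | Summable F}
  add_mem' := Summable.add
  zero_mem' := summable_zero
  smul_mem' c _ h := h.const_smul c

instance : AddCommGroup SummableFun := inferInstanceAs (AddCommGroup toSubmodule)

/-- The summable function with given values. -/
def mk (F : ℤ × ℤ → ℂ) (hF : Summable F) : SummableFun := ⟨F, hF⟩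

theorem mk_val (F : ℤ × ℤ → ℂ) (hF : Summable F) : (mk F hF).1 = F := rfl

theorem ext {F G : SummableFun} (h : ∀ k, F.1 k = G.1 k) : F = G := Subtype.ext (funext h)

theorem add_val (F G : SummableFun) (k : ℤ × ℤ) : (F + G).1 k = F.1 k + G.1 k := rfl

theorem summable_prod (F G : SummableFun) :
    Summable fun p : (ℤ × ℤ) × (ℤ × ℤ) => F.1 p.1 * G.1 p.2 :=
  (summable_mul_of_summable_norm F.2.norm G.2.norm)

theorem summable_shear (F G : SummableFun) :
    Summable fun p : (ℤ × ℤ) × (ℤ × ℤ) => F.1 p.2 * G.1 (p.1 - p.2) := by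
  have := summable_prod F G
  let e : (ℤ × ℤ) × (ℤ × ℤ) ≃ (ℤ × ℤ) × (ℤ × ℤ) :=
    ⟨fun p => (p.2, p.1 - p.2), fun p => (p.1 + p.2, p.1), fun p => by simp, fun p => by simp⟩
  exact (e.summable_iff (f := fun p : (ℤ × ℤ) × (ℤ × ℤ) => F.1 p.1 * G.1 p.2)).2 this

theorem summable_conv (F G : SummableFun) (k : ℤ × ℤ) :
    Summable fun a => F.1 a * G.1 (k - a) := (summable_shear F G).prod_factor k

instance : Mul SummableFun :=
  ⟨fun F G => ⟨fun k => ∑' a, F.1 a * G.1 (k - a), (summable_shear F G).prod⟩⟩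

theorem mul_val (F G : SummableFun) (k : ℤ × ℤ) :
    (F * G).1 k = ∑' a, F.1 a * G.1 (k - a) := rfl

instance : One SummableFun :=
  ⟨⟨fun k => if k = 0 then 1 else 0, summable_of_ne_finset_zero (s := {0}) (by
    intro b hb; rw [if_neg (by simpa using hb)])⟩⟩

theorem one_val (k : ℤ × ℤ) : (1 : SummableFun).1 k = if k = 0 then 1 else 0 := rfl

protected theorem mul_comm (F G : SummableFun) : F * G = G * F := by
  refine ext fun k => ?_
  rw [mul_val, mul_val, ← (Equiv.subLeft k).tsum_eq]
  exact tsum_congr fun a => by simp [mul_comm]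

protected theorem left_distrib (F G H : SummableFun) : F * (G + H) = F * G + F * H := by
  refine ext fun k => ?_
  rw [add_val, mul_val, mul_val, mul_val,
    ← (summable_conv F G k).tsum_add (summable_conv F H k)]
  exact tsum_congr fun a => by rw [add_val, mul_add]

protected theorem mul_assoc (F G H : SummableFun) : F * G * H = F * (G * H) := by
  refine ext fun k => ?_
  have e1 : Summable fun p : (ℤ × ℤ) × (ℤ × ℤ) =>
      F.1 p.1 * (G.1 (p.2 - p.1) * H.1 (k - p.2)) := by
    refine Summable.of_norm_bounded (g := fun p : (ℤ × ℤ) × (ℤ × ℤ) =>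
      ‖F.1 p.1 * G.1 (p.2 - p.1)‖ * ∑' b, ‖H.1 b‖) ?_ ?_
    · refine Summable.mul_right _ ?_
      exact ((Equiv.prodComm _ _).summable_iff
        (f := fun p : (ℤ × ℤ) × (ℤ × ℤ) => ‖F.1 p.1 * G.1 (p.2 - p.1)‖)).1 (summable_shear F G).norm
    · intro p
      rw [← mul_assoc, norm_mul]
      exact mul_le_mul_of_nonneg_left (H.2.norm.le_tsum _ fun _ _ => norm_nonneg _) (norm_nonneg _)
  calc (F * G * H).1 k = ∑' b, ∑' a, F.1 a * (G.1 (b - a) * H.1 (k - b)) := by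
        rw [mul_val]
        refine tsum_congr fun b => ?_
        rw [mul_val, ← tsum_mul_right]
        exact tsum_congr fun a => mul_assoc _ _ _
    _ = ∑' a, ∑' b, F.1 a * (G.1 (b - a) * H.1 (k - b)) := e1.tsum_comm
    _ = (F * (G * H)).1 k := by
        rw [mul_val]
        refine tsum_congr fun a => ?_
        rw [mul_val, tsum_mul_left, ← (Equiv.addRight a).tsum_eq]
        congr 1
        refine tsum_congr fun b => ?_
        simp [sub_sub, add_comm]

protected theorem one_mul (F : SummableFun) : 1 * F = F := by
  refine ext fun k => ?_
  rw [mul_val, tsum_eq_single 0 (by intro b hb; simp [one_val, hb])]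
  simp [one_val]

instance : CommRing SummableFun where
  mul_assoc := SummableFun.mul_assoc
  mul_comm := SummableFun.mul_comm
  one_mul := SummableFun.one_mul
  mul_one F := by rw [SummableFun.mul_comm, SummableFun.one_mul]
  left_distrib := SummableFun.left_distrib
  right_distrib F G H := by
    rw [SummableFun.mul_comm, SummableFun.left_distrib, SummableFun.mul_comm H F,
      SummableFun.mul_comm H G]
  zero_mul F := ext fun k => by
    rw [mul_val]; exact (tsum_congr fun a => zero_mul _).trans tsum_zero
  mul_zero F := ext fun k => by
    rw [mul_val]; exact (tsum_congr fun a => mul_zero _).trans tsum_zero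

theorem sum_val {ι : Type} (s : Finset ι) (F : ι → SummableFun) (k : ℤ × ℤ) :
    (∑ i ∈ s, F i).1 k = ∑ i ∈ s, (F i).1 k := by
  classical
  induction s using Finset.induction_on with
  | empty => rfl
  | insert a s h ih => rw [Finset.sum_insert h, Finset.sum_insert h, add_val, ih]

end SummableFun

/-! ### The symplectic torus, its linear Lagrangians and holomorphic triangles -/

/-- The complex symplectic form
`ω = τ₁ dx₁∧dy₁ + τ₂ dx₂∧dy₂ + τ₃ (dx₁∧dy₂ + dx₂∧dy₁)` on `ℝ⁴/ℤ⁴`, whose imaginary part is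
positive, that is, the imaginary part of the symmetric matrix `(τ₁, τ₃; τ₃, τ₂)` is positive
definite. -/
structure SymplecticForm where
  τ₁ : ℂ
  τ₂ : ℂ
  τ₃ : ℂ
  im_pos : 0 < τ₁.im
  im_det_pos : τ₃.im ^ 2 < τ₁.im * τ₂.im

/-- A point (or vector) of the universal cover `ℝ⁴` of the torus. -/
@[ext]
structure Vec where
  x₁ : ℝ
  y₁ : ℝ
  x₂ : ℝ
  y₂ : ℝ

/-- The difference vector of two points of `ℝ⁴`. -/
instance : Sub Vec := ⟨fun u v => ⟨u.x₁ - v.x₁, u.y₁ - v.y₁, u.x₂ - v.x₂, u.y₂ - v.y₂⟩⟩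

namespace SymplecticForm

/-- The value `ω(u, v)`. -/
def eval (ω : SymplecticForm) (u v : Vec) : ℂ :=
  ω.τ₁ * (u.x₁ * v.y₁ - u.y₁ * v.x₁ : ℝ) + ω.τ₂ * (u.x₂ * v.y₂ - u.y₂ * v.x₂ : ℝ)
    + ω.τ₃ * ((u.x₁ * v.y₂ - u.y₂ * v.x₁ : ℝ) + (u.x₂ * v.y₁ - u.y₁ * v.x₂ : ℝ))

/-- The integral of `ω` over the flat triangle `p q r` in `ℝ⁴`. -/
def triangleArea (ω : SymplecticForm) (p q r : Vec) : ℂ := ω.eval (q - p) (r - p) / 2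

end SymplecticForm

/-- The linear symplectomorphism `ρ(x, y) = (x, y + 2x)`. -/
def rho (v : Vec) : Vec := ⟨v.x₁, v.y₁ + 2 * v.x₁, v.x₂, v.y₂ + 2 * v.x₂⟩

/-- The point `(a/2l, 0, b/2l, 0)` of `ℝ⁴`, for `k = (a, b)`: a lift of the intersection point
`y^l_{a,b}` of the Lagrangians `L = {y = 0}` and `ρ^l L = {y = 2 l x}`. -/
def pt (l : ℕ) (k : ℤ × ℤ) : Vec := ⟨k.1 / (2 * l), 0, k.2 / (2 * l), 0⟩

/-- The lattice translate by `(0, -a, 0, -b)`, for `k = (a, b)`. -/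
def shiftY (k : ℤ × ℤ) (v : Vec) : Vec := ⟨v.x₁, v.y₁ - k.1, v.x₂, v.y₂ - k.2⟩

/-- The contribution `exp (2πi ∫ ω)` of the triangle in `ℝ⁴` bounded by lifts of `L`, `ρ^l L` and
`ρ^{l+m} L` with corners

* `pt l a`, a lift of `y^l_a ∈ L ∩ ρ^l L`,
* `shiftY a (ρ^l (pt m c))`, a lift of `ρ^l (y^m_c) ∈ ρ^l L ∩ ρ^{l+m} L`, which lies on the same
  lift `{y = 2 l x - a}` of `ρ^l L` as `pt l a`,
* `pt (l + m) (a + c)`, a lift of `y^{l+m}_{a+c} ∈ L ∩ ρ^{l+m} L`, which lies on the same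
  lift `{y = 2 (l + m) x - (a + c)}` of `ρ^{l+m} L` as the previous corner.

When the third corner is fixed, these are all such triangles, one for each decomposition `a + c`.
If `l = 0` or `m = 0` (and `a = 0`, respectively `c = 0`) the triangle is constant. -/
def weight (ω : SymplecticForm) (l m : ℕ) (a c : ℤ × ℤ) : ℂ :=
  Complex.exp (2 * Real.pi * Complex.I *
    ω.triangleArea (pt l a) (pt (l + m) (a + c)) (shiftY a (rho^[l] (pt m c))))

theorem rho_iterate_pt (l m : ℕ) (c : ℤ × ℤ) :
    rho^[l] (pt m c) = ⟨c.1 / (2 * m), 2 * l * (c.1 / (2 * m)), c.2 / (2 * m),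
      2 * l * (c.2 / (2 * m))⟩ := by
  induction l with
  | zero => simp [pt]
  | succ l ih =>
    rw [Function.iterate_succ_apply', ih, rho]
    ext <;> push_cast <;> ring

/-- The quadratic form `τ₁ a² + τ₂ b² + 2 τ₃ a b`. -/
def quadForm (ω : SymplecticForm) (k : ℤ × ℤ) : ℂ :=
  ω.τ₁ * (k.1 : ℂ) ^ 2 + ω.τ₂ * (k.2 : ℂ) ^ 2 + 2 * ω.τ₃ * (k.1 : ℂ) * (k.2 : ℂ)

/-- The Gaussian `exp (2πi Q(k) / 4l)`. -/
def gauss (ω : SymplecticForm) (l : ℕ) (k : ℤ × ℤ) : ℂ :=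
  Complex.exp (2 * Real.pi * Complex.I * (quadForm ω k / (4 * l)))

theorem gauss_ne_zero (ω : SymplecticForm) (l : ℕ) (k : ℤ × ℤ) : gauss ω l k ≠ 0 :=
  Complex.exp_ne_zero _

theorem weight_mul_gauss (ω : SymplecticForm) {l m : ℕ} {a c : ℤ × ℤ}
    (ha : l = 0 → a = 0) (hc : m = 0 → c = 0) :
    weight ω l m a c * gauss ω (l + m) (a + c) = gauss ω l a * gauss ω m c := by
  unfold weight gauss
  rw [← Complex.exp_add, ← Complex.exp_add, ← mul_add, ← mul_add, rho_iterate_pt]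
  congr 2
  have key : ∀ u v : Vec, u - v = ⟨u.x₁ - v.x₁, u.y₁ - v.y₁, u.x₂ - v.x₂, u.y₂ - v.y₂⟩ :=
    fun _ _ => rfl
  simp only [SymplecticForm.triangleArea, SymplecticForm.eval, key, pt, shiftY, quadForm,
    Prod.fst_add, Prod.snd_add]
  rcases Nat.eq_zero_or_pos l with rfl | hl
  · rw [ha rfl]
    simp
  rcases Nat.eq_zero_or_pos m with rfl | hm
  · rw [hc rfl]
    simp
  have h1 : (l : ℂ) ≠ 0 := by exact_mod_cast hl.ne'
  have h2 : (m : ℂ) ≠ 0 := by exact_mod_cast hm.ne'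
  have h3 : (l : ℂ) + m ≠ 0 := by exact_mod_cast (by omega : l + m ≠ 0)
  push_cast
  field_simp
  ring

theorem weight_neg (ω : SymplecticForm) (l m : ℕ) (a c : ℤ × ℤ) :
    weight ω l m (-a) (-c) = weight ω l m a c := by
  unfold weight
  rw [rho_iterate_pt, rho_iterate_pt]
  congr 2
  have key : ∀ u v : Vec, u - v = ⟨u.x₁ - v.x₁, u.y₁ - v.y₁, u.x₂ - v.x₂, u.y₂ - v.y₂⟩ :=
    fun _ _ => rfl
  simp only [SymplecticForm.triangleArea, SymplecticForm.eval, key, pt, shiftY,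
    Prod.fst_add, Prod.snd_add, Prod.fst_neg, Prod.snd_neg]
  push_cast
  ring

theorem weight_add (ω : SymplecticForm) {l m : ℕ} (hl : 0 < l) (hm : 0 < m) (a c n : ℤ × ℤ) :
    weight ω l m (a + (2 * l : ℤ) • n) (c + (2 * m : ℤ) • n) = weight ω l m a c := by
  unfold weight
  rw [rho_iterate_pt, rho_iterate_pt]
  congr 2
  have key : ∀ u v : Vec, u - v = ⟨u.x₁ - v.x₁, u.y₁ - v.y₁, u.x₂ - v.x₂, u.y₂ - v.y₂⟩ :=
    fun _ _ => rfl
  simp only [SymplecticForm.triangleArea, SymplecticForm.eval, key, pt, shiftY,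
    Prod.fst_add, Prod.snd_add, Prod.smul_fst, Prod.smul_snd, smul_eq_mul]
  have h1 : (l : ℂ) ≠ 0 := by exact_mod_cast hl.ne'
  have h2 : (m : ℂ) ≠ 0 := by exact_mod_cast hm.ne'
  have h3 : (l : ℂ) + m ≠ 0 := by exact_mod_cast (by omega : l + m ≠ 0)
  push_cast
  field_simp
  ring

theorem weight_zero_left (ω : SymplecticForm) (m : ℕ) (c : ℤ × ℤ) :
    weight ω 0 m 0 c = 1 := by
  unfold weight
  have key : ∀ u v : Vec, u - v = ⟨u.x₁ - v.x₁, u.y₁ - v.y₁, u.x₂ - v.x₂, u.y₂ - v.y₂⟩ :=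
    fun _ _ => rfl
  simp [SymplecticForm.triangleArea, SymplecticForm.eval, key, pt, shiftY]

theorem weight_zero_right (ω : SymplecticForm) (l : ℕ) (a : ℤ × ℤ) :
    weight ω l 0 a 0 = 1 := by
  unfold weight
  have key : ∀ u v : Vec, u - v = ⟨u.x₁ - v.x₁, u.y₁ - v.y₁, u.x₂ - v.x₂, u.y₂ - v.y₂⟩ :=
    fun _ _ => rfl
  rw [rho_iterate_pt]
  simp [SymplecticForm.triangleArea, SymplecticForm.eval, key, pt, shiftY]

theorem quadForm_im_ge (ω : SymplecticForm) :
    ∃ δ : ℝ, 0 < δ ∧ ∀ k : ℤ × ℤ,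
      δ * ((k.1 : ℝ) ^ 2 + (k.2 : ℝ) ^ 2) ≤ (quadForm ω k).im := by
  have h1 := ω.im_pos
  have h2 := ω.im_det_pos
  have h3 : 0 < ω.τ₂.im := by
    have h4 : 0 < ω.τ₁.im * ω.τ₂.im := lt_of_le_of_lt (sq_nonneg _) h2
    exact (pos_iff_pos_of_mul_pos h4).1 h1
  set p := ω.τ₁.im
  set q := ω.τ₂.im
  set r := ω.τ₃.im
  refine ⟨(p * q - r ^ 2) / (p + q), div_pos (by linarith) (by linarith), fun k => ?_⟩
  have e : (quadForm ω k).im = p * (k.1 : ℝ) ^ 2 + q * (k.2 : ℝ) ^ 2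
      + 2 * r * (k.1 : ℝ) * (k.2 : ℝ) := by
    have : quadForm ω k = ω.τ₁ * (((k.1 : ℝ) ^ 2 : ℝ) : ℂ) + ω.τ₂ * (((k.2 : ℝ) ^ 2 : ℝ) : ℂ)
      + ω.τ₃ * ((2 * (k.1 : ℝ) * (k.2 : ℝ) : ℝ) : ℂ) := by
      unfold quadForm; push_cast; ring
    rw [this]
    simp only [Complex.add_im, Complex.im_mul_ofReal]
    ring
  rw [e, div_mul_eq_mul_div, div_le_iff₀ (by linarith)]
  have i1 := sq_nonneg (p * (k.1 : ℝ) + r * (k.2 : ℝ))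
  have i2 := sq_nonneg (r * (k.1 : ℝ) + q * (k.2 : ℝ))
  have i3 : (p * (k.1 : ℝ) ^ 2 + q * (k.2 : ℝ) ^ 2 + 2 * r * (k.1 : ℝ) * (k.2 : ℝ)) * (p + q)
      = (p * q - r ^ 2) * ((k.1 : ℝ) ^ 2 + (k.2 : ℝ) ^ 2) + (p * (k.1 : ℝ) + r * (k.2 : ℝ)) ^ 2
        + (r * (k.1 : ℝ) + q * (k.2 : ℝ)) ^ 2 := by ring
  rw [i3]
  linarith

theorem summable_exp_sq {ε : ℝ} (hε : 0 < ε) :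
    Summable fun n : ℤ => Real.exp (-ε * (n : ℝ) ^ 2) := by
  have hn : Summable fun n : ℕ => Real.exp (-ε * (n : ℝ) ^ 2) := by
    have h0 : Summable fun n : ℕ => Real.exp (n * (-ε)) :=
      Real.summable_exp_nat_mul_iff.2 (neg_lt_zero.2 hε)
    refine Summable.of_nonneg_of_le (fun _ => (Real.exp_pos _).le) (fun n => ?_) h0
    refine Real.exp_le_exp.2 ?_
    have h1 : (n : ℝ) ≤ (n : ℝ) ^ 2 := by exact_mod_cast Nat.le_self_pow two_ne_zero n
    have := mul_le_mul_of_nonneg_left h1 hε.le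
    linarith
  refine Summable.of_nat_of_neg ?_ ?_
  · simpa using hn
  · simpa using hn

theorem norm_gauss_le (ω : SymplecticForm) {l : ℕ} (hl : 0 < l) :
    ∃ ε : ℝ, 0 < ε ∧ ∀ k : ℤ × ℤ,
      ‖gauss ω l k‖ ≤ Real.exp (-ε * (k.1 : ℝ) ^ 2) * Real.exp (-ε * (k.2 : ℝ) ^ 2) := by
  obtain ⟨δ, hδ, h⟩ := quadForm_im_ge ω
  have hl' : (0 : ℝ) < l := by exact_mod_cast hl
  have h5 : 0 < 2 * Real.pi / (4 * (l : ℝ)) := by positivity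
  refine ⟨2 * Real.pi / (4 * (l : ℝ)) * δ, mul_pos h5 hδ, fun k => ?_⟩
  rw [gauss, Complex.norm_exp, ← Real.exp_add]
  refine Real.exp_le_exp.2 ?_
  have e : 2 * (Real.pi : ℂ) * Complex.I * (quadForm ω k / (4 * l))
      = ((2 * Real.pi / (4 * l) : ℝ) : ℂ) * (Complex.I * quadForm ω k) := by
    push_cast; ring
  rw [e, Complex.re_ofReal_mul, Complex.I_mul_re]
  have := mul_le_mul_of_nonneg_left (h k) h5.le
  linarith

theorem summable_gauss (ω : SymplecticForm) {l : ℕ} (hl : 0 < l) : Summable (gauss ω l) := by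
  obtain ⟨ε, hε, h⟩ := norm_gauss_le ω hl
  have s1 := summable_exp_sq hε
  exact Summable.of_norm_bounded
    (s1.mul_of_nonneg s1 (fun _ => (Real.exp_pos _).le) (fun _ => (Real.exp_pos _).le)) h

/-! ### The Fukaya ring of the torus -/

/-- The vector space `⨁_l Hom (L, ρ^l L)`. An element is a family `f l`, nonzero for finitely many
`l`. For `l ≥ 1` the morphism `∑ f_l(y) y` between the transverse Lagrangians `L` and `ρ^l L`, a
combination of the intersection points `y^l_k`, `k ∈ (ℤ/2l)²`, is recorded by the function
`f l k = f_l (y^l_k)` of the lifts `k ∈ ℤ²`, which is `2l`-periodic. For `l = 0` one has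
`Hom (L, L) = HF⁰ (L, L) = ℂ`, recorded by the value `f 0 0`. -/
def morphisms : Submodule ℂ (ℕ → ℤ × ℤ → ℂ) where
  carrier := {f | (∀ (l : ℕ) (k n : ℤ × ℤ), f l (k + (2 * l : ℤ) • n) = f l k) ∧
    (∀ k : ℤ × ℤ, k ≠ 0 → f 0 k = 0) ∧ ∃ N : ℕ, ∀ l, N < l → ∀ k, f l k = 0}
  add_mem' := by
    rintro f g ⟨h1, h2, N, h3⟩ ⟨h1', h2', N', h3'⟩
    refine ⟨fun l k n => ?_, fun k hk => ?_, max N N', fun l hl k => ?_⟩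
    · simp only [Pi.add_apply, h1, h1']
    · simp only [Pi.add_apply, h2 k hk, h2' k hk, add_zero]
    · simp only [Pi.add_apply, h3 l (lt_of_le_of_lt (le_max_left _ _) hl),
        h3' l (lt_of_le_of_lt (le_max_right _ _) hl), add_zero]
  zero_mem' := ⟨fun _ _ _ => rfl, fun _ _ => rfl, 0, fun _ _ _ => rfl⟩
  smul_mem' := by
    rintro c f ⟨h1, h2, N, h3⟩
    refine ⟨fun l k n => ?_, fun k hk => ?_, N, fun l hl k => ?_⟩
    · simp only [Pi.smul_apply, h1]
    · simp only [Pi.smul_apply, h2 k hk, smul_zero]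
    · simp only [Pi.smul_apply, h3 l hl, smul_zero]

/-- The ring `R(T) = ⨁_l Hom (L, ρ^l L)` of the symplectic torus `T = (ℝ⁴/ℤ⁴, ω)`. -/
def TorusRing (_ω : SymplecticForm) : Type := morphisms

namespace TorusRing

variable {ω : SymplecticForm}

instance : AddCommGroup (TorusRing ω) := inferInstanceAs (AddCommGroup morphisms)
instance : Module ℂ (TorusRing ω) := inferInstanceAs (Module ℂ morphisms)

/-- The coefficients of an element of `R(T)`. -/
def coeff (f : TorusRing ω) : ℕ → ℤ × ℤ → ℂ := Subtype.val (p := fun g => g ∈ morphisms) f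

theorem mem (f : TorusRing ω) : f.coeff ∈ morphisms :=
  Subtype.property (p := fun g => g ∈ morphisms) f

/-- The element of `R(T)` with given coefficients. -/
def mk (f : ℕ → ℤ × ℤ → ℂ) (hf : f ∈ morphisms) : TorusRing ω :=
  Subtype.mk (p := fun g => g ∈ morphisms) f hf

@[simp]
theorem coeff_mk (f : ℕ → ℤ × ℤ → ℂ) (hf : f ∈ morphisms) : (mk f hf : TorusRing ω).coeff = f := rfl

theorem ext {f g : TorusRing ω} (h : ∀ l k, f.coeff l k = g.coeff l k) : f = g :=
  Subtype.ext (p := fun g => g ∈ morphisms) (funext fun l => funext fun k => h l k)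

theorem coeff_zero (l : ℕ) (k : ℤ × ℤ) : (0 : TorusRing ω).coeff l k = 0 := rfl

theorem coeff_add (f g : TorusRing ω) (l : ℕ) (k : ℤ × ℤ) :
    (f + g).coeff l k = f.coeff l k + g.coeff l k := rfl

theorem coeff_smul (c : ℂ) (f : TorusRing ω) (l : ℕ) (k : ℤ × ℤ) :
    (c • f).coeff l k = c * f.coeff l k := rfl

/-- The product of `f` and `g`, where `Hom (L, ρ^m L)` is identified with
`Hom (ρ^l L, ρ^{l+m} L)` by `ρ^l`: the coefficient at an intersection point of `L` and `ρ^n L` is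
the sum over all holomorphic triangles with that corner. -/
def mulFun (ω : SymplecticForm) (f g : ℕ → ℤ × ℤ → ℂ) (n : ℕ) (k : ℤ × ℤ) : ℂ :=
  ∑ p ∈ Finset.HasAntidiagonal.antidiagonal n, ∑' a : ℤ × ℤ, weight ω p.1 p.2 a (k - a) * f p.1 a * g p.2 (k - a)

theorem mulFun_mem (f g : TorusRing ω) : mulFun ω f.coeff g.coeff ∈ morphisms := by
  obtain ⟨h1, h2, N, h3⟩ := f.mem
  obtain ⟨h1', h2', N', h3'⟩ := g.mem
  refine ⟨fun n k v => ?_, fun k hk => ?_, N + N', fun n hn k => ?_⟩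
  · unfold mulFun
    refine Finset.sum_congr rfl fun p hp => ?_
    have hp' : p.1 + p.2 = n := Finset.HasAntidiagonal.mem_antidiagonal.1 hp
    rw [← (Equiv.addRight ((2 * p.1 : ℤ) • v)).tsum_eq]
    refine tsum_congr fun a => ?_
    have e : k + (2 * n : ℤ) • v - (a + (2 * p.1 : ℤ) • v) = k - a + (2 * p.2 : ℤ) • v := by
      rw [← hp']; push_cast; module
    simp only [Equiv.coe_addRight]
    rw [e, h1, h1']
    rcases Nat.eq_zero_or_pos p.1 with h0 | hl
    · by_cases ha : a = 0
      · subst ha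
        simp [h0, weight_zero_left]
      · simp [h0, h2 a ha]
    rcases Nat.eq_zero_or_pos p.2 with h0 | hm
    · by_cases ha : k - a = 0
      · rw [ha]
        simp [h0, weight_zero_right]
      · simp [h0, h2' _ ha]
    rw [weight_add ω hl hm]
  · simp only [mulFun, Finset.HasAntidiagonal.antidiagonal_zero, Finset.sum_singleton]
    rw [← tsum_zero (α := ℂ) (β := ℤ × ℤ)]
    refine tsum_congr fun a => ?_
    by_cases ha : a = 0
    · rw [ha, sub_zero, h2' k hk, mul_zero]
    · rw [h2 a ha, mul_zero, zero_mul]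
  · refine Finset.sum_eq_zero fun p hp => ?_
    have hp' : p.1 + p.2 = n := Finset.HasAntidiagonal.mem_antidiagonal.1 hp
    rw [← tsum_zero (α := ℂ) (β := ℤ × ℤ)]
    refine tsum_congr fun a => ?_
    by_cases hN : N < p.1
    · rw [h3 _ hN, mul_zero, zero_mul]
    · rw [h3' _ (by omega), mul_zero]

instance : Mul (TorusRing ω) := ⟨fun f g => mk (mulFun ω f.coeff g.coeff) (mulFun_mem f g)⟩

theorem coeff_mul (f g : TorusRing ω) (n : ℕ) (k : ℤ × ℤ) :
    (f * g).coeff n k = ∑ p ∈ Finset.HasAntidiagonal.antidiagonal n,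
      ∑' a : ℤ × ℤ, weight ω p.1 p.2 a (k - a) * f.coeff p.1 a * g.coeff p.2 (k - a) := rfl

/-- The unit is the generator of `Hom (L, L) = ℂ`. -/
instance : One (TorusRing ω) :=
  ⟨mk (fun l k => if l = 0 ∧ k = 0 then 1 else 0) (by
    refine ⟨fun l k n => ?_, fun k hk => if_neg fun h => hk h.2, 0, fun l hl k =>
      if_neg fun h => hl.ne' h.1⟩
    by_cases hl : l = 0
    · subst hl; simp
    · simp [hl])⟩

theorem coeff_one (l : ℕ) (k : ℤ × ℤ) :
    (1 : TorusRing ω).coeff l k = if l = 0 ∧ k = 0 then 1 else 0 := rfl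

theorem summable_mul_gauss (f : TorusRing ω) (l : ℕ) :
    Summable fun k => f.coeff l k * gauss ω l k := by
  obtain ⟨h1, h2, -⟩ := f.mem
  rcases Nat.eq_zero_or_pos l with rfl | hl
  · refine summable_of_ne_finset_zero (s := {0}) fun k hk => ?_
    rw [h2 k (by simpa using hk), zero_mul]
  let S : Finset (ℤ × ℤ) := Finset.Ico 0 (2 * l : ℤ) ×ˢ Finset.Ico 0 (2 * l : ℤ)
  have hb : ∀ k, ‖f.coeff l k‖ ≤ ∑ s ∈ S, ‖f.coeff l s‖ := fun k => by
    have h2l : (0 : ℤ) < 2 * l := by omega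
    have e : f.coeff l k = f.coeff l (k.1 % (2 * l), k.2 % (2 * l)) := by
      rw [← h1 l (k.1 % (2 * l), k.2 % (2 * l)) (k.1 / (2 * l), k.2 / (2 * l))]
      congr 1
      ext
      · simpa using (Int.emod_add_mul_ediv k.1 (2 * l)).symm
      · simpa using (Int.emod_add_mul_ediv k.2 (2 * l)).symm
    rw [e]
    refine Finset.single_le_sum (f := fun s => ‖f.coeff l s‖) (fun _ _ => norm_nonneg _) ?_
    simp only [S, Finset.mem_product, Finset.mem_Ico]
    exact ⟨⟨Int.emod_nonneg _ h2l.ne', Int.emod_lt_of_pos _ h2l⟩,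
      ⟨Int.emod_nonneg _ h2l.ne', Int.emod_lt_of_pos _ h2l⟩⟩
  refine Summable.of_norm_bounded ((summable_gauss ω hl).norm.mul_left (∑ s ∈ S, ‖f.coeff l s‖)) ?_
  intro k
  rw [norm_mul]
  exact mul_le_mul_of_nonneg_right (hb k) (norm_nonneg _)

/-- An auxiliary embedding of `R(T)` into a power series ring. -/
def toSeries (f : TorusRing ω) : PowerSeries SummableFun :=
  PowerSeries.mk fun l => SummableFun.mk (fun k => f.coeff l k * gauss ω l k) (summable_mul_gauss f l)

theorem coeff_toSeries (f : TorusRing ω) (l : ℕ) : PowerSeries.coeff l (toSeries f) =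
    SummableFun.mk (fun k => f.coeff l k * gauss ω l k) (summable_mul_gauss f l) :=
  PowerSeries.coeff_mk _ _

theorem toSeries_injective : Function.Injective (toSeries (ω := ω)) := by
  intro f g h
  refine ext fun l k => ?_
  have h1 := congrArg (fun s => (PowerSeries.coeff l s).1 k) h
  simp only [coeff_toSeries] at h1
  exact mul_right_cancel₀ (gauss_ne_zero ω l k) h1

theorem toSeries_add (f g : TorusRing ω) : toSeries (f + g) = toSeries f + toSeries g := by
  ext l
  rw [map_add]
  simp only [coeff_toSeries]
  refine SummableFun.ext fun k => ?_
  simp only [SummableFun.add_val, SummableFun.mk_val, coeff_add, add_mul]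

theorem toSeries_one : toSeries (1 : TorusRing ω) = 1 := by
  ext l
  rw [PowerSeries.coeff_one]
  simp only [coeff_toSeries]
  refine SummableFun.ext fun k => ?_
  by_cases hl : l = 0
  · subst hl
    rw [if_pos rfl, SummableFun.one_val, SummableFun.mk_val]
    by_cases hk : k = 0
    · simp [hk, coeff_one, gauss, quadForm]
    · simp [hk, coeff_one]
  · rw [if_neg hl]
    show (1 : TorusRing ω).coeff l k * gauss ω l k = 0
    simp [coeff_one, hl]

theorem toSeries_mul (f g : TorusRing ω) : toSeries (f * g) = toSeries f * toSeries g := by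
  ext n
  rw [PowerSeries.coeff_mul]
  simp only [coeff_toSeries]
  refine SummableFun.ext fun k => ?_
  rw [SummableFun.sum_val, SummableFun.mk_val, coeff_mul, Finset.sum_mul]
  refine Finset.sum_congr rfl fun p hp => ?_
  have hp' : p.1 + p.2 = n := Finset.HasAntidiagonal.mem_antidiagonal.1 hp
  rw [SummableFun.mul_val, SummableFun.mk_val, SummableFun.mk_val, ← tsum_mul_right]
  refine tsum_congr fun a => ?_
  by_cases ha : p.1 = 0 ∧ a ≠ 0
  · have : f.coeff p.1 a = 0 := by rw [ha.1]; exact f.mem.2.1 a ha.2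
    simp [this]
  by_cases hc : p.2 = 0 ∧ k - a ≠ 0
  · have : g.coeff p.2 (k - a) = 0 := by rw [hc.1]; exact g.mem.2.1 _ hc.2
    simp [this]
  have hw := weight_mul_gauss ω (l := p.1) (m := p.2) (a := a) (c := k - a)
    (fun h => by_contra fun h' => ha ⟨h, h'⟩) (fun h => by_contra fun h' => hc ⟨h, h'⟩)
  rw [hp', add_sub_cancel] at hw
  calc _ = (weight ω p.1 p.2 a (k - a) * gauss ω n k) * (f.coeff p.1 a * g.coeff p.2 (k - a)) := by ring
    _ = _ := by rw [hw]; ring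

theorem toSeries_zero : toSeries (0 : TorusRing ω) = 0 := by
  ext l
  refine SummableFun.ext fun k => ?_
  simp only [coeff_toSeries]
  exact zero_mul _

instance : CommRing (TorusRing ω) where
  __ := (inferInstance : AddCommGroup (TorusRing ω))
  mul_assoc f g h := toSeries_injective (by simp only [toSeries_mul, mul_assoc])
  mul_comm f g := toSeries_injective (by simp only [toSeries_mul, mul_comm])
  one_mul f := toSeries_injective (by simp only [toSeries_mul, toSeries_one, one_mul])
  mul_one f := toSeries_injective (by simp only [toSeries_mul, toSeries_one, mul_one])
  left_distrib f g h := toSeries_injective (by simp only [toSeries_mul, toSeries_add, mul_add])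
  right_distrib f g h := toSeries_injective (by simp only [toSeries_mul, toSeries_add, add_mul])
  zero_mul f := toSeries_injective (by simp only [toSeries_mul, toSeries_zero, zero_mul])
  mul_zero f := toSeries_injective (by simp only [toSeries_mul, toSeries_zero, mul_zero])

instance : Algebra ℂ (TorusRing ω) := Algebra.ofModule
  (fun c f g => ext fun n k => by
    rw [coeff_smul, coeff_mul, coeff_mul, Finset.mul_sum]
    refine Finset.sum_congr rfl fun p _ => ?_
    rw [← tsum_mul_left]
    exact tsum_congr fun a => by rw [coeff_smul]; ring)
  (fun c f g => ext fun n k => by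
    rw [coeff_smul, coeff_mul, coeff_mul, Finset.mul_sum]
    refine Finset.sum_congr rfl fun p _ => ?_
    rw [← tsum_mul_left]
    exact tsum_congr fun a => by rw [coeff_smul]; ring)

end TorusRing

/-! ### The Fukaya ring of the Kummer surface -/

/-- The ring `R(K)` of the symplectic Kummer surface `K = T/ι`, the `ι`-invariant part of `R(T)`:
the involution `ι(x, y) = (-x, -y)` maps `y^l_k` to `y^l_{-k}`. -/
def kummerRing (ω : SymplecticForm) : Subalgebra ℂ (TorusRing ω) where
  carrier := {f | ∀ l k, f.coeff l (-k) = f.coeff l k}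
  add_mem' := by
    intro f g hf hg l k
    rw [TorusRing.coeff_add, TorusRing.coeff_add, hf, hg]
  mul_mem' := by
    intro f g hf hg n k
    rw [TorusRing.coeff_mul, TorusRing.coeff_mul]
    refine Finset.sum_congr rfl fun p _ => ?_
    rw [← (Equiv.neg (ℤ × ℤ)).tsum_eq]
    refine tsum_congr fun a => ?_
    have e : -k - -a = -(k - a) := by abel
    simp only [Equiv.neg_apply]
    rw [e, weight_neg, hf, hg]
  algebraMap_mem' := by
    intro c l k
    rw [Algebra.algebraMap_eq_smul_one, TorusRing.coeff_smul, TorusRing.coeff_smul,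
      TorusRing.coeff_one, TorusRing.coeff_one]
    simp

namespace kummerRing

variable {ω : SymplecticForm}

theorem ext {f g : kummerRing ω} (h : ∀ l k, f.1.coeff l k = g.1.coeff l k) : f = g :=
  Subtype.ext (TorusRing.ext h)

/-- The part of degree `l` of `R(K)`. -/
def grading (ω : SymplecticForm) (l : ℕ) : Submodule ℂ (kummerRing ω) where
  carrier := {f | ∀ m k, m ≠ l → f.1.coeff m k = 0}
  add_mem' := by
    intro f g hf hg m k hm
    show f.1.coeff m k + g.1.coeff m k = 0
    rw [hf m k hm, hg m k hm, add_zero]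
  zero_mem' := fun _ _ _ => rfl
  smul_mem' := by
    intro c f hf m k hm
    show c * f.1.coeff m k = 0
    rw [hf m k hm, mul_zero]

/-- The component of degree `l` of an element of `R(K)`. -/
def component (f : kummerRing ω) (l : ℕ) : grading ω l :=
  ⟨⟨TorusRing.mk (fun m k => if m = l then f.1.coeff m k else 0) (by
    obtain ⟨h1, h2, N, h3⟩ := f.1.mem
    refine ⟨fun m k n => ?_, fun k hk => ?_, N, fun m hm k => ?_⟩
    · show (if _ then _ else _) = if _ then _ else _
      rw [h1]
    · show (if _ then _ else _) = _
      rw [h2 k hk, ite_self]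
    · show (if _ then _ else _) = _
      rw [h3 m hm, ite_self]), fun m k => by
    show (if _ then _ else _) = if _ then _ else _
    rw [f.2]⟩, fun m k hm => if_neg hm⟩

theorem component_val (f : kummerRing ω) (l m : ℕ) (k : ℤ × ℤ) :
    (component f l).1.1.coeff m k = if m = l then f.1.coeff m k else 0 := rfl

instance : SetLike.GradedMonoid (grading ω) where
  one_mem := fun m k hm => if_neg fun h => hm h.1
  mul_mem := by
    intro i j f g hf hg n k hn
    show (f.1 * g.1).coeff n k = 0
    rw [TorusRing.coeff_mul]
    refine Finset.sum_eq_zero fun p hp => ?_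
    have hp' : p.1 + p.2 = n := Finset.HasAntidiagonal.mem_antidiagonal.1 hp
    rw [← tsum_zero (α := ℂ) (β := ℤ × ℤ)]
    refine tsum_congr fun a => ?_
    by_cases h1 : p.1 = i
    · rw [hg _ _ (by omega), mul_zero]
    · rw [hf _ _ h1, mul_zero, zero_mul]

theorem sum_val {ι : Type} (s : Finset ι) (f : ι → kummerRing ω) (l : ℕ) (k : ℤ × ℤ) :
    (∑ i ∈ s, f i).1.coeff l k = ∑ i ∈ s, (f i).1.coeff l k := by
  classical
  induction s using Finset.induction_on with
  | empty => rfl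
  | insert a s h ih => rw [Finset.sum_insert h, Finset.sum_insert h, ← ih]; rfl

open DirectSum in
theorem coe_val (x : ⨁ l, grading ω l) (l : ℕ) (k : ℤ × ℤ) :
    (DirectSum.coeAddMonoidHom (grading ω) x).1.coeff l k = (x l).1.1.coeff l k := by
  induction x using DirectSum.induction_on with
  | zero => rw [map_zero]; rfl
  | of i x =>
    rw [DirectSum.coeAddMonoidHom_of]
    by_cases h : i = l
    · subst h; rw [DirectSum.of_eq_same]
    · rw [DirectSum.of_eq_of_ne _ _ _ (Ne.symm h), x.2 l k (Ne.symm h)]; rfl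
  | add x y hx hy =>
    rw [map_add]
    exact congrArg₂ (fun a b : ℂ => a + b) hx hy

instance : DirectSum.Decomposition (grading ω) where
  decompose' f := DirectSum.mk (fun l => grading ω l)
    (Finset.range (f.1.mem.2.2.choose + 1)) fun l => component f l
  left_inv f := by
    refine ext fun l k => ?_
    rw [coe_val]
    by_cases hl : l ∈ Finset.range (f.1.mem.2.2.choose + 1)
    · rw [DirectSum.mk_apply_of_mem hl, component_val, if_pos rfl]
    · rw [DirectSum.mk_apply_of_notMem hl]
      exact (f.1.mem.2.2.choose_spec l (by simpa using hl) k).symm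
  right_inv x := by
    refine DFinsupp.ext fun l => Subtype.ext (ext fun m k => ?_)
    set f := DirectSum.coeAddMonoidHom (grading ω) x with hf
    by_cases hm : m = l
    · subst hm
      rw [← coe_val x m k]
      by_cases hl : m ∈ Finset.range (f.1.mem.2.2.choose + 1)
      · rw [DirectSum.mk_apply_of_mem hl, component_val, if_pos rfl]
      · rw [DirectSum.mk_apply_of_notMem hl]
        exact (f.1.mem.2.2.choose_spec m (by simpa using hl) k).symm
    · rw [(x l).2 m k hm]
      exact Subtype.property
        ((DirectSum.mk (fun l => grading ω l)
          (Finset.range (f.1.mem.2.2.choose + 1)) fun l => component f l) l) m k hm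

instance : GradedAlgebra (grading ω) where

end kummerRing

/-! ### Generators, theta functions and the Kummer quartic -/

/-- The lifts `v, k ∈ ℤ²` represent the same point of `(ℤ/2l)²`. -/
def SamePoint (l : ℕ+) (v k : ℤ × ℤ) : Prop :=
  (2 * (l : ℕ) : ℤ) ∣ v.1 - k.1 ∧ (2 * (l : ℕ) : ℤ) ∣ v.2 - k.2

open Classical in
/-- The basis element `y^l_k` of `R(T)`, `k ∈ ℤ²` representing an element of `(ℤ/2l)²`. -/
def torusGen (ω : SymplecticForm) (l : ℕ+) (k : ℤ × ℤ) : TorusRing ω :=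
  TorusRing.mk (fun n v => if n = (l : ℕ) ∧ SamePoint l v k then 1 else 0) (by
    refine ⟨fun n v u => ?_, fun v _ => if_neg fun h => l.pos.ne h.1, l, fun n hn v =>
      if_neg fun h => hn.ne' h.1⟩
    by_cases hn : n = (l : ℕ)
    · subst hn
      have h1 : SamePoint l (v + (2 * (l : ℕ) : ℤ) • u) k ↔ SamePoint l v k := by
        simp only [SamePoint, Prod.fst_add, Prod.snd_add, Prod.smul_fst, Prod.smul_snd,
          smul_eq_mul, add_sub_right_comm]
        simp
      simp only [h1]
    · simp [hn])

open Classical in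
theorem coeff_torusGen (ω : SymplecticForm) (l : ℕ+) (k : ℤ × ℤ) (n : ℕ) (v : ℤ × ℤ) :
    (torusGen ω l k).coeff n v = if n = (l : ℕ) ∧ SamePoint l v k then 1 else 0 := rfl

open Classical in
/-- The basis element of `R(K)` given by the image of `y^l_k` under the identification of
generators in the same orbit of `ι`: the sum of the orbit `{y^l_k, y^l_{-k}}`, which is `y^l_k` if
this point is fixed by `ι` and `y^l_k + y^l_{-k}` otherwise. -/
def kummerGen (ω : SymplecticForm) (l : ℕ+) (k : ℤ × ℤ) : kummerRing ω :=
  ⟨∑ y ∈ {torusGen ω l k, torusGen ω l (-k)}, y, by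
    have hneg : ∀ k n v, (torusGen ω l k).coeff n (-v) = (torusGen ω l (-k)).coeff n v := by
      intro k n v
      have : SamePoint l (-v) k ↔ SamePoint l v (-k) := by
        simp only [SamePoint, Prod.fst_neg, Prod.snd_neg]
        rw [← dvd_neg, ← dvd_neg (b := -v.2 - k.2)]
        simp [add_comm]
      simp only [coeff_torusGen, this]
    intro n v
    by_cases h : torusGen ω l k = torusGen ω l (-k)
    · rw [← h, Finset.pair_eq_singleton, Finset.sum_singleton, hneg, ← h]
    · rw [Finset.sum_pair h, TorusRing.coeff_add, TorusRing.coeff_add, hneg, hneg, neg_neg,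
        add_comm]⟩

theorem kummerGen_mem (ω : SymplecticForm) (l : ℕ+) (k : ℤ × ℤ) :
    kummerGen ω l k ∈ kummerRing.grading ω l := by
  have h0 : ∀ k n v, n ≠ (l : ℕ) → (torusGen ω l k).coeff n v = 0 :=
    fun k n v hn => if_neg fun h => hn h.1
  classical
  intro n v hn
  show TorusRing.coeff (Finset.sum _ _) n v = 0
  by_cases h : torusGen ω l k = torusGen ω l (-k)
  · rw [← h, Finset.pair_eq_singleton, Finset.sum_singleton, h0 k n v hn]
  · rw [Finset.sum_pair h, TorusRing.coeff_add, h0 k n v hn, h0 (-k) n v hn, add_zero]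

/-- The degree one generators `X₀ = y¹_{0,0}`, `X₁ = y¹_{1,0}`, `X₂ = y¹_{0,1}`, `X₃ = y¹_{1,1}`. -/
def coordX (ω : SymplecticForm) : Fin 4 → kummerRing ω :=
  ![kummerGen ω 1 (0, 0), kummerGen ω 1 (1, 0), kummerGen ω 1 (0, 1), kummerGen ω 1 (1, 1)]

theorem coordX_mem (ω : SymplecticForm) (i : Fin 4) : coordX ω i ∈ kummerRing.grading ω 1 := by
  fin_cases i <;> exact kummerGen_mem ω 1 _

/-- The five quartic expressions `W₀, …, W₄` in four elements of a commutative ring. -/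
def quarticW {R : Type} [CommRing R] (X : Fin 4 → R) : Fin 5 → R :=
  ![X 0 ^ 4 + X 1 ^ 4 + X 2 ^ 4 + X 3 ^ 4,
    X 0 ^ 2 * X 1 ^ 2 + X 2 ^ 2 * X 3 ^ 2,
    X 0 ^ 2 * X 2 ^ 2 + X 1 ^ 2 * X 3 ^ 2,
    X 0 ^ 2 * X 3 ^ 2 + X 1 ^ 2 * X 2 ^ 2,
    X 0 * X 1 * X 2 * X 3]

/-- The elements `Z₀, …, Z₃` of degree four. -/
def elemZ (ω : SymplecticForm) : Fin 4 → kummerRing ω :=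
  ![kummerGen ω 4 (0, 0) + kummerGen ω 4 (4, 0) + kummerGen ω 4 (0, 4) + kummerGen ω 4 (4, 4),
    kummerGen ω 4 (2, 0) + kummerGen ω 4 (2, 4),
    kummerGen ω 4 (0, 2) + kummerGen ω 4 (4, 2),
    kummerGen ω 4 (2, 2) + kummerGen ω 4 (2, 6)]

/-- The theta function `θ(a, b, l)`. -/
def theta (ω : SymplecticForm) (a b : ℤ) (l : ℕ) : ℂ :=
  ∑' p : ℤ × ℤ,
    Complex.exp (4 * l * Real.pi * Complex.I * ω.τ₁ * ((a : ℂ) / (4 * l) + p.1) ^ 2)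
      * Complex.exp (4 * l * Real.pi * Complex.I * ω.τ₂ * ((b : ℂ) / (4 * l) + p.2) ^ 2)
      * Complex.exp (8 * l * Real.pi * Complex.I * ω.τ₃
          * ((a : ℂ) / (4 * l) + p.1) * ((b : ℂ) / (4 * l) + p.2))

theorem weight_self (ω : SymplecticForm) (l : ℕ+) (a b c d : ℤ) :
    weight ω l l (a, b) (c, d) =
      Complex.exp (4 * (l : ℕ) * Real.pi * Complex.I * ω.τ₁ * (((c : ℂ) - a) / (4 * (l : ℕ))) ^ 2)
      * Complex.exp (4 * (l : ℕ) * Real.pi * Complex.I * ω.τ₂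
          * (((d : ℂ) - b) / (4 * (l : ℕ))) ^ 2)
      * Complex.exp (8 * (l : ℕ) * Real.pi * Complex.I * ω.τ₃
          * (((c : ℂ) - a) / (4 * (l : ℕ))) * (((d : ℂ) - b) / (4 * (l : ℕ)))) := by
  unfold weight
  rw [← Complex.exp_add, ← Complex.exp_add, rho_iterate_pt]
  congr 1
  have key : ∀ u v : Vec, u - v = ⟨u.x₁ - v.x₁, u.y₁ - v.y₁, u.x₂ - v.x₂, u.y₂ - v.y₂⟩ :=
    fun _ _ => rfl
  simp only [SymplecticForm.triangleArea, SymplecticForm.eval, key, pt, shiftY,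
    Prod.mk_add_mk]
  have h1 : ((l : ℕ) : ℂ) ≠ 0 := by exact_mod_cast l.pos.ne'
  push_cast
  field_simp
  ring

/-- The product of basis elements of the same degree in `R(T)`, through theta functions. -/
theorem torusGen_mul_torusGen (ω : SymplecticForm) (l : ℕ+) (a b c d : ℤ) :
    torusGen ω l (a, b) * torusGen ω l (c, d) = ∑ i ∈ Finset.range 2, ∑ j ∈ Finset.range 2,
      theta ω (c - a + 2 * i * (l : ℕ)) (d - b + 2 * j * (l : ℕ)) l •
        torusGen ω (2 * l) (a + c + 2 * (l : ℕ) * i, b + d + 2 * (l : ℕ) * j) := by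
  classical
  refine TorusRing.ext fun n v => ?_
  obtain ⟨v1, v2⟩ := v
  have hl : (0 : ℤ) < (l : ℕ) := by exact_mod_cast l.pos
  simp only [Finset.sum_range_succ, Finset.sum_range_zero, zero_add, TorusRing.coeff_add,
    TorusRing.coeff_smul, coeff_torusGen, TorusRing.coeff_mul]
  by_cases hn : n = 2 * (l : ℕ)
  swap
  · rw [Finset.sum_eq_zero]
    · simp [hn]
    · intro p hp
      have hp' : p.1 + p.2 = n := Finset.HasAntidiagonal.mem_antidiagonal.1 hp
      rw [← tsum_zero (α := ℂ) (β := ℤ × ℤ)]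
      refine tsum_congr fun x => ?_
      by_cases h1 : p.1 = (l : ℕ)
      · have h2 : p.2 ≠ (l : ℕ) := by omega
        simp [h2]
      · simp [h1]
  subst hn
  rw [Finset.sum_eq_single ((l : ℕ), (l : ℕ))]
  rotate_left
  · intro p hp hne
    have hp' : p.1 + p.2 = _ := Finset.HasAntidiagonal.mem_antidiagonal.1 hp
    rw [← tsum_zero (α := ℂ) (β := ℤ × ℤ)]
    refine tsum_congr fun x => ?_
    have h1 : p.1 ≠ (l : ℕ) := fun h1 => hne (Prod.ext h1 (show p.2 = (l : ℕ) by omega))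
    simp [h1]
  · intro h
    exact absurd (Finset.HasAntidiagonal.mem_antidiagonal.2 (by omega)) h
  simp only [SamePoint, PNat.mul_coe, PNat.val_ofNat, true_and, Prod.fst_sub, Prod.snd_sub]
  push_cast
  by_cases hv : (2 * (l : ℕ) : ℤ) ∣ v1 - (a + c) ∧ (2 * (l : ℕ) : ℤ) ∣ v2 - (b + d)
  swap
  · have hR : ∀ i j : ℤ, ¬ ((2 * (2 * (l : ℕ)) : ℤ) ∣ v1 - (a + c + 2 * (l : ℕ) * i) ∧
        (2 * (2 * (l : ℕ)) : ℤ) ∣ v2 - (b + d + 2 * (l : ℕ) * j)) := by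
      rintro i j ⟨⟨s, hs⟩, ⟨t, ht⟩⟩
      exact hv ⟨⟨2 * s + i, by linarith⟩, ⟨2 * t + j, by linarith⟩⟩
    rw [if_neg (hR 0 0), if_neg (hR 0 1), if_neg (hR 1 0), if_neg (hR 1 1)]
    simp only [mul_zero, add_zero]
    refine (tsum_congr fun x => ?_).trans tsum_zero
    by_cases h1 : (2 * (l : ℕ) : ℤ) ∣ x.1 - a ∧ (2 * (l : ℕ) : ℤ) ∣ x.2 - b
    · rw [if_neg (c := (2 * (l : ℕ) : ℤ) ∣ v1 - x.1 - c ∧ _), mul_zero]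
      rintro ⟨h2, h3⟩
      refine hv ⟨?_, ?_⟩
      · have h4 := dvd_add h1.1 h2
        rwa [show x.1 - a + (v1 - x.1 - c) = v1 - (a + c) by ring] at h4
      · have h4 := dvd_add h1.2 h3
        rwa [show x.2 - b + (v2 - x.2 - d) = v2 - (b + d) by ring] at h4
    · rw [if_neg h1, mul_zero, zero_mul]
  obtain ⟨⟨s, hs⟩, ⟨t, ht⟩⟩ := hv
  have hL : ∀ (i j σ τ : ℤ), s = i + 2 * σ → t = j + 2 * τ →
      ∑' x : ℤ × ℤ, weight ω l l x ((v1, v2) - x) *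
        (if (2 * (l : ℕ) : ℤ) ∣ x.1 - a ∧ (2 * (l : ℕ) : ℤ) ∣ x.2 - b then 1 else 0) *
        (if (2 * (l : ℕ) : ℤ) ∣ v1 - x.1 - c ∧ (2 * (l : ℕ) : ℤ) ∣ v2 - x.2 - d then 1 else 0)
      = theta ω (c - a + 2 * i * (l : ℕ)) (d - b + 2 * j * (l : ℕ)) l := by
    intro i j σ τ hi hj
    have hinj : Function.Injective fun u : ℤ × ℤ =>
        ((a + 2 * (l : ℕ) * (σ - u.1), b + 2 * (l : ℕ) * (τ - u.2)) : ℤ × ℤ) := by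
      intro u u' h
      have h2l : (2 * (l : ℕ) : ℤ) ≠ 0 := by omega
      have e1 := mul_left_cancel₀ h2l (add_left_cancel (congrArg Prod.fst h))
      have e2 := mul_left_cancel₀ h2l (add_left_cancel (congrArg Prod.snd h))
      exact Prod.ext (by linarith) (by linarith)
    rw [← hinj.tsum_eq, theta]
    · refine tsum_congr fun u => ?_
      dsimp only
      rw [if_pos ⟨⟨σ - u.1, by ring⟩, ⟨τ - u.2, by ring⟩⟩,
        if_pos ⟨⟨s - (σ - u.1), by linarith⟩, ⟨t - (τ - u.2), by linarith⟩⟩, mul_one, mul_one]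
      have e1 : v1 = a + c + 2 * (l : ℕ) * (i + 2 * σ) := by rw [← hi]; linarith
      have e2 : v2 = b + d + 2 * (l : ℕ) * (j + 2 * τ) := by rw [← hj]; linarith
      rw [Prod.mk_sub_mk, weight_self, e1, e2]
      have h1 : ((l : ℕ) : ℂ) ≠ 0 := by exact_mod_cast l.pos.ne'
      have h4 : (4 * (l : ℕ) : ℂ) ≠ 0 := mul_ne_zero (by norm_num) h1
      have q1 : ((a + c + 2 * (l : ℕ) * (i + 2 * σ) - (a + 2 * (l : ℕ) * (σ - u.1)) : ℤ) : ℂ)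
          - (a + 2 * (l : ℕ) * (σ - u.1) : ℤ) = (c - a + 2 * i * (l : ℕ) : ℤ)
            + 4 * (l : ℕ) * u.1 := by push_cast; ring
      have q2 : ((b + d + 2 * (l : ℕ) * (j + 2 * τ) - (b + 2 * (l : ℕ) * (τ - u.2)) : ℤ) : ℂ)
          - (b + 2 * (l : ℕ) * (τ - u.2) : ℤ) = (d - b + 2 * j * (l : ℕ) : ℤ)
            + 4 * (l : ℕ) * u.2 := by push_cast; ring
      rw [q1, q2, add_div, add_div, mul_div_cancel_left₀ _ h4,
        mul_div_cancel_left₀ _ h4]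
    · intro x hx
      rw [Function.mem_support] at hx
      by_cases h1 : (2 * (l : ℕ) : ℤ) ∣ x.1 - a ∧ (2 * (l : ℕ) : ℤ) ∣ x.2 - b
      · obtain ⟨⟨y, hy⟩, ⟨z, hz⟩⟩ := h1
        exact ⟨(σ - y, τ - z), Prod.ext (by dsimp only; linarith) (by dsimp only; linarith)⟩
      · rw [if_neg h1, mul_zero, zero_mul] at hx
        exact absurd rfl hx
  have hc : ∀ i j : ℤ, ((2 * (2 * (l : ℕ)) : ℤ) ∣ v1 - (a + c + 2 * (l : ℕ) * i) ∧
      (2 * (2 * (l : ℕ)) : ℤ) ∣ v2 - (b + d + 2 * (l : ℕ) * j)) ↔ (2 ∣ s - i ∧ 2 ∣ t - j) := by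
    intro i j
    have e1 : v1 - (a + c + 2 * (l : ℕ) * i) = 2 * (l : ℕ) * (s - i) := by linarith
    have e2 : v2 - (b + d + 2 * (l : ℕ) * j) = 2 * (l : ℕ) * (t - j) := by linarith
    have e3 : (2 * (2 * (l : ℕ)) : ℤ) = 2 * (l : ℕ) * 2 := by ring
    have h2l : (2 * (l : ℕ) : ℤ) ≠ 0 := by omega
    rw [e1, e2, e3, mul_dvd_mul_iff_left h2l, mul_dvd_mul_iff_left h2l]
  simp only [hc]
  rcases Int.even_or_odd' s with ⟨σ, h | h⟩ <;> rcases Int.even_or_odd' t with ⟨τ, h' | h'⟩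
  · have := hL 0 0 σ τ (by omega) (by omega)
    rw [this, if_pos (by omega), if_neg (by omega), if_neg (by omega), if_neg (by omega)]
    simp
  · have := hL 0 1 σ τ (by omega) (by omega)
    rw [this, if_neg (by omega), if_pos (by omega), if_neg (by omega), if_neg (by omega)]
    simp
  · have := hL 1 0 σ τ (by omega) (by omega)
    rw [this, if_neg (by omega), if_neg (by omega), if_pos (by omega), if_neg (by omega)]
    simp
  · have := hL 1 1 σ τ (by omega) (by omega)
    rw [this, if_neg (by omega), if_neg (by omega), if_neg (by omega), if_pos (by omega)]
    simp

/-- `g`, the first Kummer parameter of `ω`. -/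
def paramG (ω : SymplecticForm) : ℂ :=
  (1 / 2) * (theta ω 0 0 2 + theta ω 4 0 2 + theta ω 0 4 2 + theta ω 4 4 2)

/-- `h`, the second Kummer parameter of `ω`. -/
def paramH (ω : SymplecticForm) : ℂ := theta ω 2 0 2 + theta ω 2 4 2

/-- `j`, the third Kummer parameter of `ω`. -/
def paramJ (ω : SymplecticForm) : ℂ := theta ω 0 2 2 + theta ω 4 2 2

/-- `k`, the fourth Kummer parameter of `ω`. -/
def paramK (ω : SymplecticForm) : ℂ := theta ω 2 2 2 + theta ω 6 2 2

/-- The conditions on `(g : h : j : k) ∈ ℙ³` to parametrize a Kummer surface. -/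
structure IsKummerParameter (g h j k : ℂ) : Prop where
  gh_ne : g * h ≠ j * k
  gh_ne_neg : g * h ≠ -(j * k)
  gj_ne : g * j ≠ h * k
  gj_ne_neg : g * j ≠ -(h * k)
  gk_ne : g * k ≠ h * j
  gk_ne_neg : g * k ≠ -(h * j)
  sq_gh_ne : g ^ 2 + h ^ 2 ≠ j ^ 2 + k ^ 2
  sq_gj_ne : g ^ 2 + j ^ 2 ≠ h ^ 2 + k ^ 2
  sq_gk_ne : g ^ 2 + k ^ 2 ≠ h ^ 2 + j ^ 2
  sq_sum_ne : g ^ 2 + h ^ 2 + j ^ 2 + k ^ 2 ≠ 0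

/-- The coefficient vector `[1, A, B, C, D]` of the Kummer quartic with parameters `g, h, j, k`. -/
def quarticCoeff (g h j k : ℂ) : Fin 5 → ℂ :=
  ![1,
    (j ^ 4 + k ^ 4 - h ^ 4 - g ^ 4) / (h ^ 2 * g ^ 2 - j ^ 2 * k ^ 2),
    (k ^ 4 + h ^ 4 - j ^ 4 - g ^ 4) / (j ^ 2 * g ^ 2 - h ^ 2 * k ^ 2),
    (h ^ 4 + j ^ 4 - k ^ 4 - g ^ 4) / (k ^ 2 * g ^ 2 - j ^ 2 * h ^ 2),
    2 * (h * j * k * g * (g ^ 2 + h ^ 2 - j ^ 2 - k ^ 2) * (g ^ 2 + j ^ 2 - k ^ 2 - h ^ 2)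
        * (g ^ 2 - h ^ 2 - j ^ 2 + k ^ 2) * (h ^ 2 + j ^ 2 + k ^ 2 + g ^ 2))
      / ((h ^ 2 * g ^ 2 - j ^ 2 * k ^ 2) * (j ^ 2 * g ^ 2 - h ^ 2 * k ^ 2)
        * (k ^ 2 * g ^ 2 - j ^ 2 * h ^ 2))]

/-- The Kummer quartic
`∑ Xᵢ⁴ + A (X₀²X₁² + X₂²X₃²) + B (X₀²X₂² + X₁²X₃²) + C (X₀²X₃² + X₁²X₂²) + D X₀X₁X₂X₃`. -/
def kummerQuartic (g h j k : ℂ) : MvPolynomial (Fin 4) ℂ :=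
  ∑ i, quarticCoeff g h j k i • quarticW (MvPolynomial.X (R := ℂ)) i

/-- The matrix `M`. -/
def matrixM (g h j k : ℂ) : Matrix (Fin 4) (Fin 5) ℂ :=
  !![8 * g ^ 3, 4 * h ^ 2 * g, 4 * j ^ 2 * g, 4 * k ^ 2 * g, 2 * j * k * h;
     8 * h ^ 3, 4 * g ^ 2 * h, 4 * k ^ 2 * h, 4 * j ^ 2 * h, 2 * j * k * g;
     8 * j ^ 3, 4 * k ^ 2 * j, 4 * g ^ 2 * j, 4 * h ^ 2 * j, 2 * h * g * k;
     8 * k ^ 3, 4 * j ^ 2 * k, 4 * h ^ 2 * k, 4 * g ^ 2 * k, 2 * h * g * j]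

/-- The set of singular points in `ℙ³` of the surface `F = 0`, for a homogeneous `F`. -/
def singularPoints (F : MvPolynomial (Fin 4) ℂ) : Set (Projectivization ℂ (Fin 4 → ℂ)) :=
  {p | MvPolynomial.eval p.rep F = 0 ∧ ∀ i, MvPolynomial.eval p.rep (MvPolynomial.pderiv i F) = 0}

/-- The Hessian matrix of `F` at `v`. -/
def hessian (F : MvPolynomial (Fin 4) ℂ) (v : Fin 4 → ℂ) : Matrix (Fin 4) (Fin 4) ℂ :=
  Matrix.of fun i j => MvPolynomial.eval v (MvPolynomial.pderiv i (MvPolynomial.pderiv j F))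

/-- `F = 0` is a Kummer surface in `ℙ³`: a quartic surface whose only singularities are sixteen
(ordinary) double points. A singular point is an ordinary double point when its tangent cone is
nondegenerate, that is, when the `4 × 4` Hessian, whose kernel contains the point, has rank `3`. -/
structure IsKummerSurface (F : MvPolynomial (Fin 4) ℂ) : Prop where
  isHomogeneous : F.IsHomogeneous 4
  ncard_singularPoints : (singularPoints F).ncard = 16
  isDoublePoint : ∀ p ∈ singularPoints F, (hessian F p.rep).rank = 3

/-- The homomorphism of graded `ℂ`-algebras `ℂ[X₀, …, X₃] → R(K)` that sends the variables to the
degree one generators of `R(K)`. -/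
def coordHom (ω : SymplecticForm) :
    MvPolynomial.homogeneousSubmodule (Fin 4) ℂ →+*ᵍ kummerRing.grading ω where
  toRingHom := (MvPolynomial.aeval (coordX ω)).toRingHom
  map_mem := by
    intro l p hp
    have hp' : p.IsHomogeneous l := hp
    show MvPolynomial.aeval (coordX ω) p ∈ _
    rw [MvPolynomial.aeval_def, MvPolynomial.eval₂_eq]
    refine Submodule.sum_mem _ fun d hd => ?_
    rw [← Algebra.smul_def]
    refine Submodule.smul_mem _ _ ?_
    have hd' : l = ∑ i ∈ d.support, d i • 1 := by
      have := hp' (MvPolynomial.mem_support_iff.1 hd)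
      simp only [smul_eq_mul, mul_one]
      rw [← this, Finsupp.weight_apply, Finsupp.sum]
      simp
    rw [hd']
    exact SetLike.prod_pow_mem_graded _ _ _ _ fun i _ => coordX_mem ω i

instance : GradedAlgebra (MvPolynomial.homogeneousSubmodule (Fin 4) ℂ) :=
  MvPolynomial.gradedAlgebra

end KummerMirror

end

open KummerMirror

/-! An element of degree `l` in the torus ring is read as a theta function on the real torus:
`y^l_a` becomes the sum over its lifts of `gauss ω l k` times the character `torusChar x k`. Since
`weight_mul_gauss` turns triangle weights into quotients of Gaussians, evaluation at a real point is
a ring homomorphism to power series, and by uniqueness of Fourier coefficients these homomorphisms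
separate elements. The functions extend holomorphically along complex lines, so the torus ring is a
domain.

In this picture the `X_i` are the four theta functions of order two with values `2(g, h, j, k)` at
the origin, and `Z_r(x) = X_r(2x)`. Riemann's relation for these functions is the identity `W = M Z`
(`quarticW_coordX`). Row `i` of `M` is twice the `i`-th partial derivative of `W_0, ..., W_4` at the
parameters, so its kernel consists of the Heisenberg-invariant quartics singular at `(g : h : j :
k)`; this is the line through the coefficient vector of `F`, and therefore `F(X) = 0` in the ring.

The same description of `M` determines the singular points of `F`: a point is singular when `M`,
taken at that point, kills the coefficient vector. In the squares of the coordinates the equations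
become quadratic, and a 4 by 4 Hadamard transform makes them multiplicative. The solutions are the
sixteen points of the Heisenberg orbit of the parameters. Each of them is again a parameter of the
same quartic, so the Hessian only has to be studied at `(g, h, j, k)`.

That there are no further relations follows from a growth argument. Let `d(m)` be the dimension of
the forms of degree `m` in the `X_i`. Since `Z_r(x) = X_r(2x)`, the `Z_r` satisfy the same relations
as the `X_i`; since `M` has rank four, they are quartics in the `X_i`; and they are fixed by the
Heisenberg group. Multiplying forms in the `Z_r` by eight nonzero quartics with distinct Heisenberg
characters gives `8 d(m) ≤ d(4m + 4)` (`eight_mul_finrank_le`), so `d` grows faster than linearly.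
Two relations without common factor would force linear growth, so all relations are multiples of a
single prime form `G` that divides `F`. The degree of `G` is even by commutation of Heisenberg
operators, and it is not two because the ten even quadrics are independent. Hence it is four
(`ker_aeval_coordX`).

Generation is then a dimension count: degree `l > 0` of the ring has dimension at most `2l² + 2`,
the number of orbits of `±1` on `(ℤ/2l)²`, while the forms of degree `l` modulo multiples of `F`
already have dimension at least `2l² + 2`. The statement about `Proj` holds for every surjective
graded homomorphism with principal kernel. -/

noncomputable section

namespace KummerMirror

/-! ### Evaluation of theta functions on the real torus -/

/-- The character `exp (2πi (k₁ x₁ + k₂ x₂))` of `ℤ²`. -/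
def torusChar (x : ℝ × ℝ) (k : ℤ × ℤ) : ℂ :=
  Complex.exp (2 * Real.pi * Complex.I * (k.1 * x.1 + k.2 * x.2))

theorem torusChar_add (x : ℝ × ℝ) (k m : ℤ × ℤ) :
    torusChar x (k + m) = torusChar x k * torusChar x m := by
  simp only [torusChar, ← Complex.exp_add, Prod.fst_add, Prod.snd_add]
  push_cast
  ring_nf

theorem torusChar_zero_right (x : ℝ × ℝ) : torusChar x 0 = 1 := by simp [torusChar]

theorem torusChar_zero_left (k : ℤ × ℤ) : torusChar 0 k = 1 := by simp [torusChar]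

theorem torusChar_two_smul (x : ℝ × ℝ) (k : ℤ × ℤ) :
    torusChar x ((2 : ℤ) • k) = torusChar ((2 : ℝ) • x) k := by
  simp only [torusChar, Prod.smul_fst, Prod.smul_snd, smul_eq_mul]
  push_cast
  ring_nf

theorem norm_torusChar (x : ℝ × ℝ) (k : ℤ × ℤ) : ‖torusChar x k‖ = 1 := by
  have e : 2 * (Real.pi : ℂ) * Complex.I * (k.1 * x.1 + k.2 * x.2)
      = ((2 * Real.pi * (k.1 * x.1 + k.2 * x.2) : ℝ) : ℂ) * Complex.I := by
    push_cast; ring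
  rw [torusChar, e, Complex.norm_exp_ofReal_mul_I]

theorem summable_mul_torusChar {F : ℤ × ℤ → ℂ} (hF : Summable F) (x : ℝ × ℝ) :
    Summable fun k => F k * torusChar x k :=
  Summable.of_norm_bounded hF.norm fun k => by rw [norm_mul, norm_torusChar, mul_one]

/-- The sum of the Fourier series with given coefficients. -/
def SummableFun.eval (x : ℝ × ℝ) : SummableFun →+* ℂ where
  toFun F := ∑' k, F.1 k * torusChar x k
  map_one' := by
    rw [tsum_eq_single 0 (by intro b hb; simp [SummableFun.one_val, hb])]
    simp [SummableFun.one_val, torusChar_zero_right]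
  map_zero' := (tsum_congr fun _ => zero_mul _).trans tsum_zero
  map_add' F G := by
    rw [← (summable_mul_torusChar F.2 x).tsum_add (summable_mul_torusChar G.2 x)]
    exact tsum_congr fun k => by rw [SummableFun.add_val, add_mul]
  map_mul' F G := by
    rw [tsum_mul_tsum_of_summable_norm (summable_mul_torusChar F.2 x).norm
      (summable_mul_torusChar G.2 x).norm]
    let e : (ℤ × ℤ) × (ℤ × ℤ) ≃ (ℤ × ℤ) × (ℤ × ℤ) :=
      ⟨fun p => (p.2, p.1 - p.2), fun p => (p.1 + p.2, p.1), fun p => by simp, fun p => by simp⟩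
    rw [← e.tsum_eq]
    have hs : Summable fun p : (ℤ × ℤ) × (ℤ × ℤ) =>
        F.1 p.2 * G.1 (p.1 - p.2) * torusChar x p.1 :=
      Summable.of_norm_bounded (SummableFun.summable_shear F G).norm fun p => by
        rw [norm_mul, norm_torusChar, mul_one]
    have he : ∀ p, F.1 (e p).1 * torusChar x (e p).1 * (G.1 (e p).2 * torusChar x (e p).2) =
        F.1 p.2 * G.1 (p.1 - p.2) * torusChar x p.1 := fun p => by
      have : torusChar x p.1 = torusChar x p.2 * torusChar x (p.1 - p.2) := by
        rw [← torusChar_add, add_sub_cancel]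
      rw [this]
      simp only [e, Equiv.coe_fn_mk]
      ring
    rw [tsum_congr he, hs.tsum_prod' (hs.prod_factor)]
    refine tsum_congr fun k => ?_
    rw [SummableFun.mul_val]
    exact tsum_mul_right.symm

theorem SummableFun.eval_apply (x : ℝ × ℝ) (F : SummableFun) :
    SummableFun.eval x F = ∑' k, F.1 k * torusChar x k := rfl

/-! ### Uniqueness of Fourier coefficients -/

/-- Absolute summability gives convergence in the sup norm, hence in `L²`, where the inner product
with the `m`-th character isolates `a m` by orthonormality. -/
theorem eq_zero_of_fourier_series_eq_zero {a : ℤ → ℂ} (ha : Summable a)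
    (h : ∀ x : ℝ, ∑' n : ℤ, a n * Complex.exp (2 * Real.pi * Complex.I * (n * x)) = 0) :
    a = 0 := by
  have hsum : Summable fun n : ℤ => a n • (fourier n : C(AddCircle (1 : ℝ), ℂ)) := by
    refine Summable.of_norm_bounded ha.norm fun n => ?_
    rw [norm_smul, fourier_norm, mul_one]
  have h0 : ∑' n : ℤ, a n • (fourier n : C(AddCircle (1 : ℝ), ℂ)) = 0 := by
    ext x
    induction x using QuotientAddGroup.induction_on with
    | H x =>
      have h1 := (ContinuousMap.evalCLM ℂ (x : AddCircle (1 : ℝ))).hasSum hsum.hasSum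
      have h2 := h1.tsum_eq
      refine Eq.trans h2.symm (Eq.trans (tsum_congr fun n => ?_) (h x))
      simp only [map_smul, ContinuousMap.evalCLM_apply, smul_eq_mul]
      rw [fourier_coe_apply]
      congr 2
      push_cast
      ring
  have hs := hsum.hasSum
  rw [h0] at hs
  have h1 := (ContinuousMap.toLp (E := ℂ) 2 (AddCircle.haarAddCircle (T := (1 : ℝ))) ℂ).hasSum hs
  rw [map_zero] at h1
  ext m
  have h2 := (innerSL ℂ (fourierLp (T := (1 : ℝ)) 2 m)).hasSum h1
  rw [map_zero] at h2
  have h3 : ∀ n : ℤ, innerSL ℂ (fourierLp (T := (1 : ℝ)) 2 m)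
      (ContinuousMap.toLp (E := ℂ) 2 (AddCircle.haarAddCircle (T := (1 : ℝ))) ℂ
        (a n • fourier n)) = if n = m then a n else 0 := fun n => by
    have h4 := (orthonormal_iff_ite.1 (orthonormal_fourier (T := (1 : ℝ)))) m n
    have h5 : ContinuousMap.toLp (E := ℂ) 2 (AddCircle.haarAddCircle (T := (1 : ℝ))) ℂ (fourier n)
      = fourierLp (T := (1 : ℝ)) 2 n := rfl
    rw [map_smul, map_smul, innerSL_apply_apply, h5, h4]
    by_cases hnm : n = m
    · subst hnm; simp
    · rw [if_neg hnm, if_neg (Ne.symm hnm), smul_zero]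
  have h4 := (tsum_congr h3).symm.trans h2.tsum_eq
  rw [tsum_ite_eq] at h4
  exact h4

/-- The one-variable statement is used twice. For fixed `y` the double series is a Fourier series in
`x` whose coefficients are the inner series in `y`, so each inner series vanishes for every `y`. -/
theorem SummableFun.eq_zero_of_eval_eq_zero {F : SummableFun}
    (h : ∀ x, SummableFun.eval x F = 0) : F = 0 := by
  have hF := F.2
  have key : ∀ (y : ℝ) (m : ℤ), ∑' n : ℤ, F.1 (m, n) *
      Complex.exp (2 * Real.pi * Complex.I * (n * y)) = 0 := by
    intro y
    have hs := summable_mul_torusChar hF (0, y)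
    have := eq_zero_of_fourier_series_eq_zero
      (a := fun m => ∑' n : ℤ, F.1 (m, n) * torusChar (0, y) (m, n)) hs.prod fun x => by
        rw [← h (x, y), SummableFun.eval_apply,
          (summable_mul_torusChar hF (x, y)).tsum_prod' (summable_mul_torusChar hF (x, y)).prod_factor]
        refine tsum_congr fun m => ?_
        rw [← tsum_mul_right]
        refine tsum_congr fun n => ?_
        simp only [torusChar]
        rw [mul_assoc, ← Complex.exp_add]
        congr 2
        push_cast
        ring
    intro m
    refine Eq.trans (tsum_congr fun n => ?_) (congrFun this m)
    simp [torusChar]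
  refine SummableFun.ext fun k => ?_
  obtain ⟨m, n⟩ := k
  exact congrFun (eq_zero_of_fourier_series_eq_zero (a := fun n => F.1 (m, n))
    (hF.prod_factor m) fun y => key y m) n

/-! ### Elements of the torus ring as functions of a real point -/

namespace TorusRing

variable {ω : SymplecticForm}

/-- The value at `x` of the theta function attached to the degree `l` part of `f`. -/
def evalAt (f : TorusRing ω) (l : ℕ) (x : ℝ × ℝ) : ℂ :=
  ∑' k, f.coeff l k * gauss ω l k * torusChar x k

/-- The ring homomorphism that sends an element of `R(T)` to the generating series of the values at
`x` of its homogeneous components. -/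
def evalSeries (ω : SymplecticForm) (x : ℝ × ℝ) : TorusRing ω →+* PowerSeries ℂ :=
  (PowerSeries.map (SummableFun.eval x)).comp
    { toFun := toSeries
      map_one' := toSeries_one
      map_zero' := toSeries_zero
      map_add' := toSeries_add
      map_mul' := toSeries_mul }

theorem coeff_evalSeries (x : ℝ × ℝ) (f : TorusRing ω) (l : ℕ) :
    PowerSeries.coeff l (evalSeries ω x f) = f.evalAt l x := by
  rw [evalSeries, RingHom.comp_apply, PowerSeries.coeff_map]
  show SummableFun.eval x (PowerSeries.coeff l (toSeries f)) = _
  rw [coeff_toSeries]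
  rfl

theorem coeff_eq_zero_of_evalAt_eq_zero {f : TorusRing ω} {l : ℕ} (h : ∀ x, f.evalAt l x = 0)
    (k : ℤ × ℤ) : f.coeff l k = 0 := by
  have h1 : SummableFun.mk _ (summable_mul_gauss f l) = 0 :=
    SummableFun.eq_zero_of_eval_eq_zero fun x => h x
  exact (mul_eq_zero.1 (congrArg (fun F => F.1 k) h1)).resolve_right (gauss_ne_zero ω l k)

/-- Reduces identities in the ring, Riemann's relation among them, to identities between numbers at
each real point. -/
theorem ext_evalAt {f g : TorusRing ω} (h : ∀ l x, f.evalAt l x = g.evalAt l x) : f = g := by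
  rw [← sub_eq_zero]
  refine ext fun l k => coeff_eq_zero_of_evalAt_eq_zero (fun x => ?_) k
  rw [← coeff_evalSeries, map_sub, map_sub, coeff_evalSeries, coeff_evalSeries, h, sub_self]

theorem exists_norm_coeff_le (f : TorusRing ω) {l : ℕ} (hl : 0 < l) :
    ∃ C, ∀ k, ‖f.coeff l k‖ ≤ C := by
  let S : Finset (ℤ × ℤ) := Finset.Ico 0 (2 * l : ℤ) ×ˢ Finset.Ico 0 (2 * l : ℤ)
  refine ⟨∑ s ∈ S, ‖f.coeff l s‖, fun k => ?_⟩
  have h2l : (0 : ℤ) < 2 * l := by omega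
  have e : f.coeff l k = f.coeff l (k.1 % (2 * l), k.2 % (2 * l)) := by
    rw [← f.mem.1 l (k.1 % (2 * l), k.2 % (2 * l)) (k.1 / (2 * l), k.2 / (2 * l))]
    congr 1
    ext
    · simpa using (Int.emod_add_mul_ediv k.1 (2 * l)).symm
    · simpa using (Int.emod_add_mul_ediv k.2 (2 * l)).symm
  rw [e]
  refine Finset.single_le_sum (f := fun s => ‖f.coeff l s‖) (fun _ _ => norm_nonneg _) ?_
  simp only [S, Finset.mem_product, Finset.mem_Ico]
  exact ⟨⟨Int.emod_nonneg _ h2l.ne', Int.emod_lt_of_pos _ h2l⟩,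
    ⟨Int.emod_nonneg _ h2l.ne', Int.emod_lt_of_pos _ h2l⟩⟩

end TorusRing

/-! ### The torus ring is an integral domain -/

/-- Completing the square gives `-εn² + B|n| ≤ B²/(2ε) - (ε/2)n²`. The linear exponent is the growth
of the characters away from real points. -/
theorem summable_exp_sq_add_abs {ε : ℝ} (hε : 0 < ε) (B : ℝ) :
    Summable fun n : ℤ => Real.exp (-ε * (n : ℝ) ^ 2) * Real.exp (B * |(n : ℝ)|) := by
  refine Summable.of_nonneg_of_le (fun n => by positivity) (fun n => ?_)
    ((summable_exp_sq (half_pos hε)).mul_left (Real.exp (B ^ 2 / (2 * ε))))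
  rw [← Real.exp_add, ← Real.exp_add]
  refine Real.exp_le_exp.2 ?_
  have h1 : 0 ≤ (ε * |(n : ℝ)| - B) ^ 2 / (2 * ε) := by positivity
  have h2 : (ε * |(n : ℝ)| - B) ^ 2 / (2 * ε)
      = B ^ 2 / (2 * ε) + -(ε / 2) * (n : ℝ) ^ 2 - (-ε * (n : ℝ) ^ 2 + B * |(n : ℝ)|) := by
    rw [← sq_abs (n : ℝ)]
    field_simp
    ring
  linarith

namespace TorusRing

variable {ω : SymplecticForm}

/-- The restriction of a theta function to the complex line through two real points. -/
def lineEval (f : TorusRing ω) (l : ℕ) (x y : ℝ × ℝ) (t : ℂ) : ℂ :=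
  ∑' k : ℤ × ℤ, f.coeff l k * gauss ω l k * (torusChar x k *
    Complex.exp (2 * Real.pi * Complex.I * (t * (k.1 * (y.1 - x.1) + k.2 * (y.2 - x.2)))))

theorem lineEval_ofReal (f : TorusRing ω) (l : ℕ) (x y : ℝ × ℝ) (t : ℝ) :
    f.lineEval l x y t = f.evalAt l (x + t • (y - x)) := by
  refine tsum_congr fun k => ?_
  congr 1
  simp only [torusChar, ← Complex.exp_add, Prod.fst_add, Prod.snd_add, Prod.smul_fst,
    Prod.smul_snd, smul_eq_mul, Prod.fst_sub, Prod.snd_sub]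
  push_cast
  ring_nf

theorem differentiable_lineEval (f : TorusRing ω) (l : ℕ) (x y : ℝ × ℝ) :
    Differentiable ℂ (f.lineEval l x y) := by
  -- In degree zero the division by `4 * l` is a division by zero and the Gaussian does not decay,
  -- but only the coefficient at `k = 0` is present.
  rcases Nat.eq_zero_or_pos l with rfl | hl
  · have : f.lineEval 0 x y = fun _ => f.coeff 0 0 * gauss ω 0 0 * torusChar x 0 := by
      funext t
      rw [lineEval, tsum_eq_single 0 fun k hk => by rw [f.mem.2.1 k hk]; simp]
      simp
    rw [this]
    exact differentiable_const _
  obtain ⟨C, hC⟩ := exists_norm_coeff_le f hl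
  obtain ⟨ε, hε, hg⟩ := norm_gauss_le ω hl
  intro t₀
  set R : ℝ := ‖t₀‖ + 1
  set B₁ : ℝ := 2 * Real.pi * (R * |y.1 - x.1|)
  set B₂ : ℝ := 2 * Real.pi * (R * |y.2 - x.2|)
  have hR : 0 ≤ R := by positivity
  have hC0 : 0 ≤ C := (norm_nonneg _).trans (hC 0)
  have hsum : Summable fun k : ℤ × ℤ =>
      C * ((Real.exp (-ε * (k.1 : ℝ) ^ 2) * Real.exp (B₁ * |(k.1 : ℝ)|))
        * (Real.exp (-ε * (k.2 : ℝ) ^ 2) * Real.exp (B₂ * |(k.2 : ℝ)|))) :=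
    ((summable_exp_sq_add_abs hε B₁).mul_of_nonneg (summable_exp_sq_add_abs hε B₂)
      (fun _ => by positivity) (fun _ => by positivity)).mul_left C
  -- Weierstrass test on a ball containing `t₀`: there `|Im t| ≤ R`, so the characters grow at most
  -- like `exp (B₁|k₁| + B₂|k₂|)`.
  have hd : DifferentiableOn ℂ (f.lineEval l x y) (Metric.ball 0 R) := by
    refine Complex.differentiableOn_tsum_of_summable_norm hsum (fun k => ?_) Metric.isOpen_ball
      fun k t ht => ?_
    · fun_prop
    · rw [norm_mul, norm_mul, norm_mul, norm_torusChar, one_mul, Complex.norm_exp]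
      have e : 2 * (Real.pi : ℂ) * Complex.I *
          (t * (k.1 * (y.1 - x.1) + k.2 * (y.2 - x.2))) =
          Complex.I * (((2 * Real.pi * (k.1 * (y.1 - x.1) + k.2 * (y.2 - x.2)) : ℝ) : ℂ) * t) := by
        push_cast; ring
      rw [e, Complex.I_mul_re, Complex.im_ofReal_mul]
      have ht' : |t.im| ≤ R := (Complex.abs_im_le_norm t).trans (mem_ball_zero_iff.1 ht).le
      have hexp : -(2 * Real.pi * (k.1 * (y.1 - x.1) + k.2 * (y.2 - x.2)) * t.im)
          ≤ B₁ * |(k.1 : ℝ)| + B₂ * |(k.2 : ℝ)| := by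
        have h1 : -((k.1 * (y.1 - x.1) + k.2 * (y.2 - x.2)) * t.im) ≤
            (|(k.1 : ℝ)| * |y.1 - x.1| + |(k.2 : ℝ)| * |y.2 - x.2|) * R := by
          refine (neg_le_abs _).trans ?_
          rw [abs_mul]
          refine mul_le_mul ((abs_add_le _ _).trans ?_) ht' (abs_nonneg _) (by positivity)
          rw [abs_mul, abs_mul]
        have h2 := mul_le_mul_of_nonneg_left h1 (show 0 ≤ 2 * Real.pi by positivity)
        calc _ = 2 * Real.pi * -((k.1 * (y.1 - x.1) + k.2 * (y.2 - x.2)) * t.im) := by ring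
          _ ≤ _ := h2
          _ = _ := by simp only [B₁, B₂]; ring
      calc ‖f.coeff l k‖ * ‖gauss ω l k‖ * _
          ≤ C * (Real.exp (-ε * (k.1 : ℝ) ^ 2) * Real.exp (-ε * (k.2 : ℝ) ^ 2)) *
            Real.exp (B₁ * |(k.1 : ℝ)| + B₂ * |(k.2 : ℝ)|) := by
            gcongr
            · exact hC k
            · exact hg k
        _ = _ := by rw [Real.exp_add]; ring
  refine hd.differentiableAt (Metric.isOpen_ball.mem_nhds ?_)
  rw [mem_ball_zero_iff]
  exact lt_add_one _

theorem exists_evalAt_ne_zero {f : TorusRing ω} (hf : f ≠ 0) : ∃ l x, f.evalAt l x ≠ 0 := by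
  by_contra! h
  exact hf (ext fun l k => coeff_eq_zero_of_evalAt_eq_zero (h l) k)

/-- Take the complex line through a point where `f` is nonzero and one where `g` is. Near `t = 0`
the function `f` stays nonzero; if `g` vanished at all real `t ≠ 0` there, the identity theorem
would make it vanish on the whole line, in particular at `t = 1`. -/
theorem exists_evalAt_ne_zero_and {f g : TorusRing ω} (hf : f ≠ 0) (hg : g ≠ 0) :
    ∃ l m x, f.evalAt l x ≠ 0 ∧ g.evalAt m x ≠ 0 := by
  obtain ⟨l, x, hx⟩ := exists_evalAt_ne_zero hf
  obtain ⟨m, y, hy⟩ := exists_evalAt_ne_zero hg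
  by_contra! h
  have hA := f.differentiable_lineEval l x y
  have hB := g.differentiable_lineEval m x y
  have hA0 : f.lineEval l x y 0 ≠ 0 := by
    have := f.lineEval_ofReal l x y 0
    simp only [Complex.ofReal_zero, zero_smul, add_zero] at this
    rwa [this]
  have hB1 : g.lineEval m x y 1 ≠ 0 := by
    have := g.lineEval_ofReal m x y 1
    simp only [Complex.ofReal_one, one_smul, add_sub_cancel] at this
    rwa [this]
  have hev : ∀ᶠ t in nhds (0 : ℂ), f.lineEval l x y t ≠ 0 := hA.continuous.continuousAt.eventually_ne hA0
  have hreal : ∀ᶠ t : ℝ in nhdsWithin 0 {0}ᶜ, g.lineEval m x y t = 0 := by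
    have hc : Filter.Tendsto (fun t : ℝ => (t : ℂ)) (nhds 0) (nhds 0) := by
      simpa using Complex.continuous_ofReal.tendsto 0
    filter_upwards [nhdsWithin_le_nhds (hc.eventually hev)] with t ht
    rw [lineEval_ofReal] at ht ⊢
    exact h l m _ ht
  have hfreq : ∃ᶠ t in nhdsWithin (0 : ℂ) {0}ᶜ, g.lineEval m x y t = 0 := by
    have hc : Filter.Tendsto (fun t : ℝ => (t : ℂ)) (nhdsWithin 0 {0}ᶜ) (nhdsWithin 0 {0}ᶜ) := by
      refine tendsto_nhdsWithin_iff.2 ⟨?_, ?_⟩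
      · have : Filter.Tendsto (fun t : ℝ => (t : ℂ)) (nhds 0) (nhds 0) := by
          simpa using Complex.continuous_ofReal.tendsto 0
        exact this.mono_left nhdsWithin_le_nhds
      · filter_upwards [self_mem_nhdsWithin] with t ht
        simpa using ht
    exact hc.frequently hreal.frequently
  have hz := AnalyticOnNhd.eqOn_zero_of_preconnected_of_frequently_eq_zero (U := Set.univ)
    (fun t _ => hB.analyticAt t) isPreconnected_univ (Set.mem_univ 0) hfreq
  exact hB1 (hz (Set.mem_univ 1))

/-- At a point where neither factor vanishes, both have nonzero images in the power series ring over
`ℂ`. The degrees in which they are nonzero may differ. -/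
instance : IsDomain (TorusRing ω) :=
  have : NoZeroDivisors (TorusRing ω) := ⟨by
    intro f g hfg
    by_contra! h
    obtain ⟨l, m, x, hl, hm⟩ := exists_evalAt_ne_zero_and h.1 h.2
    rw [← coeff_evalSeries] at hl hm
    have h1 : evalSeries ω x f * evalSeries ω x g = 0 := by rw [← map_mul, hfg, map_zero]
    rcases mul_eq_zero.1 h1 with h2 | h2
    · exact hl (by rw [h2, map_zero])
    · exact hm (by rw [h2, map_zero])⟩
  have : Nontrivial (TorusRing ω) := ⟨0, 1, fun h => by
    have := congrArg (fun f => f.coeff 0 0) h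
    simp [coeff_zero, coeff_one] at this⟩
  NoZeroDivisors.to_isDomain _

end TorusRing

end KummerMirror

end

noncomputable section

namespace KummerMirror

/-! ### The kernel of the matrix `M` -/

namespace IsKummerParameter

variable {g h j k : ℂ}

theorem den_gh_ne (H : IsKummerParameter g h j k) : h ^ 2 * g ^ 2 - j ^ 2 * k ^ 2 ≠ 0 := by
  have := mul_ne_zero (sub_ne_zero.2 H.gh_ne) (by simpa using sub_ne_zero.2 H.gh_ne_neg :
    g * h + j * k ≠ 0)
  intro h0
  exact this (by linear_combination h0)

theorem den_gj_ne (H : IsKummerParameter g h j k) : j ^ 2 * g ^ 2 - h ^ 2 * k ^ 2 ≠ 0 := by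
  have := mul_ne_zero (sub_ne_zero.2 H.gj_ne) (by simpa using sub_ne_zero.2 H.gj_ne_neg :
    g * j + h * k ≠ 0)
  intro h0
  exact this (by linear_combination h0)

theorem den_gk_ne (H : IsKummerParameter g h j k) : k ^ 2 * g ^ 2 - j ^ 2 * h ^ 2 ≠ 0 := by
  have := mul_ne_zero (sub_ne_zero.2 H.gk_ne) (by simpa using sub_ne_zero.2 H.gk_ne_neg :
    g * k + h * j ≠ 0)
  intro h0
  exact this (by linear_combination h0)

/-- At most one of the parameters vanishes. -/
theorem triple_ne (H : IsKummerParameter g h j k) :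
    h * j * k ≠ 0 ∨ g * j * k ≠ 0 ∨ g * h * k ≠ 0 ∨ g * h * j ≠ 0 := by
  have h1 := H.gh_ne
  have h2 := H.gj_ne
  have h3 := H.gk_ne
  -- If two of the parameters vanish, both sides of one of `gh = jk`, `gj = hk`, `gk = hj` are zero.
  by_cases hg : g = 0
  · subst hg
    left
    intro h0
    rcases mul_eq_zero.1 h0 with h0 | h0
    · rcases mul_eq_zero.1 h0 with h0 | h0 <;> simp_all
    · simp_all
  by_cases hh : h = 0
  · subst hh
    right; left
    have : j ≠ 0 := by rintro rfl; simp_all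
    have : k ≠ 0 := by rintro rfl; simp_all
    simp_all
  by_cases hj : j = 0
  · subst hj
    right; right; left
    have : k ≠ 0 := by rintro rfl; simp_all
    simp_all
  right; right; right
  simp_all

theorem smul (H : IsKummerParameter g h j k) {c : ℂ} (hc : c ≠ 0) :
    IsKummerParameter (c * g) (c * h) (c * j) (c * k) := by
  have hc2 := pow_ne_zero 2 hc
  obtain ⟨h1, h2, h3, h4, h5, h6, h7, h8, h9, h10⟩ := H
  constructor
  · exact fun e => h1 (mul_left_cancel₀ hc2 (by linear_combination e))
  · exact fun e => h2 (mul_left_cancel₀ hc2 (by linear_combination e))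
  · exact fun e => h3 (mul_left_cancel₀ hc2 (by linear_combination e))
  · exact fun e => h4 (mul_left_cancel₀ hc2 (by linear_combination e))
  · exact fun e => h5 (mul_left_cancel₀ hc2 (by linear_combination e))
  · exact fun e => h6 (mul_left_cancel₀ hc2 (by linear_combination e))
  · exact fun e => h7 (mul_left_cancel₀ hc2 (by linear_combination e))
  · exact fun e => h8 (mul_left_cancel₀ hc2 (by linear_combination e))
  · exact fun e => h9 (mul_left_cancel₀ hc2 (by linear_combination e))
  · exact fun e => h10 (mul_left_cancel₀ hc2 (by linear_combination e))

/-- The translation `(01)(23)` of the Heisenberg group. -/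
theorem swap₁ (H : IsKummerParameter g h j k) : IsKummerParameter h g k j := by
  obtain ⟨h1, h2, h3, h4, h5, h6, h7, h8, h9, h10⟩ := H
  constructor
  · exact fun e => h1 (by linear_combination e)
  · exact fun e => h2 (by linear_combination e)
  · exact fun e => h3 (by linear_combination -e)
  · exact fun e => h4 (by linear_combination e)
  · exact fun e => h5 (by linear_combination -e)
  · exact fun e => h6 (by linear_combination e)
  · exact fun e => h7 (by linear_combination e)
  · exact fun e => h8 (by linear_combination -e)
  · exact fun e => h9 (by linear_combination -e)
  · exact fun e => h10 (by linear_combination e)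

/-- The translation `(02)(13)` of the Heisenberg group. -/
theorem swap₂ (H : IsKummerParameter g h j k) : IsKummerParameter j k g h := by
  obtain ⟨h1, h2, h3, h4, h5, h6, h7, h8, h9, h10⟩ := H
  constructor
  · exact fun e => h1 (by linear_combination -e)
  · exact fun e => h2 (by linear_combination e)
  · exact fun e => h3 (by linear_combination e)
  · exact fun e => h4 (by linear_combination e)
  · exact fun e => h5 (by linear_combination -e)
  · exact fun e => h6 (by linear_combination e)
  · exact fun e => h7 (by linear_combination -e)
  · exact fun e => h8 (by linear_combination e)
  · exact fun e => h9 (by linear_combination -e)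
  · exact fun e => h10 (by linear_combination e)

theorem neg₁ (H : IsKummerParameter g h j k) : IsKummerParameter g h (-j) (-k) := by
  obtain ⟨h1, h2, h3, h4, h5, h6, h7, h8, h9, h10⟩ := H
  constructor
  · exact fun e => h1 (by linear_combination e)
  · exact fun e => h2 (by linear_combination e)
  · exact fun e => h3 (by linear_combination -e)
  · exact fun e => h4 (by linear_combination -e)
  · exact fun e => h5 (by linear_combination -e)
  · exact fun e => h6 (by linear_combination -e)
  · exact fun e => h7 (by linear_combination e)
  · exact fun e => h8 (by linear_combination e)
  · exact fun e => h9 (by linear_combination e)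
  · exact fun e => h10 (by linear_combination e)

theorem neg₂ (H : IsKummerParameter g h j k) : IsKummerParameter g (-h) j (-k) := by
  obtain ⟨h1, h2, h3, h4, h5, h6, h7, h8, h9, h10⟩ := H
  constructor
  · exact fun e => h1 (by linear_combination -e)
  · exact fun e => h2 (by linear_combination -e)
  · exact fun e => h3 (by linear_combination e)
  · exact fun e => h4 (by linear_combination e)
  · exact fun e => h5 (by linear_combination -e)
  · exact fun e => h6 (by linear_combination -e)
  · exact fun e => h7 (by linear_combination e)
  · exact fun e => h8 (by linear_combination e)
  · exact fun e => h9 (by linear_combination e)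
  · exact fun e => h10 (by linear_combination e)

end IsKummerParameter

/-! ### Invariance of the quartic under scaling and the Heisenberg group -/

section quarticCoeff

/-- Numerators and denominators have equal degree: four for `A`, `B`, `C` and twelve for `D`. -/
theorem quarticCoeff_smul (g h j k : ℂ) {c : ℂ} (hc : c ≠ 0) :
    quarticCoeff (c * g) (c * h) (c * j) (c * k) = quarticCoeff g h j k := by
  have h4 : c ^ 4 ≠ 0 := pow_ne_zero 4 hc
  have h12 : c ^ 12 ≠ 0 := pow_ne_zero 12 hc
  unfold quarticCoeff
  congr! 1
  congr! 1
  · refine Eq.trans ?_ (mul_div_mul_left _ _ h4); congr 1 <;> ring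
  congr! 1
  · refine Eq.trans ?_ (mul_div_mul_left _ _ h4); congr 1 <;> ring
  congr! 1
  · refine Eq.trans ?_ (mul_div_mul_left _ _ h4); congr 1 <;> ring
  congr! 1
  · refine Eq.trans ?_ (mul_div_mul_left _ _ h12); congr 1 <;> ring

theorem quarticCoeff_swap₁ (g h j k : ℂ) : quarticCoeff h g k j = quarticCoeff g h j k := by
  unfold quarticCoeff
  congr! 1
  congr! 1
  · congr 1 <;> ring
  congr! 1
  · rw [← neg_div_neg_eq]; congr 1 <;> ring
  congr! 1
  · rw [← neg_div_neg_eq]; congr 1 <;> ring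
  congr! 1
  · congr 1 <;> ring

theorem quarticCoeff_swap₂ (g h j k : ℂ) : quarticCoeff j k g h = quarticCoeff g h j k := by
  unfold quarticCoeff
  congr! 1
  congr! 1
  · rw [← neg_div_neg_eq]; congr 1 <;> ring
  congr! 1
  · congr 1 <;> ring
  congr! 1
  · rw [← neg_div_neg_eq]; congr 1 <;> ring
  congr! 1
  · congr 1 <;> ring

theorem quarticCoeff_neg₁ (g h j k : ℂ) : quarticCoeff g h (-j) (-k) = quarticCoeff g h j k := by
  unfold quarticCoeff
  congr! 1
  congr! 1
  · congr 1 <;> ring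
  congr! 1
  · congr 1 <;> ring
  congr! 1
  · congr 1 <;> ring
  congr! 1
  · congr 1 <;> ring

theorem quarticCoeff_neg₂ (g h j k : ℂ) : quarticCoeff g (-h) j (-k) = quarticCoeff g h j k := by
  unfold quarticCoeff
  congr! 1
  congr! 1
  · congr 1 <;> ring
  congr! 1
  · congr 1 <;> ring
  congr! 1
  · congr 1 <;> ring
  congr! 1
  · congr 1 <;> ring

end quarticCoeff

/-- The halved rows are the partial derivatives at `(g, h, j, k)` of the quartic with coefficients
`v`. This makes the kernel of `M` a condition of singularity. -/
theorem matrixM_mulVec_eq_zero_iff (g h j k : ℂ) (v : Fin 5 → ℂ) :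
    (matrixM g h j k).mulVec v = 0 ↔
      4 * g ^ 3 * v 0 + 2 * h ^ 2 * g * v 1 + 2 * j ^ 2 * g * v 2 + 2 * k ^ 2 * g * v 3
        + j * k * h * v 4 = 0 ∧
      4 * h ^ 3 * v 0 + 2 * g ^ 2 * h * v 1 + 2 * k ^ 2 * h * v 2 + 2 * j ^ 2 * h * v 3
        + j * k * g * v 4 = 0 ∧
      4 * j ^ 3 * v 0 + 2 * k ^ 2 * j * v 1 + 2 * g ^ 2 * j * v 2 + 2 * h ^ 2 * j * v 3
        + h * g * k * v 4 = 0 ∧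
      4 * k ^ 3 * v 0 + 2 * j ^ 2 * k * v 1 + 2 * h ^ 2 * k * v 2 + 2 * g ^ 2 * k * v 3
        + h * g * j * v 4 = 0 := by
  have h0 : ∀ i : Fin 4, (matrixM g h j k).mulVec v i = matrixM g h j k i 0 * v 0 +
      matrixM g h j k i 1 * v 1 + matrixM g h j k i 2 * v 2 + matrixM g h j k i 3 * v 3 +
      matrixM g h j k i 4 * v 4 := fun i => by
    simp [Matrix.mulVec, dotProduct, Fin.sum_univ_succ]; ring
  rw [funext_iff]
  have h3 : (Fin.succ 2 : Fin 4) = 3 := rfl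
  simp only [h0, Fin.forall_fin_succ, Fin.succ_zero_eq_one, Fin.succ_one_eq_two, h3, Pi.zero_apply,
    IsEmpty.forall_iff, and_true]
  simp only [matrixM, Matrix.of_apply, Matrix.cons_val]
  refine and_congr ?_ (and_congr ?_ (and_congr ?_ ?_)) <;>
  · constructor
    · intro e; linear_combination (1 / 2) * e
    · intro e; linear_combination 2 * e

theorem matrixM_mulVec_quarticCoeff {g h j k : ℂ} (H : IsKummerParameter g h j k) :
    (matrixM g h j k).mulVec (quarticCoeff g h j k) = 0 := by
  have ha := H.den_gh_ne
  have hb := H.den_gj_ne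
  have hc := H.den_gk_ne
  have hd := mul_ne_zero (mul_ne_zero ha hb) hc
  have hA := mul_div_cancel₀ (j ^ 4 + k ^ 4 - h ^ 4 - g ^ 4) ha
  have hB := mul_div_cancel₀ (k ^ 4 + h ^ 4 - j ^ 4 - g ^ 4) hb
  have hC := mul_div_cancel₀ (h ^ 4 + j ^ 4 - k ^ 4 - g ^ 4) hc
  have hD := mul_div_cancel₀ (2 * (h * j * k * g * (g ^ 2 + h ^ 2 - j ^ 2 - k ^ 2)
    * (g ^ 2 + j ^ 2 - k ^ 2 - h ^ 2) * (g ^ 2 - h ^ 2 - j ^ 2 + k ^ 2)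
    * (h ^ 2 + j ^ 2 + k ^ 2 + g ^ 2))) hd
  rw [matrixM_mulVec_eq_zero_iff]
  simp only [quarticCoeff, Matrix.cons_val]
  set a := h ^ 2 * g ^ 2 - j ^ 2 * k ^ 2 with ha'
  set b := j ^ 2 * g ^ 2 - h ^ 2 * k ^ 2 with hb'
  set c := k ^ 2 * g ^ 2 - j ^ 2 * h ^ 2 with hc'
  refine ⟨mul_left_cancel₀ hd ?_, mul_left_cancel₀ hd ?_, mul_left_cancel₀ hd ?_,
    mul_left_cancel₀ hd ?_⟩
  · linear_combination 2 * h ^ 2 * g * b * c * hA + 2 * j ^ 2 * g * a * c * hB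
      + 2 * k ^ 2 * g * a * b * hC + j * k * h * hD
  · linear_combination 2 * g ^ 2 * h * b * c * hA + 2 * k ^ 2 * h * a * c * hB
      + 2 * j ^ 2 * h * a * b * hC + j * k * g * hD
  · linear_combination 2 * k ^ 2 * j * b * c * hA + 2 * g ^ 2 * j * a * c * hB
      + 2 * h ^ 2 * j * a * b * hC + h * g * k * hD
  · linear_combination 2 * j ^ 2 * k * b * c * hA + 2 * h ^ 2 * k * a * c * hB
      + 2 * g ^ 2 * k * a * b * hC + h * g * j * hD

/-- Subtracting a multiple of the known kernel vector makes the first entry zero, so it suffices to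
show that a kernel vector with first entry zero vanishes. -/
theorem eq_smul_quarticCoeff {g h j k : ℂ} (H : IsKummerParameter g h j k) {v : Fin 5 → ℂ}
    (hv : (matrixM g h j k).mulVec v = 0) : v = v 0 • quarticCoeff g h j k := by
  suffices h0 : ∀ u : Fin 5 → ℂ, u 0 = 0 → (matrixM g h j k).mulVec u = 0 → u = 0 by
    rw [← sub_eq_zero]
    refine h0 _ ?_ ?_
    · simp [quarticCoeff]
    · rw [Matrix.mulVec_sub, Matrix.mulVec_smul, hv, matrixM_mulVec_quarticCoeff H]
      simp
  intro u hu0 hu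
  rw [matrixM_mulVec_eq_zero_iff, hu0] at hu
  obtain ⟨e0, e1, e2, e3⟩ := hu
  -- After multiplying the rows by `g, h, j, k`, the sum with two plus and two minus signs cancels
  -- the last column and two of the three middle ones. What remains is a denominator of the
  -- coefficients.
  have hu1 : u 1 = 0 := (mul_eq_zero.1 (by
    linear_combination (g * e0 + h * e1 - j * e2 - k * e3) / 4 :
    (h ^ 2 * g ^ 2 - j ^ 2 * k ^ 2) * u 1 = 0)).resolve_left H.den_gh_ne
  have hu2 : u 2 = 0 := (mul_eq_zero.1 (by
    linear_combination (g * e0 - h * e1 + j * e2 - k * e3) / 4 :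
    (j ^ 2 * g ^ 2 - h ^ 2 * k ^ 2) * u 2 = 0)).resolve_left H.den_gj_ne
  have hu3 : u 3 = 0 := (mul_eq_zero.1 (by
    linear_combination (g * e0 - h * e1 - j * e2 + k * e3) / 4 :
    (k ^ 2 * g ^ 2 - j ^ 2 * h ^ 2) * u 3 = 0)).resolve_left H.den_gk_ne
  -- Each row now reads (product of three parameters) times `u 4`, and one of these products is
  -- nonzero.
  have hu4 : u 4 = 0 := by
    rw [hu1, hu2, hu3] at e0 e1 e2 e3
    rcases H.triple_ne with h0 | h0 | h0 | h0
    · exact (mul_eq_zero.1 (by linear_combination e0)).resolve_left h0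
    · exact (mul_eq_zero.1 (by linear_combination e1)).resolve_left h0
    · exact (mul_eq_zero.1 (by linear_combination e2)).resolve_left h0
    · exact (mul_eq_zero.1 (by linear_combination e3)).resolve_left h0
  funext i
  fin_cases i <;> assumption

theorem ker_matrixM {g h j k : ℂ} (H : IsKummerParameter g h j k) :
    LinearMap.ker (matrixM g h j k).mulVecLin = Submodule.span ℂ {quarticCoeff g h j k} := by
  ext v
  rw [LinearMap.mem_ker, Matrix.mulVecLin_apply, Submodule.mem_span_singleton]
  constructor
  · exact fun hv => ⟨v 0, (eq_smul_quarticCoeff H hv).symm⟩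
  · rintro ⟨c, rfl⟩
    rw [Matrix.mulVec_smul, matrixM_mulVec_quarticCoeff H, smul_zero]

end KummerMirror

end

noncomputable section
namespace KummerMirror
open MvPolynomial

/-! ### Gradient and Hessian of the quartic -/

theorem kummerQuartic_eq (g h j k : ℂ) : kummerQuartic g h j k =
    X 0 ^ 4 + X 1 ^ 4 + X 2 ^ 4 + X 3 ^ 4
      + C (quarticCoeff g h j k 1) * (X 0 ^ 2 * X 1 ^ 2 + X 2 ^ 2 * X 3 ^ 2)
      + C (quarticCoeff g h j k 2) * (X 0 ^ 2 * X 2 ^ 2 + X 1 ^ 2 * X 3 ^ 2)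
      + C (quarticCoeff g h j k 3) * (X 0 ^ 2 * X 3 ^ 2 + X 1 ^ 2 * X 2 ^ 2)
      + C (quarticCoeff g h j k 4) * (X 0 * X 1 * X 2 * X 3) := by
  have h0 : quarticCoeff g h j k 0 = 1 := rfl
  rw [kummerQuartic, Fin.sum_univ_five, h0, one_smul]
  simp only [MvPolynomial.smul_eq_C_mul, quarticW, Matrix.cons_val]

/-- The gradient of the Kummer quartic. -/
theorem pderiv_kummerQuartic (g h j k : ℂ) (i : Fin 4) :
    pderiv i (kummerQuartic g h j k) =
      ![4 * X 0 ^ 3 + C (quarticCoeff g h j k 1) * (2 * X 0 * X 1 ^ 2)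
        + C (quarticCoeff g h j k 2) * (2 * X 0 * X 2 ^ 2)
        + C (quarticCoeff g h j k 3) * (2 * X 0 * X 3 ^ 2)
        + C (quarticCoeff g h j k 4) * (X 1 * X 2 * X 3),
      4 * X 1 ^ 3 + C (quarticCoeff g h j k 1) * (2 * X 1 * X 0 ^ 2)
        + C (quarticCoeff g h j k 2) * (2 * X 1 * X 3 ^ 2)
        + C (quarticCoeff g h j k 3) * (2 * X 1 * X 2 ^ 2)
        + C (quarticCoeff g h j k 4) * (X 0 * X 2 * X 3),
      4 * X 2 ^ 3 + C (quarticCoeff g h j k 1) * (2 * X 2 * X 3 ^ 2)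
        + C (quarticCoeff g h j k 2) * (2 * X 2 * X 0 ^ 2)
        + C (quarticCoeff g h j k 3) * (2 * X 2 * X 1 ^ 2)
        + C (quarticCoeff g h j k 4) * (X 0 * X 1 * X 3),
      4 * X 3 ^ 3 + C (quarticCoeff g h j k 1) * (2 * X 3 * X 2 ^ 2)
        + C (quarticCoeff g h j k 2) * (2 * X 3 * X 1 ^ 2)
        + C (quarticCoeff g h j k 3) * (2 * X 3 * X 0 ^ 2)
        + C (quarticCoeff g h j k 4) * (X 0 * X 1 * X 2)] i := by
  rw [kummerQuartic_eq]
  fin_cases i <;>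
  · simp [pderiv_X]
    try ring

theorem eval_kummerQuartic (g h j k : ℂ) (x : Fin 4 → ℂ) : eval x (kummerQuartic g h j k) =
    x 0 ^ 4 + x 1 ^ 4 + x 2 ^ 4 + x 3 ^ 4
      + quarticCoeff g h j k 1 * (x 0 ^ 2 * x 1 ^ 2 + x 2 ^ 2 * x 3 ^ 2)
      + quarticCoeff g h j k 2 * (x 0 ^ 2 * x 2 ^ 2 + x 1 ^ 2 * x 3 ^ 2)
      + quarticCoeff g h j k 3 * (x 0 ^ 2 * x 3 ^ 2 + x 1 ^ 2 * x 2 ^ 2)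
      + quarticCoeff g h j k 4 * (x 0 * x 1 * x 2 * x 3) := by
  rw [kummerQuartic_eq]
  simp

/-- Here `M` is taken at the point `x`, while the coefficient vector belongs to `(g, h, j, k)`.
Singular points and parameters of one quartic thus satisfy the same system. -/
theorem forall_eval_pderiv_eq_zero_iff (g h j k : ℂ) (x : Fin 4 → ℂ) :
    (∀ i, eval x (pderiv i (kummerQuartic g h j k)) = 0) ↔
      (matrixM (x 0) (x 1) (x 2) (x 3)).mulVec (quarticCoeff g h j k) = 0 := by
  have h0 : quarticCoeff g h j k 0 = 1 := rfl
  rw [matrixM_mulVec_eq_zero_iff]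
  simp only [pderiv_kummerQuartic]
  have h3 : (Fin.succ 2 : Fin 4) = 3 := rfl
  simp only [h0, Fin.forall_fin_succ, Fin.succ_zero_eq_one, Fin.succ_one_eq_two, h3,
    IsEmpty.forall_iff, and_true, Matrix.cons_val]
  simp only [map_add, map_mul, map_pow, eval_X, eval_C, map_ofNat]
  refine and_congr ?_ (and_congr ?_ (and_congr ?_ ?_)) <;>
  · constructor
    · intro e; linear_combination e
    · intro e; linear_combination e

theorem hessian_kummerQuartic (g h j k : ℂ) (x : Fin 4 → ℂ) :
    hessian (kummerQuartic g h j k) x =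
      let A := quarticCoeff g h j k 1
      let B := quarticCoeff g h j k 2
      let C' := quarticCoeff g h j k 3
      let D := quarticCoeff g h j k 4
      !![12 * x 0 ^ 2 + 2 * A * x 1 ^ 2 + 2 * B * x 2 ^ 2 + 2 * C' * x 3 ^ 2,
          4 * A * x 0 * x 1 + D * x 2 * x 3, 4 * B * x 0 * x 2 + D * x 1 * x 3,
          4 * C' * x 0 * x 3 + D * x 1 * x 2;
        4 * A * x 0 * x 1 + D * x 2 * x 3,
          12 * x 1 ^ 2 + 2 * A * x 0 ^ 2 + 2 * B * x 3 ^ 2 + 2 * C' * x 2 ^ 2,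
          4 * C' * x 1 * x 2 + D * x 0 * x 3, 4 * B * x 1 * x 3 + D * x 0 * x 2;
        4 * B * x 0 * x 2 + D * x 1 * x 3, 4 * C' * x 1 * x 2 + D * x 0 * x 3,
          12 * x 2 ^ 2 + 2 * A * x 3 ^ 2 + 2 * B * x 0 ^ 2 + 2 * C' * x 1 ^ 2,
          4 * A * x 2 * x 3 + D * x 0 * x 1;
        4 * C' * x 0 * x 3 + D * x 1 * x 2, 4 * B * x 1 * x 3 + D * x 0 * x 2,
          4 * A * x 2 * x 3 + D * x 0 * x 1,
          12 * x 3 ^ 2 + 2 * A * x 2 ^ 2 + 2 * B * x 1 ^ 2 + 2 * C' * x 0 ^ 2] := by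
  have h4 : ∀ i, pderiv i (4 : MvPolynomial (Fin 4) ℂ) = 0 := fun i => by
    rw [show (4 : MvPolynomial (Fin 4) ℂ) = C 4 from (map_ofNat C 4).symm, pderiv_C]
  have h2 : ∀ i, pderiv i (2 : MvPolynomial (Fin 4) ℂ) = 0 := fun i => by
    rw [show (2 : MvPolynomial (Fin 4) ℂ) = C 2 from (map_ofNat C 2).symm, pderiv_C]
  ext i l
  simp only [hessian, pderiv_kummerQuartic, Matrix.of_apply]
  fin_cases l <;> fin_cases i <;>
  · simp [pderiv_X, h2, h4]
    try ring


/-! ### The singular points of the Kummer quartic -/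

namespace IsKummerParameter

variable {g h j k : ℂ}

theorem ne₁ (H : IsKummerParameter g h j k) : g ^ 2 + h ^ 2 - j ^ 2 - k ^ 2 ≠ 0 :=
  fun e => H.sq_gh_ne (by linear_combination e)

theorem ne₂ (H : IsKummerParameter g h j k) : g ^ 2 - h ^ 2 + j ^ 2 - k ^ 2 ≠ 0 :=
  fun e => H.sq_gj_ne (by linear_combination e)

theorem ne₃ (H : IsKummerParameter g h j k) : g ^ 2 - h ^ 2 - j ^ 2 + k ^ 2 ≠ 0 :=
  fun e => H.sq_gk_ne (by linear_combination e)

theorem coeff_one_mul (H : IsKummerParameter g h j k) :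
    (h ^ 2 * g ^ 2 - j ^ 2 * k ^ 2) * quarticCoeff g h j k 1 = j ^ 4 + k ^ 4 - h ^ 4 - g ^ 4 :=
  mul_div_cancel₀ _ H.den_gh_ne

theorem coeff_two_mul (H : IsKummerParameter g h j k) :
    (j ^ 2 * g ^ 2 - h ^ 2 * k ^ 2) * quarticCoeff g h j k 2 = k ^ 4 + h ^ 4 - j ^ 4 - g ^ 4 :=
  mul_div_cancel₀ _ H.den_gj_ne

theorem coeff_three_mul (H : IsKummerParameter g h j k) :
    (k ^ 2 * g ^ 2 - j ^ 2 * h ^ 2) * quarticCoeff g h j k 3 = h ^ 4 + j ^ 4 - k ^ 4 - g ^ 4 :=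
  mul_div_cancel₀ _ H.den_gk_ne

theorem coeff_four_mul (H : IsKummerParameter g h j k) :
    ((h ^ 2 * g ^ 2 - j ^ 2 * k ^ 2) * (j ^ 2 * g ^ 2 - h ^ 2 * k ^ 2)
      * (k ^ 2 * g ^ 2 - j ^ 2 * h ^ 2)) * quarticCoeff g h j k 4 =
      2 * (h * j * k * g * (g ^ 2 + h ^ 2 - j ^ 2 - k ^ 2) * (g ^ 2 + j ^ 2 - k ^ 2 - h ^ 2)
        * (g ^ 2 - h ^ 2 - j ^ 2 + k ^ 2) * (h ^ 2 + j ^ 2 + k ^ 2 + g ^ 2)) :=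
  mul_div_cancel₀ _ (mul_ne_zero (mul_ne_zero H.den_gh_ne H.den_gj_ne) H.den_gk_ne)

/-- Cleared of its denominator, `2 + A` is a difference of two squares, namely minus the product of
two signed sums of `g², h², j², k²`. The five statements that follow have the same reason, with the
other pairs of signed sums. -/
theorem two_add_coeff_one_ne (H : IsKummerParameter g h j k) : 2 + quarticCoeff g h j k 1 ≠ 0 :=
  fun e => mul_ne_zero H.ne₂ H.ne₃ (by
    linear_combination -(h ^ 2 * g ^ 2 - j ^ 2 * k ^ 2) * e + H.coeff_one_mul)

theorem two_sub_coeff_one_ne (H : IsKummerParameter g h j k) : 2 - quarticCoeff g h j k 1 ≠ 0 :=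
  fun e => mul_ne_zero H.sq_sum_ne H.ne₁ (by
    linear_combination (h ^ 2 * g ^ 2 - j ^ 2 * k ^ 2) * e + H.coeff_one_mul)

theorem two_add_coeff_two_ne (H : IsKummerParameter g h j k) : 2 + quarticCoeff g h j k 2 ≠ 0 :=
  fun e => mul_ne_zero H.ne₁ H.ne₃ (by
    linear_combination -(j ^ 2 * g ^ 2 - h ^ 2 * k ^ 2) * e + H.coeff_two_mul)

theorem two_sub_coeff_two_ne (H : IsKummerParameter g h j k) : 2 - quarticCoeff g h j k 2 ≠ 0 :=
  fun e => mul_ne_zero H.sq_sum_ne H.ne₂ (by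
    linear_combination (j ^ 2 * g ^ 2 - h ^ 2 * k ^ 2) * e + H.coeff_two_mul)

theorem two_add_coeff_three_ne (H : IsKummerParameter g h j k) : 2 + quarticCoeff g h j k 3 ≠ 0 :=
  fun e => mul_ne_zero H.ne₁ H.ne₂ (by
    linear_combination -(k ^ 2 * g ^ 2 - j ^ 2 * h ^ 2) * e + H.coeff_three_mul)

theorem two_sub_coeff_three_ne (H : IsKummerParameter g h j k) : 2 - quarticCoeff g h j k 3 ≠ 0 :=
  fun e => mul_ne_zero H.sq_sum_ne H.ne₃ (by
    linear_combination (k ^ 2 * g ^ 2 - j ^ 2 * h ^ 2) * e + H.coeff_three_mul)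

/-- The cubic relation between the coefficients of the Kummer quartic. -/
theorem coeff_relation (H : IsKummerParameter g h j k) :
    quarticCoeff g h j k 4 ^ 2 = 4 * (quarticCoeff g h j k 1 ^ 2 + quarticCoeff g h j k 2 ^ 2
      + quarticCoeff g h j k 3 ^ 2
      - quarticCoeff g h j k 1 * quarticCoeff g h j k 2 * quarticCoeff g h j k 3 - 4) := by
  -- The relation involves only squares of the parameters, so it is proved with half the degree, `G`
  -- standing for `g²` and so on.
  have key : ∀ G H J K : ℂ,
      (J ^ 2 + K ^ 2 - H ^ 2 - G ^ 2) ^ 2 * ((J * G - H * K) * (K * G - J * H)) ^ 2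
        + (K ^ 2 + H ^ 2 - J ^ 2 - G ^ 2) ^ 2 * ((H * G - J * K) * (K * G - J * H)) ^ 2
        + (H ^ 2 + J ^ 2 - K ^ 2 - G ^ 2) ^ 2 * ((H * G - J * K) * (J * G - H * K)) ^ 2
        - (J ^ 2 + K ^ 2 - H ^ 2 - G ^ 2) * (K ^ 2 + H ^ 2 - J ^ 2 - G ^ 2)
          * (H ^ 2 + J ^ 2 - K ^ 2 - G ^ 2)
          * ((H * G - J * K) * (J * G - H * K) * (K * G - J * H))
        - 4 * ((H * G - J * K) * (J * G - H * K) * (K * G - J * H)) ^ 2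
      = G * H * J * K * ((G + H - J - K) * (G + J - K - H) * (G - H - J + K)
          * (H + J + K + G)) ^ 2 := by
    intro G H J K
    ring
  have e := key (g ^ 2) (h ^ 2) (j ^ 2) (k ^ 2)
  have hA := H.coeff_one_mul
  have hB := H.coeff_two_mul
  have hC := H.coeff_three_mul
  have hD := H.coeff_four_mul
  have hd := pow_ne_zero 2 (mul_ne_zero (mul_ne_zero H.den_gh_ne H.den_gj_ne) H.den_gk_ne)
  simp only [← pow_mul, Nat.reduceMul] at e
  rw [← hA, ← hB, ← hC] at e
  refine mul_left_cancel₀ hd ?_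
  rw [← mul_pow, hD]
  linear_combination -4 * e

theorem coeff_four_ne (H : IsKummerParameter g h j k) (h0 : h * j * k * g ≠ 0) :
    quarticCoeff g h j k 4 ≠ 0 := by
  intro e
  have hD := H.coeff_four_mul
  rw [e, mul_zero] at hD
  have h2 : g ^ 2 + j ^ 2 - k ^ 2 - h ^ 2 ≠ 0 := fun e => H.ne₂ (by linear_combination e)
  have h3 : h ^ 2 + j ^ 2 + k ^ 2 + g ^ 2 ≠ 0 := fun e => H.sq_sum_ne (by linear_combination e)
  exact mul_ne_zero two_ne_zero (mul_ne_zero (mul_ne_zero (mul_ne_zero (mul_ne_zero h0 H.ne₁) h2)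
    H.ne₃) h3) hD.symm

end IsKummerParameter

end KummerMirror
end

noncomputable section
namespace KummerMirror
open MvPolynomial

/-! ### The Heisenberg orbit and the Hadamard transform -/

/-- Let `s` and `u` be the Hadamard transforms of `(G, H, J, K)` and of `t`. The hypothesis `e`,
with `A` eliminated, becomes the multiplicative equation `s₀s₁u₂u₃ = s₂s₃u₀u₁`. -/
theorem hadamard_relation {G H J K t₀ t₁ t₂ t₃ A : ℂ}
    (hA : (H * G - J * K) * A = J ^ 2 + K ^ 2 - H ^ 2 - G ^ 2)
    (e : t₀ ^ 2 + t₁ ^ 2 - t₂ ^ 2 - t₃ ^ 2 + A * (t₀ * t₁ - t₂ * t₃) = 0) :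
    (G + H + J + K) * (G + H - J - K) * ((t₀ - t₁ + t₂ - t₃) * (t₀ - t₁ - t₂ + t₃)) =
      (G - H + J - K) * (G - H - J + K) * ((t₀ + t₁ + t₂ + t₃) * (t₀ + t₁ - t₂ - t₃)) := by
  linear_combination 4 * (H * G - J * K) * e - 4 * (t₀ * t₁ - t₂ * t₃) * hA

/-- If two of the `u`'s are nonzero, the equations force all of them to be nonzero, and the ratios
`u_i/s_i` then agree up to an even number of signs. Otherwise at most one `u` survives. -/
theorem hadamard_solve {s₀ s₁ s₂ s₃ u₀ u₁ u₂ u₃ : ℂ} (h₀ : s₀ ≠ 0) (h₁ : s₁ ≠ 0) (h₂ : s₂ ≠ 0)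
    (h₃ : s₃ ≠ 0) (r₁ : s₀ * s₁ * (u₂ * u₃) = s₂ * s₃ * (u₀ * u₁))
    (r₂ : s₀ * s₂ * (u₁ * u₃) = s₁ * s₃ * (u₀ * u₂))
    (r₃ : s₀ * s₃ * (u₁ * u₂) = s₁ * s₂ * (u₀ * u₃)) :
    (u₁ = 0 ∧ u₂ = 0 ∧ u₃ = 0) ∨ (u₀ = 0 ∧ u₂ = 0 ∧ u₃ = 0) ∨ (u₀ = 0 ∧ u₁ = 0 ∧ u₃ = 0) ∨
    (u₀ = 0 ∧ u₁ = 0 ∧ u₂ = 0) ∨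
    ∃ c, u₀ = c * s₀ ∧ ((u₁ = c * s₁ ∧ u₂ = c * s₂ ∧ u₃ = c * s₃) ∨
      (u₁ = c * s₁ ∧ u₂ = -(c * s₂) ∧ u₃ = -(c * s₃)) ∨
      (u₁ = -(c * s₁) ∧ u₂ = c * s₂ ∧ u₃ = -(c * s₃)) ∨
      (u₁ = -(c * s₁) ∧ u₂ = -(c * s₂) ∧ u₃ = c * s₃)) := by
  by_cases hu₀ : u₀ = 0
  · subst hu₀
    have e₁ : u₂ * u₃ = 0 := by simpa [h₀, h₁] using r₁
    have e₂ : u₁ * u₃ = 0 := by simpa [h₀, h₂] using r₂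
    have e₃ : u₁ * u₂ = 0 := by simpa [h₀, h₃] using r₃
    rcases mul_eq_zero.1 e₁ with e₁ | e₁ <;> rcases mul_eq_zero.1 e₂ with e₂ | e₂ <;>
      rcases mul_eq_zero.1 e₃ with e₃ | e₃ <;> simp_all
  by_cases hu₁ : u₁ = 0
  · subst hu₁
    left
    have e₂ : u₂ = 0 := by simpa [h₁, h₃, hu₀] using r₂.symm
    have e₃ : u₃ = 0 := by simpa [h₁, h₂, hu₀] using r₃.symm
    exact ⟨rfl, e₂, e₃⟩
  have hu₂ : u₂ ≠ 0 := by
    rintro rfl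
    have : u₁ = 0 := by simpa [h₂, h₃, hu₀] using r₁.symm
    exact hu₁ this
  have hu₃ : u₃ ≠ 0 := by
    rintro rfl
    have : u₁ = 0 := by simpa [h₂, h₃, hu₀] using r₁.symm
    exact hu₁ this
  right; right; right; right
  have hc : u₀ = u₀ / s₀ * s₀ := (div_mul_cancel₀ _ h₀).symm
  set c := u₀ / s₀
  have hc0 : c ≠ 0 := div_ne_zero hu₀ h₀
  rw [hc] at r₁ r₂ r₃
  -- The product of the equations `r₂` and `r₃`, from which the common factors cancel.
  have q₁ : u₁ ^ 2 = (c * s₁) ^ 2 := by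
    refine mul_left_cancel₀ (mul_ne_zero (mul_ne_zero (pow_ne_zero 2 h₀) (mul_ne_zero h₂ h₃))
      (mul_ne_zero hu₂ hu₃)) ?_
    linear_combination s₀ * s₃ * u₁ * u₂ * r₂ + (s₁ * s₃ * (c * s₀ * u₂)) * r₃
  have q₂ : u₂ ^ 2 = (c * s₂) ^ 2 := by
    refine mul_left_cancel₀ (mul_ne_zero (mul_ne_zero (pow_ne_zero 2 h₀) (mul_ne_zero h₁ h₃))
      (mul_ne_zero hu₁ hu₃)) ?_
    linear_combination s₀ * s₃ * u₁ * u₂ * r₁ + (s₂ * s₃ * (c * s₀ * u₁)) * r₃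
  have q₃ : ∀ δ : ℂ, u₁ * u₂ = δ * (c * s₁) * (c * s₂) → u₃ = δ * (c * s₃) := fun δ hδ => by
    refine mul_left_cancel₀ (mul_ne_zero (mul_ne_zero h₁ h₂) (mul_ne_zero hc0 h₀)) ?_
    linear_combination -r₃ + s₀ * s₃ * hδ
  refine ⟨c, hc, ?_⟩
  rcases sq_eq_sq_iff_eq_or_eq_neg.1 q₁ with e₁ | e₁ <;>
    rcases sq_eq_sq_iff_eq_or_eq_neg.1 q₂ with e₂ | e₂
  · exact Or.inl ⟨e₁, e₂, by rw [q₃ 1 (by rw [e₁, e₂]; ring), one_mul]⟩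
  · exact Or.inr (Or.inl ⟨e₁, e₂, by rw [q₃ (-1) (by rw [e₁, e₂]; ring), neg_one_mul]⟩)
  · exact Or.inr (Or.inr (Or.inl ⟨e₁, e₂, by rw [q₃ (-1) (by rw [e₁, e₂]; ring), neg_one_mul]⟩))
  · exact Or.inr (Or.inr (Or.inr ⟨e₁, e₂, by rw [q₃ 1 (by rw [e₁, e₂]; ring), one_mul]⟩))

/-- The translations in the Heisenberg group, acting on the coordinates. -/
def kleinPerm (p : Fin 4) (x : Fin 4 → ℂ) : Fin 4 → ℂ :=
  ![x, ![x 1, x 0, x 3, x 2], ![x 2, x 3, x 0, x 1], ![x 3, x 2, x 1, x 0]] p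

/-- The sign changes in the Heisenberg group. -/
def kleinSign (q : Fin 4) : Fin 4 → ℂ :=
  ![![1, 1, 1, 1], ![1, 1, -1, -1], ![1, -1, 1, -1], ![1, -1, -1, 1]] q

/-- `x` is a Kummer parameter with the given quartic coefficients. -/
def IsParameterOf (v : Fin 5 → ℂ) (x : Fin 4 → ℂ) : Prop :=
  IsKummerParameter (x 0) (x 1) (x 2) (x 3) ∧ quarticCoeff (x 0) (x 1) (x 2) (x 3) = v

namespace IsParameterOf

variable {v : Fin 5 → ℂ} {x : Fin 4 → ℂ}

theorem kleinPerm (H : IsParameterOf v x) (p : Fin 4) : IsParameterOf v (kleinPerm p x) := by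
  obtain ⟨h, e⟩ := H
  fin_cases p
  · exact ⟨h, e⟩
  · exact ⟨h.swap₁, (quarticCoeff_swap₁ _ _ _ _).trans e⟩
  · exact ⟨h.swap₂, (quarticCoeff_swap₂ _ _ _ _).trans e⟩
  · exact ⟨h.swap₂.swap₁, ((quarticCoeff_swap₁ _ _ _ _).trans (quarticCoeff_swap₂ _ _ _ _)).trans e⟩

theorem kleinSign (H : IsParameterOf v x) (q : Fin 4) :
    IsParameterOf v fun i => kleinSign q i * x i := by
  obtain ⟨h, e⟩ := H
  fin_cases q
  · simpa [IsParameterOf, KummerMirror.kleinSign] using ⟨h, e⟩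
  · simpa [IsParameterOf, KummerMirror.kleinSign] using
      ⟨h.neg₁, (quarticCoeff_neg₁ _ _ _ _).trans e⟩
  · simpa [IsParameterOf, KummerMirror.kleinSign] using
      ⟨h.neg₂, (quarticCoeff_neg₂ _ _ _ _).trans e⟩
  · have := (quarticCoeff_neg₂ (x 0) (x 1) (-x 2) (-x 3)).trans (quarticCoeff_neg₁ _ _ _ _)
    simpa [IsParameterOf, KummerMirror.kleinSign] using
      And.intro (by simpa using h.neg₁.neg₂) (by simpa using this.trans e)

theorem smul (H : IsParameterOf v x) {c : ℂ} (hc : c ≠ 0) : IsParameterOf v (c • x) :=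
  ⟨H.1.smul hc, (quarticCoeff_smul _ _ _ _ hc).trans H.2⟩

theorem ne_zero (H : IsParameterOf v x) : x ≠ 0 := by
  rintro rfl
  exact H.1.sq_sum_ne (by simp)

/-- Two different sign vectors, even up to a global sign, agree in only two places, whereas at least
three coordinates of `x` are nonzero. -/
theorem eq_of_mul_eq (H : IsParameterOf v x) {q q' : Fin 4} {c : ℂ} (hc : c = 1 ∨ c = -1)
    (h : ∀ i, KummerMirror.kleinSign q i * x i = c * (KummerMirror.kleinSign q' i * x i)) :
    q = q' := by
  have h0 := H.1.triple_ne
  have e0 := h 0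
  have e1 := h 1
  have e2 := h 2
  have e3 := h 3
  rcases hc with rfl | rfl <;> fin_cases q <;> fin_cases q' <;>
    first
      | rfl
      | simp_all [KummerMirror.kleinSign, self_eq_neg, neg_eq_self]

end IsParameterOf

/-- The sixteen nodes of the Kummer quartic: the orbit of `x` under the Heisenberg group. -/
def kummerNode (x : Fin 4 → ℂ) (e : Fin 4 × Fin 4) : Fin 4 → ℂ :=
  fun i => kleinSign e.2 i * kleinPerm e.1 x i

theorem IsParameterOf.kummerNode {v : Fin 5 → ℂ} {x : Fin 4 → ℂ} (H : IsParameterOf v x)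
    (e : Fin 4 × Fin 4) : IsParameterOf v (kummerNode x e) := (H.kleinPerm e.1).kleinSign e.2

theorem kleinSign_sq (q i : Fin 4) : kleinSign q i ^ 2 = 1 := by
  fin_cases q <;> fin_cases i <;> simp [kleinSign]

theorem kummerNode_injective {v : Fin 5 → ℂ} {x : Fin 4 → ℂ} (H : IsParameterOf v x)
    {e e' : Fin 4 × Fin 4} {c : ℂ} (h : kummerNode x e = c • kummerNode x e') : e = e' := by
  obtain ⟨p, q⟩ := e
  obtain ⟨p', q'⟩ := e'
  have hsq : ∀ i, kleinPerm p x i ^ 2 = c ^ 2 * kleinPerm p' x i ^ 2 := fun i => by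
    have := congrArg (· ^ 2) (congrFun h i)
    simpa [kummerNode, mul_pow, kleinSign_sq] using this
  -- The sum of the squares is nonzero and unchanged by permutations and signs.
  have hc : c ^ 2 = 1 := by
    have hs : ∀ p, ∑ i, kleinPerm p x i ^ 2 = ∑ i, x i ^ 2 := fun p => by
      fin_cases p <;> simp [kleinPerm, Fin.sum_univ_four] <;> ring
    have h1 : ∑ i, x i ^ 2 = c ^ 2 * ∑ i, x i ^ 2 := by
      conv_lhs => rw [← hs p]
      rw [← hs p', Finset.mul_sum]
      exact Finset.sum_congr rfl fun i _ => hsq i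
    have h2 : ∑ i, x i ^ 2 ≠ 0 := by
      rw [Fin.sum_univ_four]
      exact H.1.sq_sum_ne
    exact mul_right_cancel₀ h2 (by rw [← h1, one_mul])
  simp only [hc, one_mul] at hsq
  -- Two different translations with equal squares would give `g² + h² = j² + k²` or `g² + j² = h² +
  -- k²`.
  have hp : p = p' := by
    have e0 := hsq 0
    have e1 := hsq 1
    have e2 := hsq 2
    fin_cases p <;> fin_cases p' <;> first
      | rfl
      | (exfalso
         simp only [kleinPerm, Matrix.cons_val, Fin.mk_one, Fin.reduceFinMk, Fin.zero_eta] at e0 e1 e2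
         first
          | exact H.1.sq_gj_ne (by linear_combination e0 + e2)
          | exact H.1.sq_gj_ne (by linear_combination -e0 - e2)
          | exact H.1.sq_gh_ne (by linear_combination e0 + e1)
          | exact H.1.sq_gh_ne (by linear_combination -e0 - e1))
  subst hp
  have hq : q = q' := (H.kleinPerm p).eq_of_mul_eq (sq_eq_one_iff.1 hc) fun i => congrFun h i
  rw [hq]

end KummerMirror
end

noncomputable section
namespace KummerMirror
open MvPolynomial

/-- The signs in `kleinSign` are those with an even number of minuses. For an odd pattern the
product condition makes some `y i` zero, and flipping the irrelevant sign there restores the parity,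
possibly after a global sign. -/
theorem exists_kleinSign_aux {x y : Fin 4 → ℂ} {r : ℂ} (hr : r ≠ 0) (h0 : x 0 = r * y 0)
    (h : ∀ i, x i = r * y i ∨ x i = -(r * y i))
    (hw : x 0 * x 1 * x 2 * x 3 = r ^ 4 * (y 0 * y 1 * y 2 * y 3)) :
    ∃ c, c ≠ 0 ∧ ∃ q, ∀ i, x i = c * (kleinSign q i * y i) := by
  have hr' : -r ≠ 0 := neg_ne_zero.2 hr
  have even : ∀ q, (∀ i, x i = r * (kleinSign q i * y i)) →
      ∃ c, c ≠ 0 ∧ ∃ q, ∀ i, x i = c * (kleinSign q i * y i) := fun q hq => ⟨r, hr, q, hq⟩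
  have odd : ∀ q, (∀ i, x i = -r * (kleinSign q i * y i)) →
      ∃ c, c ≠ 0 ∧ ∃ q, ∀ i, x i = c * (kleinSign q i * y i) := fun q hq => ⟨-r, hr', q, hq⟩
  have zero : x 0 * x 1 * x 2 * x 3 = -(r ^ 4 * (y 0 * y 1 * y 2 * y 3)) →
      y 0 = 0 ∨ y 1 = 0 ∨ y 2 = 0 ∨ y 3 = 0 := fun e => by
    have : 2 * r ^ 4 * (y 0 * y 1 * y 2 * y 3) = 0 := by linear_combination e - hw
    simpa [hr, or_assoc] using this
  rcases h 1 with h1 | h1 <;> rcases h 2 with h2 | h2 <;> rcases h 3 with h3 | h3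
  · exact even 0 fun i => by fin_cases i <;> simp [kleinSign, h0, h1, h2, h3]
  · rcases zero (by rw [h0, h1, h2, h3]; ring) with e | e | e | e
    · exact odd 3 fun i => by fin_cases i <;> simp [kleinSign, h0, h1, h2, h3, e]
    · exact even 2 fun i => by fin_cases i <;> simp [kleinSign, h0, h1, h2, h3, e]
    · exact even 1 fun i => by fin_cases i <;> simp [kleinSign, h0, h1, h2, h3, e]
    · exact even 0 fun i => by fin_cases i <;> simp [kleinSign, h0, h1, h2, h3, e]
  · rcases zero (by rw [h0, h1, h2, h3]; ring) with e | e | e | e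
    · exact odd 2 fun i => by fin_cases i <;> simp [kleinSign, h0, h1, h2, h3, e]
    · exact even 3 fun i => by fin_cases i <;> simp [kleinSign, h0, h1, h2, h3, e]
    · exact even 0 fun i => by fin_cases i <;> simp [kleinSign, h0, h1, h2, h3, e]
    · exact even 1 fun i => by fin_cases i <;> simp [kleinSign, h0, h1, h2, h3, e]
  · exact even 1 fun i => by fin_cases i <;> simp [kleinSign, h0, h1, h2, h3]
  · rcases zero (by rw [h0, h1, h2, h3]; ring) with e | e | e | e
    · exact odd 1 fun i => by fin_cases i <;> simp [kleinSign, h0, h1, h2, h3, e]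
    · exact even 0 fun i => by fin_cases i <;> simp [kleinSign, h0, h1, h2, h3, e]
    · exact even 3 fun i => by fin_cases i <;> simp [kleinSign, h0, h1, h2, h3, e]
    · exact even 2 fun i => by fin_cases i <;> simp [kleinSign, h0, h1, h2, h3, e]
  · exact even 2 fun i => by fin_cases i <;> simp [kleinSign, h0, h1, h2, h3]
  · exact even 3 fun i => by fin_cases i <;> simp [kleinSign, h0, h1, h2, h3]
  · rcases zero (by rw [h0, h1, h2, h3]; ring) with e | e | e | e
    · exact odd 0 fun i => by fin_cases i <;> simp [kleinSign, h0, h1, h2, h3, e]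
    · exact even 1 fun i => by fin_cases i <;> simp [kleinSign, h0, h1, h2, h3, e]
    · exact even 2 fun i => by fin_cases i <;> simp [kleinSign, h0, h1, h2, h3, e]
    · exact even 3 fun i => by fin_cases i <;> simp [kleinSign, h0, h1, h2, h3, e]

theorem exists_kleinSign {x y : Fin 4 → ℂ} {r : ℂ} (hr : r ≠ 0)
    (h : ∀ i, x i = r * y i ∨ x i = -(r * y i))
    (hw : x 0 * x 1 * x 2 * x 3 = r ^ 4 * (y 0 * y 1 * y 2 * y 3)) :
    ∃ c, c ≠ 0 ∧ ∃ q, ∀ i, x i = c * (kleinSign q i * y i) := by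
  rcases h 0 with h0 | h0
  · exact exists_kleinSign_aux hr h0 h hw
  · refine exists_kleinSign_aux (neg_ne_zero.2 hr) (by rw [h0, neg_mul]) (fun i => ?_) ?_
    · rw [neg_mul, neg_neg]
      exact (h i).symm
    · rw [hw]; ring

namespace IsParameterOf

variable {v : Fin 5 → ℂ} {y : Fin 4 → ℂ}

/-- A singular point of the Kummer quartic lies in the orbit of `y`, up to sign changes. -/
theorem exists_sq_eq (H : IsParameterOf v y) {x : Fin 4 → ℂ} (hx : x ≠ 0)
    (hs : (matrixM (x 0) (x 1) (x 2) (x 3)).mulVec v = 0) :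
    ∃ (c : ℂ) (p : Fin 4), c ≠ 0 ∧ ∀ i, x i ^ 2 = c * KummerMirror.kleinPerm p y i ^ 2 := by
  obtain ⟨H, rfl⟩ := H
  have hv0 : quarticCoeff (y 0) (y 1) (y 2) (y 3) 0 = 1 := rfl
  rw [matrixM_mulVec_eq_zero_iff, hv0] at hs
  obtain ⟨e0, e1, e2, e3⟩ := hs
  have n1 := H.two_add_coeff_one_ne
  have n2 := H.two_sub_coeff_one_ne
  have n3 := H.two_add_coeff_two_ne
  have n4 := H.two_sub_coeff_two_ne
  have n5 := H.two_add_coeff_three_ne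
  have n6 := H.two_sub_coeff_three_ne
  have hrel := H.coeff_relation
  have hA := H.coeff_one_mul
  have hB := H.coeff_two_mul
  have hC := H.coeff_three_mul
  set A := quarticCoeff (y 0) (y 1) (y 2) (y 3) 1
  set B := quarticCoeff (y 0) (y 1) (y 2) (y 3) 2
  set C := quarticCoeff (y 0) (y 1) (y 2) (y 3) 3
  set D := quarticCoeff (y 0) (y 1) (y 2) (y 3) 4
  -- The combination `x₀∂₀ + x₁∂₁ - x₂∂₂ - x₃∂₃` of the gradient equations involves neither `B`, `C`
  -- nor `D`; the other two pairings isolate `B` and `C`.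
  have r₁ := hadamard_relation (G := y 0 ^ 2) (H := y 1 ^ 2) (J := y 2 ^ 2) (K := y 3 ^ 2)
    (t₀ := x 0 ^ 2) (t₁ := x 1 ^ 2) (t₂ := x 2 ^ 2) (t₃ := x 3 ^ 2) (A := A)
    (by linear_combination hA) (by linear_combination (x 0 * e0 + x 1 * e1 - x 2 * e2 - x 3 * e3) / 4)
  have r₂ := hadamard_relation (G := y 0 ^ 2) (H := y 2 ^ 2) (J := y 1 ^ 2) (K := y 3 ^ 2)
    (t₀ := x 0 ^ 2) (t₁ := x 2 ^ 2) (t₂ := x 1 ^ 2) (t₃ := x 3 ^ 2) (A := B)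
    (by linear_combination hB) (by linear_combination (x 0 * e0 - x 1 * e1 + x 2 * e2 - x 3 * e3) / 4)
  have r₃ := hadamard_relation (G := y 0 ^ 2) (H := y 3 ^ 2) (J := y 1 ^ 2) (K := y 2 ^ 2)
    (t₀ := x 0 ^ 2) (t₁ := x 3 ^ 2) (t₂ := x 1 ^ 2) (t₃ := x 2 ^ 2) (A := C)
    (by linear_combination hC) (by linear_combination (x 0 * e0 - x 1 * e1 - x 2 * e2 + x 3 * e3) / 4)
  have hs := hadamard_solve (s₀ := y 0 ^ 2 + y 1 ^ 2 + y 2 ^ 2 + y 3 ^ 2)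
    (u₀ := x 0 ^ 2 + x 1 ^ 2 + x 2 ^ 2 + x 3 ^ 2)
    (u₁ := x 0 ^ 2 + x 1 ^ 2 - x 2 ^ 2 - x 3 ^ 2)
    (u₂ := x 0 ^ 2 - x 1 ^ 2 + x 2 ^ 2 - x 3 ^ 2)
    (u₃ := x 0 ^ 2 - x 1 ^ 2 - x 2 ^ 2 + x 3 ^ 2) H.sq_sum_ne H.ne₁ H.ne₂ H.ne₃
    (by linear_combination r₁) (by linear_combination r₂) (by linear_combination r₃)
  have hE : x 0 * (4 * x 0 ^ 3 + 2 * x 1 ^ 2 * x 0 * A + 2 * x 2 ^ 2 * x 0 * B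
      + 2 * x 3 ^ 2 * x 0 * C + x 2 * x 3 * x 1 * D) = 0 := by
    rw [← mul_one (4 * x 0 ^ 3), e0, mul_zero]
  -- Excludes solutions with a single nonzero `u`, where the squares of the coordinates agree up to
  -- signs `t_i`. There the gradient gives `(2(2 + t₁A + t₂B + t₃C))² = D²`, and with the cubic
  -- relation this becomes `(2 + t₁A)(2 + t₂B)(2 + t₃C) = 0`.
  have hw : ∀ t₁ t₂ t₃ : ℂ, x 1 ^ 2 = t₁ * x 0 ^ 2 → x 2 ^ 2 = t₂ * x 0 ^ 2 →
      x 3 ^ 2 = t₃ * x 0 ^ 2 → t₁ ^ 2 = 1 → t₂ ^ 2 = 1 → t₁ * t₂ = t₃ →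
      (2 + t₁ * A) * (2 + t₂ * B) * (2 + t₃ * C) ≠ 0 → False := by
    intro t₁ t₂ t₃ h1 h2 h3 q1 q2 q3 hne
    have h0 : x 0 ≠ 0 := fun h0 => hx (by
      have p1 : x 1 = 0 := by simpa [h0] using h1
      have p2 : x 2 = 0 := by simpa [h0] using h2
      have p3 : x 3 = 0 := by simpa [h0] using h3
      funext i
      fin_cases i <;> assumption)
    have k1 : 2 * (2 + t₁ * A + t₂ * B + t₃ * C) * x 0 ^ 4 = -(x 0 * x 1 * x 2 * x 3 * D) := by
      linear_combination hE - 2 * x 0 ^ 2 * (A * h1 + B * h2 + C * h3)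
    have q3' : t₁ * t₂ * t₃ = 1 := by rw [← q3]; linear_combination t₂ ^ 2 * q1 + q2
    have q3'' : t₃ ^ 2 = 1 := by rw [← q3]; linear_combination t₂ ^ 2 * q1 + q2
    have k2 : (x 0 * x 1 * x 2 * x 3) ^ 2 = x 0 ^ 8 := by
      calc _ = x 0 ^ 2 * x 1 ^ 2 * x 2 ^ 2 * x 3 ^ 2 := by ring
        _ = t₁ * t₂ * t₃ * x 0 ^ 8 := by rw [h1, h2, h3]; ring
        _ = _ := by rw [q3', one_mul]
    have k3 : (2 * (2 + t₁ * A + t₂ * B + t₃ * C)) ^ 2 = D ^ 2 := by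
      refine mul_left_cancel₀ (pow_ne_zero 8 h0) ?_
      calc _ = (2 * (2 + t₁ * A + t₂ * B + t₃ * C) * x 0 ^ 4) ^ 2 := by ring
        _ = (x 0 * x 1 * x 2 * x 3) ^ 2 * D ^ 2 := by rw [k1]; ring
        _ = _ := by rw [k2]
    refine hne ?_
    have m1 : t₂ * t₃ = t₁ := by rw [← q3]; linear_combination t₁ * q2
    have m2 : t₁ * t₃ = t₂ := by rw [← q3]; linear_combination t₂ * q1
    linear_combination (1 / 4) * k3 + (1 / 4) * hrel + A * B * C * q3' - A ^ 2 * q1 - B ^ 2 * q2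
      - C ^ 2 * q3''
  rcases hs with ⟨h1, h2, h3⟩ | ⟨h1, h2, h3⟩ | ⟨h1, h2, h3⟩ | ⟨h1, h2, h3⟩ | ⟨c, h0, h⟩
  · exact (hw 1 1 1 (by linear_combination (-h2 - h3) / 2) (by linear_combination (-h1 - h3) / 2)
      (by linear_combination (-h1 - h2) / 2) (by norm_num) (by norm_num) (by norm_num)
      (by simpa [n1, n3] using n5)).elim
  · exact (hw 1 (-1) (-1) (by linear_combination (-h2 - h3) / 2)
      (by linear_combination (h1 + h2) / 2)
      (by linear_combination (h1 + h3) / 2) (by norm_num) (by norm_num) (by norm_num)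
      (by simpa [n1, n4, ← sub_eq_add_neg] using n6)).elim
  · exact (hw (-1) 1 (-1) (by linear_combination (h1 + h2) / 2)
      (by linear_combination (-h2 - h3) / 2)
      (by linear_combination (h1 + h3) / 2) (by norm_num) (by norm_num) (by norm_num)
      (by simpa [n2, n3, ← sub_eq_add_neg] using n6)).elim
  · exact (hw (-1) (-1) 1 (by linear_combination (h1 + h2) / 2)
      (by linear_combination (h1 + h3) / 2)
      (by linear_combination (-h2 - h3) / 2) (by norm_num) (by norm_num) (by norm_num)
      (by simpa [n2, n4, ← sub_eq_add_neg] using n5)).elim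
  -- Inverting the transform, the four even sign patterns of `u` become the four translations acting
  -- on the squares of `y`.
  · have key : ∃ p, ∀ i, x i ^ 2 = c * KummerMirror.kleinPerm p y i ^ 2 := by
      rcases h with ⟨h1, h2, h3⟩ | ⟨h1, h2, h3⟩ | ⟨h1, h2, h3⟩ | ⟨h1, h2, h3⟩
      · refine ⟨0, fun i => ?_⟩
        fin_cases i <;> simp only [KummerMirror.kleinPerm, Matrix.cons_val, Fin.mk_one,
          Fin.reduceFinMk, Fin.zero_eta]
        · linear_combination (h0 + h1 + h2 + h3) / 4
        · linear_combination (h0 + h1 - h2 - h3) / 4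
        · linear_combination (h0 - h1 + h2 - h3) / 4
        · linear_combination (h0 - h1 - h2 + h3) / 4
      · refine ⟨1, fun i => ?_⟩
        fin_cases i <;> simp only [KummerMirror.kleinPerm, Matrix.cons_val, Fin.mk_one,
          Fin.reduceFinMk, Fin.zero_eta]
        · linear_combination (h0 + h1 + h2 + h3) / 4
        · linear_combination (h0 + h1 - h2 - h3) / 4
        · linear_combination (h0 - h1 + h2 - h3) / 4
        · linear_combination (h0 - h1 - h2 + h3) / 4
      · refine ⟨2, fun i => ?_⟩
        fin_cases i <;> simp only [KummerMirror.kleinPerm, Matrix.cons_val, Fin.mk_one,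
          Fin.reduceFinMk, Fin.zero_eta]
        · linear_combination (h0 + h1 + h2 + h3) / 4
        · linear_combination (h0 + h1 - h2 - h3) / 4
        · linear_combination (h0 - h1 + h2 - h3) / 4
        · linear_combination (h0 - h1 - h2 + h3) / 4
      · refine ⟨3, fun i => ?_⟩
        fin_cases i <;> simp only [KummerMirror.kleinPerm, Matrix.cons_val, Fin.mk_one,
          Fin.reduceFinMk, Fin.zero_eta]
        · linear_combination (h0 + h1 + h2 + h3) / 4
        · linear_combination (h0 + h1 - h2 - h3) / 4
        · linear_combination (h0 - h1 + h2 - h3) / 4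
        · linear_combination (h0 - h1 - h2 + h3) / 4
    obtain ⟨p, hp⟩ := key
    refine ⟨c, p, fun hc => hx ?_, hp⟩
    funext i
    have := hp i
    simpa [hc] using this

/-- The squares fix `x` up to the sign of each coordinate, and only the product of the coordinates
decides whether these signs come from the Heisenberg group. -/
theorem exists_eq_smul_kummerNode (H : IsParameterOf v y) {x : Fin 4 → ℂ} (hx : x ≠ 0)
    (hs : (matrixM (x 0) (x 1) (x 2) (x 3)).mulVec v = 0) :
    ∃ (c : ℂ) (e : Fin 4 × Fin 4), c ≠ 0 ∧ x = c • KummerMirror.kummerNode y e := by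
  obtain ⟨c, p, hc, hp⟩ := H.exists_sq_eq hx hs
  obtain ⟨r, rfl⟩ := IsAlgClosed.exists_pow_nat_eq c (n := 2) (by norm_num)
  have hr : r ≠ 0 := fun h => hc (by rw [h]; ring)
  have Hp := H.kleinPerm p
  set z := KummerMirror.kleinPerm p y
  have hz : ∀ i, x i = r * z i ∨ x i = -(r * z i) := fun i =>
    sq_eq_sq_iff_eq_or_eq_neg.1 (by rw [hp i]; ring)
  have hw : x 0 * x 1 * x 2 * x 3 = r ^ 4 * (z 0 * z 1 * z 2 * z 3) := by
    have hsq : (x 0 * x 1 * x 2 * x 3) ^ 2 = (r ^ 4 * (z 0 * z 1 * z 2 * z 3)) ^ 2 := by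
      calc _ = x 0 ^ 2 * x 1 ^ 2 * x 2 ^ 2 * x 3 ^ 2 := by ring
        _ = _ := by rw [hp, hp, hp, hp]; ring
    by_cases h0 : z 1 * z 2 * z 3 * z 0 = 0
    · have : r ^ 4 * (z 0 * z 1 * z 2 * z 3) = 0 := by linear_combination r ^ 4 * h0
      rw [this] at hsq ⊢
      simpa using hsq
    -- With all coordinates nonzero also `D ≠ 0`. In `x₀∂₀F` every term but the one with `D` depends
    -- on squares only, so comparing `x` with `z` yields the product itself.
    · obtain ⟨Hz, rfl⟩ := Hp
      have hm := matrixM_mulVec_quarticCoeff Hz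
      rw [matrixM_mulVec_eq_zero_iff] at hs hm
      refine mul_right_cancel₀ (Hz.coeff_four_ne h0) ?_
      have q0 := hp 0
      have q1 := hp 1
      have q2 := hp 2
      have q3 := hp 3
      obtain ⟨e0, -⟩ := hs
      obtain ⟨e0', -⟩ := hm
      have i0 : x 0 ^ 4 = r ^ 4 * z 0 ^ 4 := by
        calc _ = (x 0 ^ 2) ^ 2 := by ring
          _ = _ := by rw [q0]; ring
      have i1 : x 0 ^ 2 * x 1 ^ 2 = r ^ 4 * (z 0 ^ 2 * z 1 ^ 2) := by rw [q0, q1]; ring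
      have i2 : x 0 ^ 2 * x 2 ^ 2 = r ^ 4 * (z 0 ^ 2 * z 2 ^ 2) := by rw [q0, q2]; ring
      have i3 : x 0 ^ 2 * x 3 ^ 2 = r ^ 4 * (z 0 ^ 2 * z 3 ^ 2) := by rw [q0, q3]; ring
      set w := quarticCoeff (z 0) (z 1) (z 2) (z 3)
      linear_combination x 0 * e0 - r ^ 4 * z 0 * e0' - 4 * w 0 * i0 - 2 * w 1 * i1
        - 2 * w 2 * i2 - 2 * w 3 * i3
  obtain ⟨c, hc', q, hq⟩ := exists_kleinSign hr hz hw
  exact ⟨c, (p, q), hc', funext fun i => hq i⟩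

end IsParameterOf

end KummerMirror
end

noncomputable section
namespace KummerMirror
open MvPolynomial

/-! ### Nondegeneracy of the nodes -/

/-- The derivative of `hadamard_relation` at `t = (G, H, J, K)` in the direction `u`. -/
theorem hadamard_relation_polar {G H J K u₀ u₁ u₂ u₃ A : ℂ}
    (hA : (H * G - J * K) * A = J ^ 2 + K ^ 2 - H ^ 2 - G ^ 2)
    (e : 2 * (G * u₀ + H * u₁ - J * u₂ - K * u₃)
      + A * (u₀ * H + G * u₁ - u₂ * K - J * u₃) = 0) :
    (G + H + J + K) * (G + H - J - K) * ((G - H + J - K) * (u₀ - u₁ - u₂ + u₃)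
      + (G - H - J + K) * (u₀ - u₁ + u₂ - u₃)) =
    (G - H + J - K) * (G - H - J + K) * ((G + H + J + K) * (u₀ + u₁ - u₂ - u₃)
      + (G + H - J - K) * (u₀ + u₁ + u₂ + u₃)) := by
  linear_combination 4 * (H * G - J * K) * e - 4 * (u₀ * H + G * u₁ - u₂ * K - J * u₃) * hA

/-- For the ratios `v_i = u_i/s_i` the equations read `v₂ + v₃ = v₀ + v₁` and its two analogues;
adding them in pairs shows that all ratios coincide. -/
theorem hadamard_solve_polar {s₀ s₁ s₂ s₃ u₀ u₁ u₂ u₃ : ℂ} (h₀ : s₀ ≠ 0) (h₁ : s₁ ≠ 0)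
    (h₂ : s₂ ≠ 0) (h₃ : s₃ ≠ 0)
    (r₁ : s₀ * s₁ * (s₂ * u₃ + s₃ * u₂) = s₂ * s₃ * (s₀ * u₁ + s₁ * u₀))
    (r₂ : s₀ * s₂ * (s₁ * u₃ + s₃ * u₁) = s₁ * s₃ * (s₀ * u₂ + s₂ * u₀))
    (r₃ : s₀ * s₃ * (s₁ * u₂ + s₂ * u₁) = s₁ * s₂ * (s₀ * u₃ + s₃ * u₀)) :
    ∃ c, u₀ = c * s₀ ∧ u₁ = c * s₁ ∧ u₂ = c * s₂ ∧ u₃ = c * s₃ := by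
  refine ⟨u₀ / s₀, (div_mul_cancel₀ _ h₀).symm, ?_, ?_, ?_⟩
  · rw [div_mul_eq_mul_div, eq_div_iff h₀]
    refine mul_left_cancel₀ (mul_ne_zero h₂ h₃) ?_
    linear_combination (r₂ + r₃) / 2
  · rw [div_mul_eq_mul_div, eq_div_iff h₀]
    refine mul_left_cancel₀ (mul_ne_zero h₁ h₃) ?_
    linear_combination (r₁ + r₃) / 2
  · rw [div_mul_eq_mul_div, eq_div_iff h₀]
    refine mul_left_cancel₀ (mul_ne_zero h₁ h₂) ?_
    linear_combination (r₁ + r₂) / 2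

/-- When `g = 0`, half of `h²j²k²` times this diagonal entry of the Hessian equals the product of
the four signed sums of squares. -/
theorem IsKummerParameter.diag_ne {g h j k : ℂ} (H : IsKummerParameter g h j k) (hg : g = 0) :
    12 * g ^ 2 + 2 * quarticCoeff g h j k 1 * h ^ 2 + 2 * quarticCoeff g h j k 2 * j ^ 2
      + 2 * quarticCoeff g h j k 3 * k ^ 2 ≠ 0 := by
  intro e
  have hA := H.coeff_one_mul
  have hB := H.coeff_two_mul
  have hC := H.coeff_three_mul
  have h0 := mul_ne_zero (mul_ne_zero H.sq_sum_ne H.ne₁) (mul_ne_zero H.ne₂ H.ne₃)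
  subst hg
  refine h0 ?_
  linear_combination (h ^ 2 * j ^ 2 * k ^ 2 / 2) * e + h ^ 4 * hA + j ^ 4 * hB + k ^ 4 * hC

/-- Differentiating the equations used for the singular points along `w` shows that the vector `(g
w₀, h w₁, j w₂, k w₃)` is proportional to the squares of the parameters. This determines `w` except
where a parameter vanishes. -/
theorem IsKummerParameter.exists_eq_smul_of_hessian {g h j k : ℂ} (H : IsKummerParameter g h j k)
    {w : Fin 4 → ℂ} (hw : (hessian (kummerQuartic g h j k) ![g, h, j, k]).mulVec w = 0) :
    ∃ c : ℂ, w = c • ![g, h, j, k] := by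
  have hrow : ∀ u : Fin 4 → ℂ, (hessian (kummerQuartic g h j k) ![g, h, j, k]).mulVec u = 0 → _ :=
    fun u hu => by
      have e0 := congrFun hu 0
      have e1 := congrFun hu 1
      have e2 := congrFun hu 2
      have e3 := congrFun hu 3
      rw [hessian_kummerQuartic] at e0 e1 e2 e3
      simp only [Matrix.mulVec, dotProduct, Fin.sum_univ_four, Matrix.of_apply, Matrix.cons_val,
        Pi.zero_apply] at e0 e1 e2 e3
      exact And.intro e0 (And.intro e1 (And.intro e2 e3))
  have hm := matrixM_mulVec_quarticCoeff H
  have hv0 : quarticCoeff g h j k 0 = 1 := rfl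
  rw [matrixM_mulVec_eq_zero_iff, hv0] at hm
  obtain ⟨m0, m1, m2, m3⟩ := hm
  obtain ⟨e0, e1, e2, e3⟩ := hrow w hw
  have hA := H.coeff_one_mul
  have hB := H.coeff_two_mul
  have hC := H.coeff_three_mul
  obtain ⟨c, hc⟩ : ∃ c : ℂ, g * w 0 = c * g ^ 2 ∧ h * w 1 = c * h ^ 2 ∧ j * w 2 = c * j ^ 2 ∧
      k * w 3 = c * k ^ 2 := by
    set A := quarticCoeff g h j k 1
    set B := quarticCoeff g h j k 2
    set C := quarticCoeff g h j k 3
    set D := quarticCoeff g h j k 4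
    have r₁ := hadamard_relation_polar (G := g ^ 2) (H := h ^ 2) (J := j ^ 2) (K := k ^ 2)
      (u₀ := g * w 0) (u₁ := h * w 1) (u₂ := j * w 2) (u₃ := k * w 3) (A := A)
      (by linear_combination hA) (by
        -- The derivative along `w` of the signed sum of the `x_i∂_i`: Hessian rows weighted by the
        -- coordinates plus gradient entries weighted by `w`.
        linear_combination (g * e0 + h * e1 - j * e2 - k * e3
          + (w 0 * m0 + w 1 * m1 - w 2 * m2 - w 3 * m3)) / 8)
    have r₂ := hadamard_relation_polar (G := g ^ 2) (H := j ^ 2) (J := h ^ 2) (K := k ^ 2)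
      (u₀ := g * w 0) (u₁ := j * w 2) (u₂ := h * w 1) (u₃ := k * w 3) (A := B)
      (by linear_combination hB) (by
        linear_combination (g * e0 - h * e1 + j * e2 - k * e3
          + (w 0 * m0 - w 1 * m1 + w 2 * m2 - w 3 * m3)) / 8)
    have r₃ := hadamard_relation_polar (G := g ^ 2) (H := k ^ 2) (J := h ^ 2) (K := j ^ 2)
      (u₀ := g * w 0) (u₁ := k * w 3) (u₂ := h * w 1) (u₃ := j * w 2) (A := C)
      (by linear_combination hC) (by
        linear_combination (g * e0 - h * e1 - j * e2 + k * e3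
          + (w 0 * m0 - w 1 * m1 - w 2 * m2 + w 3 * m3)) / 8)
    obtain ⟨c, h0, h1, h2, h3⟩ := hadamard_solve_polar (s₀ := g ^ 2 + h ^ 2 + j ^ 2 + k ^ 2)
      (u₀ := g * w 0 + h * w 1 + j * w 2 + k * w 3)
      (u₁ := g * w 0 + h * w 1 - j * w 2 - k * w 3)
      (u₂ := g * w 0 - h * w 1 + j * w 2 - k * w 3)
      (u₃ := g * w 0 - h * w 1 - j * w 2 + k * w 3) H.sq_sum_ne H.ne₁ H.ne₂ H.ne₃
      (by linear_combination r₁) (by linear_combination r₂) (by linear_combination r₃)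
    refine ⟨c, ?_, ?_, ?_, ?_⟩
    · linear_combination (h0 + h1 + h2 + h3) / 4
    · linear_combination (h0 + h1 - h2 - h3) / 4
    · linear_combination (h0 - h1 + h2 - h3) / 4
    · linear_combination (h0 - h1 - h2 + h3) / 4
  obtain ⟨c0, c1, c2, c3⟩ := hc
  have p0 : g = 0 ∨ w 0 = c * g := by
    by_cases hg : g = 0
    · exact Or.inl hg
    · exact Or.inr (mul_left_cancel₀ hg (by rw [c0]; ring))
  have p1 : h = 0 ∨ w 1 = c * h := by
    by_cases hg : h = 0
    · exact Or.inl hg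
    · exact Or.inr (mul_left_cancel₀ hg (by rw [c1]; ring))
  have p2 : j = 0 ∨ w 2 = c * j := by
    by_cases hg : j = 0
    · exact Or.inl hg
    · exact Or.inr (mul_left_cancel₀ hg (by rw [c2]; ring))
  have p3 : k = 0 ∨ w 3 = c * k := by
    by_cases hg : k = 0
    · exact Or.inl hg
    · exact Or.inr (mul_left_cancel₀ hg (by rw [c3]; ring))
  have ht := H.triple_ne
  have d0 := H.diag_ne
  have d1 := H.swap₁.diag_ne
  have d2 := H.swap₂.diag_ne
  have d3 := H.swap₂.swap₁.diag_ne
  rw [quarticCoeff_swap₁] at d1 d3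
  rw [quarticCoeff_swap₂] at d2 d3
  refine ⟨c, funext fun i => ?_⟩
  -- If this parameter vanishes, the other three do not, so the other entries of `w` are known and
  -- the corresponding row of the Hessian, with its nonzero diagonal entry, gives the last one.
  have q0 : w 0 = c * g := by
    refine p0.elim (fun hg => ?_) id
    have n : h ≠ 0 ∧ j ≠ 0 ∧ k ≠ 0 := by simpa [hg, and_assoc] using ht
    refine mul_left_cancel₀ (d0 hg) ?_
    linear_combination e0 - (4 * quarticCoeff g h j k 1 * g * h + quarticCoeff g h j k 4 * j * k)
      * p1.resolve_left n.1 - (4 * quarticCoeff g h j k 2 * g * j + quarticCoeff g h j k 4 * h * k)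
      * p2.resolve_left n.2.1 - (4 * quarticCoeff g h j k 3 * g * k
      + quarticCoeff g h j k 4 * h * j) * p3.resolve_left n.2.2 - 3 * c * m0
  have q1 : w 1 = c * h := by
    refine p1.elim (fun hg => ?_) id
    have n : g ≠ 0 ∧ j ≠ 0 ∧ k ≠ 0 := by simpa [hg, and_assoc] using ht
    refine mul_left_cancel₀ (d1 hg) ?_
    linear_combination e1 - (4 * quarticCoeff g h j k 1 * g * h + quarticCoeff g h j k 4 * j * k)
      * p0.resolve_left n.1 - (4 * quarticCoeff g h j k 3 * h * j + quarticCoeff g h j k 4 * g * k)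
      * p2.resolve_left n.2.1 - (4 * quarticCoeff g h j k 2 * h * k
      + quarticCoeff g h j k 4 * g * j) * p3.resolve_left n.2.2 - 3 * c * m1
  have q2 : w 2 = c * j := by
    refine p2.elim (fun hg => ?_) id
    have n : g ≠ 0 ∧ h ≠ 0 ∧ k ≠ 0 := by simpa [hg, and_assoc] using ht
    refine mul_left_cancel₀ (d2 hg) ?_
    linear_combination e2 - (4 * quarticCoeff g h j k 2 * g * j + quarticCoeff g h j k 4 * h * k)
      * p0.resolve_left n.1 - (4 * quarticCoeff g h j k 3 * h * j + quarticCoeff g h j k 4 * g * k)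
      * p1.resolve_left n.2.1 - (4 * quarticCoeff g h j k 1 * j * k
      + quarticCoeff g h j k 4 * g * h) * p3.resolve_left n.2.2 - 3 * c * m2
  have q3 : w 3 = c * k := by
    refine p3.elim (fun hg => ?_) id
    have n : g ≠ 0 ∧ h ≠ 0 ∧ j ≠ 0 := by simpa [hg, and_assoc] using ht
    refine mul_left_cancel₀ (d3 hg) ?_
    linear_combination e3 - (4 * quarticCoeff g h j k 3 * g * k + quarticCoeff g h j k 4 * h * j)
      * p0.resolve_left n.1 - (4 * quarticCoeff g h j k 2 * h * k + quarticCoeff g h j k 4 * g * j)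
      * p1.resolve_left n.2.1 - (4 * quarticCoeff g h j k 1 * j * k
      + quarticCoeff g h j k 4 * g * h) * p2.resolve_left n.2.2 - 3 * c * m3
  fin_cases i <;> assumption

theorem IsKummerParameter.rank_hessian {g h j k : ℂ} (H : IsKummerParameter g h j k) :
    (hessian (kummerQuartic g h j k) ![g, h, j, k]).rank = 3 := by
  have hne : (![g, h, j, k] : Fin 4 → ℂ) ≠ 0 :=
    IsParameterOf.ne_zero (v := quarticCoeff g h j k) ⟨H, rfl⟩
  have hker : LinearMap.ker (hessian (kummerQuartic g h j k) ![g, h, j, k]).mulVecLin =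
      Submodule.span ℂ {![g, h, j, k]} := by
    ext w
    rw [LinearMap.mem_ker, Matrix.mulVecLin_apply, Submodule.mem_span_singleton]
    constructor
    · intro hw
      obtain ⟨c, hc⟩ := H.exists_eq_smul_of_hessian hw
      exact ⟨c, hc.symm⟩
    · rintro ⟨c, rfl⟩
      have hm := matrixM_mulVec_quarticCoeff H
      have hv0 : quarticCoeff g h j k 0 = 1 := rfl
      rw [matrixM_mulVec_eq_zero_iff, hv0] at hm
      obtain ⟨m0, m1, m2, m3⟩ := hm
      rw [Matrix.mulVec_smul, hessian_kummerQuartic]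
      suffices h0 : Matrix.mulVec _ ![g, h, j, k] = 0 by rw [h0, smul_zero]
      funext i
      fin_cases i <;> simp only [Matrix.mulVec, dotProduct, Fin.sum_univ_four, Matrix.of_apply,
        Matrix.cons_val, Pi.zero_apply, Fin.mk_one, Fin.reduceFinMk, Fin.zero_eta]
      -- Euler's identity for the cubic partial derivatives: the Hessian maps the point to three
      -- times the gradient.
      · linear_combination 3 * m0
      · linear_combination 3 * m1
      · linear_combination 3 * m2
      · linear_combination 3 * m3
  have h1 := LinearMap.finrank_range_add_finrank_ker
    (hessian (kummerQuartic g h j k) ![g, h, j, k]).mulVecLin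
  rw [hker, finrank_span_singleton hne, Module.finrank_fin_fun] at h1
  rw [Matrix.rank]
  omega

/-! ### The quartic is a Kummer surface -/

theorem isHomogeneous_quarticW (i : Fin 5) :
    (quarticW (X (R := ℂ) (σ := Fin 4)) i).IsHomogeneous 4 := by
  have hX : ∀ i : Fin 4, (X i : MvPolynomial (Fin 4) ℂ).IsHomogeneous 1 := isHomogeneous_X ℂ
  have h4 : ∀ i : Fin 4, (X i ^ 4 : MvPolynomial (Fin 4) ℂ).IsHomogeneous 4 := fun i =>
    isHomogeneous_X_pow i 4
  have h22 : ∀ i j : Fin 4, (X i ^ 2 * X j ^ 2 : MvPolynomial (Fin 4) ℂ).IsHomogeneous 4 :=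
    fun i j => (isHomogeneous_X_pow i 2).mul (isHomogeneous_X_pow j 2)
  fin_cases i
  · exact (((h4 0).add (h4 1)).add (h4 2)).add (h4 3)
  · exact (h22 0 1).add (h22 2 3)
  · exact (h22 0 2).add (h22 1 3)
  · exact (h22 0 3).add (h22 1 2)
  · exact (((hX 0).mul (hX 1)).mul (hX 2)).mul (hX 3)

theorem isHomogeneous_kummerQuartic (g h j k : ℂ) : (kummerQuartic g h j k).IsHomogeneous 4 :=
  IsHomogeneous.sum _ _ _ fun i _ => by
    rw [smul_eq_C_mul]
    exact (isHomogeneous_quarticW i).C_mul _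

theorem kummerQuartic_congr {g h j k g' h' j' k' : ℂ}
    (e : quarticCoeff g h j k = quarticCoeff g' h' j' k') :
    kummerQuartic g h j k = kummerQuartic g' h' j' k' := by
  rw [kummerQuartic, kummerQuartic, e]

/-- By Euler's identity the equation `F = 0` is implied by the vanishing of the gradient. -/
theorem mem_singularPoints_iff (g h j k : ℂ) (p : Projectivization ℂ (Fin 4 → ℂ)) :
    p ∈ singularPoints (kummerQuartic g h j k) ↔
      (matrixM (p.rep 0) (p.rep 1) (p.rep 2) (p.rep 3)).mulVec (quarticCoeff g h j k) = 0 := by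
  rw [← forall_eval_pderiv_eq_zero_iff]
  refine ⟨fun hp => hp.2, fun hp => ⟨?_, hp⟩⟩
  have e0 := hp 0
  have e1 := hp 1
  have e2 := hp 2
  have e3 := hp 3
  simp only [pderiv_kummerQuartic, Matrix.cons_val, map_add, map_mul, map_pow, eval_X, eval_C,
    map_ofNat] at e0 e1 e2 e3
  rw [eval_kummerQuartic]
  linear_combination (p.rep 0 * e0 + p.rep 1 * e1 + p.rep 2 * e2 + p.rep 3 * e3) / 4

/-- Makes all nodes equivalent: each one is itself a parameter of the same quartic, so whatever
holds for the Hessian at the parameters holds at every node. -/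
theorem IsKummerParameter.isParameterOf_rep_iff {g h j k : ℂ} (H : IsKummerParameter g h j k)
    (p : Projectivization ℂ (Fin 4 → ℂ)) :
    p ∈ singularPoints (kummerQuartic g h j k) ↔ IsParameterOf (quarticCoeff g h j k) p.rep := by
  have H' : IsParameterOf (quarticCoeff g h j k) ![g, h, j, k] := ⟨H, rfl⟩
  rw [mem_singularPoints_iff]
  constructor
  · intro hp
    obtain ⟨c, e, hc, he⟩ := H'.exists_eq_smul_kummerNode p.rep_nonzero hp
    rw [he]
    exact (H'.kummerNode e).smul hc
  · rintro ⟨h1, h2⟩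
    rw [← h2]
    exact matrixM_mulVec_quarticCoeff h1

theorem IsKummerParameter.isKummerSurface {g h j k : ℂ} (H : IsKummerParameter g h j k) :
    IsKummerSurface (kummerQuartic g h j k) where
  isHomogeneous := isHomogeneous_kummerQuartic g h j k
  ncard_singularPoints := by
    have H' : IsParameterOf (quarticCoeff g h j k) ![g, h, j, k] := ⟨H, rfl⟩
    have hS : singularPoints (kummerQuartic g h j k) = Set.range fun e =>
        Projectivization.mk ℂ (kummerNode ![g, h, j, k] e) (H'.kummerNode e).ne_zero := by
      ext p
      constructor
      · intro hp
        rw [mem_singularPoints_iff] at hp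
        obtain ⟨c, e, hc, he⟩ := H'.exists_eq_smul_kummerNode p.rep_nonzero hp
        refine ⟨e, ?_⟩
        conv_rhs => rw [← p.mk_rep]
        rw [Projectivization.mk_eq_mk_iff']
        exact ⟨c⁻¹, by rw [he, smul_smul, inv_mul_cancel₀ hc, one_smul]⟩
      · rintro ⟨e, rfl⟩
        rw [H.isParameterOf_rep_iff]
        obtain ⟨a, ha⟩ := Projectivization.exists_smul_eq_mk_rep ℂ (kummerNode ![g, h, j, k] e)
          (H'.kummerNode e).ne_zero
        rw [← ha]
        exact (H'.kummerNode e).smul a.ne_zero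
    rw [hS, ← Set.image_univ, Set.ncard_image_of_injective, Set.ncard_univ,
      Nat.card_eq_fintype_card]
    · rfl
    · intro e e' he
      obtain ⟨c, hc⟩ := (Projectivization.mk_eq_mk_iff' _ _ _ _ _).1 he
      exact kummerNode_injective H' hc.symm
  isDoublePoint p hp := by
    rw [H.isParameterOf_rep_iff] at hp
    have h1 := hp.1.rank_hessian
    rw [kummerQuartic_congr hp.2] at h1
    convert h1 using 2
    congr 1
    funext i
    fin_cases i <;> rfl

end KummerMirror
end

noncomputable section
namespace KummerMirror

/-! ### Theta functions of order two and Riemann's relation -/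

/-- Representatives of the classes in `(ℤ/2)²`. -/
def evenClass : Fin 4 → ℤ × ℤ := ![(0, 0), (1, 0), (0, 1), (1, 1)]

/-- The decomposition of `ℤ²` into classes modulo `2`. -/
def parityEquiv : Fin 4 × (ℤ × ℤ) ≃ ℤ × ℤ :=
  Equiv.ofBijective (fun p => evenClass p.1 + (2 : ℤ) • p.2) (by
    constructor
    · rintro ⟨i, u⟩ ⟨i', u'⟩ h
      have h1 := congrArg Prod.fst h
      have h2 := congrArg Prod.snd h
      simp only [Prod.fst_add, Prod.snd_add, Prod.smul_fst, Prod.smul_snd, smul_eq_mul] at h1 h2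
      have hi : i = i' := by
        fin_cases i <;> fin_cases i' <;> first | rfl | (exfalso; simp [evenClass] at h1 h2; omega)
      subst hi
      exact Prod.ext rfl (Prod.ext (by dsimp only; omega) (by dsimp only; omega))
    · rintro ⟨a, b⟩
      rcases Int.even_or_odd' a with ⟨c, rfl | rfl⟩ <;> rcases Int.even_or_odd' b with ⟨d, rfl | rfl⟩
      · exact ⟨(0, (c, d)), by simp [evenClass]⟩
      · exact ⟨(2, (c, d)), by simp [evenClass, add_comm]⟩
      · exact ⟨(1, (c, d)), by simp [evenClass, add_comm]⟩
      · exact ⟨(3, (c, d)), by simp [evenClass, add_comm]⟩)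

theorem parityEquiv_apply (i : Fin 4) (u : ℤ × ℤ) :
    parityEquiv (i, u) = evenClass i + (2 : ℤ) • u := rfl

theorem tsum_eq_sum_parity {f : ℤ × ℤ → ℂ} (hf : Summable f) :
    ∑' k, f k = ∑ i, ∑' u, f (evenClass i + (2 : ℤ) • u) := by
  have hs := (parityEquiv.summable_iff (f := f)).2 hf
  rw [← parityEquiv.tsum_eq]
  exact (hs.tsum_prod' hs.prod_factor).trans (tsum_fintype _)

theorem tsum_parity_periodic (f : ℤ × ℤ → ℂ) (s m : ℤ × ℤ) :
    ∑' u, f (s + (2 : ℤ) • m + (2 : ℤ) • u) = ∑' u, f (s + (2 : ℤ) • u) := by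
  rw [← (Equiv.addLeft m).tsum_eq (fun u => f (s + (2 : ℤ) • u))]
  exact tsum_congr fun u => by rw [Equiv.coe_addLeft, smul_add, add_assoc]

theorem parity_injective (s : ℤ × ℤ) : Function.Injective fun u : ℤ × ℤ => s + (2 : ℤ) • u := by
  intro u u' h
  have h1 := congrArg Prod.fst h
  have h2 := congrArg Prod.snd h
  simp only [Prod.fst_add, Prod.snd_add, Prod.smul_fst, Prod.smul_snd, smul_eq_mul] at h1 h2
  exact Prod.ext (by omega) (by omega)

theorem summable_parity {f : ℤ × ℤ → ℂ} (hf : Summable f) (s : ℤ × ℤ) :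
    Summable fun u : ℤ × ℤ => f (s + (2 : ℤ) • u) := hf.comp_injective (parity_injective s)

/-- Summing over the characteristic `i` and over `u` in the first factor lets its index run freely
over `ℤ²`; the other three indices are then tied to it modulo two. -/
theorem sum_mul_four_eq_tsum {A B C D : ℤ × ℤ → ℂ} (hA : Summable A) (hB : Summable B)
    (hC : Summable C) (hD : Summable D) (p q : ℤ × ℤ) :
    ∑ i, (∑' u, A (evenClass i + (2 : ℤ) • u)) * ((∑' u, B (evenClass i + p + (2 : ℤ) • u)) *
      ((∑' u, C (evenClass i + q + (2 : ℤ) • u)) *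
        ∑' u, D (evenClass i + (p + q) + (2 : ℤ) • u))) =
    ∑' K : (ℤ × ℤ) × (ℤ × ℤ) × (ℤ × ℤ) × (ℤ × ℤ), A K.1 * (B (K.1 + p + (2 : ℤ) • K.2.1) *
      (C (K.1 + q + (2 : ℤ) • K.2.2.1) * D (K.1 + (p + q) + (2 : ℤ) • K.2.2.2))) := by
  have hCD := summable_mul_of_summable_norm hC.norm hD.norm
  have hBCD := summable_mul_of_summable_norm hB.norm hCD.norm
  have hABCD := summable_mul_of_summable_norm hA.norm hBCD.norm
  have hinj : Function.Injective fun K : (ℤ × ℤ) × (ℤ × ℤ) × (ℤ × ℤ) × (ℤ × ℤ) =>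
      (K.1, K.1 + p + (2 : ℤ) • K.2.1, K.1 + q + (2 : ℤ) • K.2.2.1,
        K.1 + (p + q) + (2 : ℤ) • K.2.2.2) := by
    rintro ⟨a, b, c, d⟩ ⟨a', b', c', d'⟩ h
    simp only [Prod.mk.injEq] at h
    obtain ⟨rfl, h1, h2, h3⟩ := h
    rw [parity_injective _ h1, parity_injective _ h2, parity_injective _ h3]
  have hs := hABCD.comp_injective hinj
  have h1 : ∀ k, (∑' L : (ℤ × ℤ) × (ℤ × ℤ) × (ℤ × ℤ), A k * (B (k + p + (2 : ℤ) • L.1) *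
      (C (k + q + (2 : ℤ) • L.2.1) * D (k + (p + q) + (2 : ℤ) • L.2.2)))) =
      A k * ((∑' u, B (k + p + (2 : ℤ) • u)) * ((∑' u, C (k + q + (2 : ℤ) • u)) *
        ∑' u, D (k + (p + q) + (2 : ℤ) • u))) := fun k => by
    have sB := (summable_parity hB (k + p)).norm
    have sC := (summable_parity hC (k + q)).norm
    have sD := (summable_parity hD (k + (p + q))).norm
    rw [tsum_mul_left, tsum_mul_tsum_of_summable_norm sC sD, tsum_mul_tsum_of_summable_norm sB]
    exact (summable_mul_of_summable_norm sC sD).norm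
  have hs2 := hs.tsum_prod' hs.prod_factor
  refine Eq.trans ?_ hs2.symm
  simp only [Function.comp_apply]
  rw [tsum_congr h1, tsum_eq_sum_parity]
  · refine Finset.sum_congr rfl fun i _ => ?_
    rw [← tsum_mul_right]
    refine tsum_congr fun u => ?_
    have e : ∀ s, evenClass i + (2 : ℤ) • u + s = evenClass i + s + (2 : ℤ) • u := fun s => by abel
    rw [e, e, e, tsum_parity_periodic, tsum_parity_periodic, tsum_parity_periodic]
  · have := hs.prod
    simp only [Function.comp_apply] at this
    exact this.congr fun k => h1 k

variable (ω : SymplecticForm)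

theorem summable_gauss_mul_torusChar (x : ℝ × ℝ) :
    Summable fun k => gauss ω 1 k * torusChar x k :=
  summable_mul_torusChar (summable_gauss ω one_pos) x

/-- The theta function of order two with characteristic `a/2`. -/
def thetaX (a : ℤ × ℤ) (x : ℝ × ℝ) : ℂ :=
  ∑' u : ℤ × ℤ, gauss ω 1 (a + (2 : ℤ) • u) * torusChar x (a + (2 : ℤ) • u)

theorem thetaX_add_two_smul (a m : ℤ × ℤ) (x : ℝ × ℝ) :
    thetaX ω (a + (2 : ℤ) • m) x = thetaX ω a x :=
  tsum_parity_periodic (fun k => gauss ω 1 k * torusChar x k) a m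

/-- The involution of `(ℤ²)⁴` behind Riemann's relation. -/
def riemannEquiv (p q : ℤ × ℤ) :
    (ℤ × ℤ) × (ℤ × ℤ) × (ℤ × ℤ) × (ℤ × ℤ) ≃ (ℤ × ℤ) × (ℤ × ℤ) × (ℤ × ℤ) × (ℤ × ℤ) :=
  Function.Involutive.toPerm (fun K => ((2 : ℤ) • K.1 + p + q + K.2.1 + K.2.2.1 + K.2.2.2,
    -K.1 - p - q - K.2.2.1 - K.2.2.2, -K.1 - p - q - K.2.1 - K.2.2.2,
    -K.1 - p - q - K.2.1 - K.2.2.1)) (by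
      rintro ⟨k, u, v, w⟩
      simp only [Prod.mk.injEq]
      refine ⟨?_, ?_, ?_, ?_⟩ <;> module)

theorem riemannEquiv_apply (p q k u v w : ℤ × ℤ) :
    riemannEquiv p q (k, u, v, w) = ((2 : ℤ) • k + p + q + u + v + w, -k - p - q - v - w,
      -k - p - q - u - w, -k - p - q - u - v) := rfl

/-- Riemann's theta relation. -/
theorem riemann_relation (p q : ℤ × ℤ) (x : ℝ × ℝ) :
    ∑ i, thetaX ω (evenClass i) x * (thetaX ω (evenClass i + p) x *
      (thetaX ω (evenClass i + q) x * thetaX ω (evenClass i + (p + q)) x)) =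
    ∑ i, thetaX ω (evenClass i) ((2 : ℝ) • x) * (thetaX ω (evenClass i + p) 0 *
      (thetaX ω (evenClass i + q) 0 * thetaX ω (evenClass i + (p + q)) 0)) := by
  have s := summable_gauss_mul_torusChar ω x
  have s2 := summable_gauss_mul_torusChar ω ((2 : ℝ) • x)
  have s0 := summable_gauss_mul_torusChar ω 0
  have h1 := sum_mul_four_eq_tsum s s s s p q
  have h2 := sum_mul_four_eq_tsum s2 s0 s0 s0 p q
  -- On the four lattice vectors themselves the involution is half the Hadamard matrix. It is
  -- orthogonal, so the product of the Gaussians is preserved, and the sum of the old vectors is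
  -- twice the new first one, so the four characters at `x` merge into one at `2x`.
  refine h1.trans (Eq.trans ?_ h2.symm)
  rw [← (riemannEquiv p q).tsum_eq]
  refine tsum_congr fun K => ?_
  obtain ⟨⟨k, k'⟩, ⟨u, u'⟩, ⟨v, v'⟩, ⟨w, w'⟩⟩ := K
  obtain ⟨p, p'⟩ := p
  obtain ⟨q, q'⟩ := q
  simp only [riemannEquiv_apply, torusChar, gauss, quadForm,
    ← Complex.exp_add, Prod.mk_add_mk, Prod.smul_mk, Prod.neg_mk, Prod.mk_sub_mk, smul_eq_mul,
    Prod.smul_fst, Prod.smul_snd, Prod.fst_zero, Prod.snd_zero]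
  congr 1
  push_cast
  ring

end KummerMirror
end

noncomputable section
namespace KummerMirror

/-! ### The generators as theta functions -/

variable (ω : SymplecticForm)

theorem tsum_ite_dvd_eq (f : ℤ × ℤ → ℂ) {d : ℤ} (hd : d ≠ 0) (s : ℤ × ℤ) :
    (∑' k : ℤ × ℤ, if d ∣ k.1 - s.1 ∧ d ∣ k.2 - s.2 then f k else 0) =
      ∑' u : ℤ × ℤ, f (s + d • u) := by
  have hinj : Function.Injective fun u : ℤ × ℤ => s + d • u := by
    intro u u' h
    have h1 := mul_left_cancel₀ hd (add_left_cancel (congrArg Prod.fst h))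
    have h2 := mul_left_cancel₀ hd (add_left_cancel (congrArg Prod.snd h))
    exact Prod.ext h1 h2
  rw [← hinj.tsum_eq]
  · exact tsum_congr fun u => by simp
  · intro k hk
    rw [Function.mem_support] at hk
    by_cases h : d ∣ k.1 - s.1 ∧ d ∣ k.2 - s.2
    · obtain ⟨⟨y, hy⟩, ⟨z, hz⟩⟩ := h
      refine ⟨(y, z), Prod.ext ?_ ?_⟩
      · show s.1 + d * y = k.1
        linarith
      · show s.2 + d * z = k.2
        linarith
    · exact absurd (if_neg h) hk

open Classical in
theorem coeff_kummerGen (l : ℕ+) (k : ℤ × ℤ) (n : ℕ) (v : ℤ × ℤ) :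
    (kummerGen ω l k).1.coeff n v =
      if n = (l : ℕ) ∧ (SamePoint l v k ∨ SamePoint l v (-k)) then 1 else 0 := by
  show TorusRing.coeff (Finset.sum _ _) n v = _
  by_cases h : torusGen ω l k = torusGen ω l (-k)
  · have h1 := congrArg (fun f => f.coeff n v) h
    simp only [coeff_torusGen] at h1
    rw [← h, Finset.pair_eq_singleton, Finset.sum_singleton, coeff_torusGen]
    by_cases h2 : n = (l : ℕ) ∧ SamePoint l v k
    · rw [if_pos h2, if_pos ⟨h2.1, Or.inl h2.2⟩]
    · rw [if_neg h2]
      rw [if_neg h2] at h1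
      rw [if_neg]
      rintro ⟨h3, h4 | h4⟩
      · exact h2 ⟨h3, h4⟩
      · rw [if_pos ⟨h3, h4⟩] at h1
        exact zero_ne_one h1
  · rw [Finset.sum_pair h, TorusRing.coeff_add, coeff_torusGen, coeff_torusGen]
    have h1 : ¬ (SamePoint l v k ∧ SamePoint l v (-k)) := by
      rintro ⟨⟨h1, h2⟩, h3, h4⟩
      refine h (TorusRing.ext fun m w => ?_)
      have e1 := dvd_sub h1 h3
      have e2 := dvd_sub h2 h4
      rw [sub_sub_sub_cancel_left] at e1 e2
      have : SamePoint l w k ↔ SamePoint l w (-k) := by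
        refine and_congr (Iff.trans ?_ (dvd_add_left e1)) (Iff.trans ?_ (dvd_add_left e2)) <;>
          rw [sub_add_sub_cancel]
      simp only [coeff_torusGen, this]
    by_cases hn : n = (l : ℕ) <;> by_cases h2 : SamePoint l v k <;>
      by_cases h3 : SamePoint l v (-k) <;> simp_all

theorem coeff_coordX (i : Fin 4) (n : ℕ) (v : ℤ × ℤ) : (coordX ω i).1.coeff n v =
    if n = 1 ∧ (2 ∣ v.1 - (evenClass i).1 ∧ 2 ∣ v.2 - (evenClass i).2) then 1 else 0 := by
  classical
  obtain ⟨a, b⟩ := v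
  fin_cases i <;>
  · refine (coeff_kummerGen ω _ _ n (a, b)).trans (if_congr ?_ rfl rfl)
    simp [SamePoint, evenClass]
    try omega

/-- The orbit sums in each `Z_r` exhaust one class of doubled vectors modulo four, each point once.
-/
theorem coeff_elemZ (i : Fin 4) (n : ℕ) (v : ℤ × ℤ) : (elemZ ω i).1.coeff n v =
    if n = 4 ∧ (4 ∣ v.1 - (2 • evenClass i).1 ∧ 4 ∣ v.2 - (2 • evenClass i).2) then 1 else 0 := by
  classical
  obtain ⟨a, b⟩ := v
  have h4 : ((4 : ℕ+) : ℕ) = 4 := rfl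
  have hadd : ∀ f g : kummerRing ω, (f + g).1.coeff n (a, b) =
    f.1.coeff n (a, b) + g.1.coeff n (a, b) := fun _ _ => rfl
  by_cases hn : n = 4
  · subst hn
    fin_cases i <;>
    · simp only [elemZ, Matrix.cons_val, Fin.reduceFinMk, Fin.zero_eta, Fin.isValue, Fin.mk_one,
        Matrix.cons_val_zero, Matrix.cons_val_one, hadd, coeff_kummerGen, SamePoint,
        evenClass, h4, true_and, Prod.fst_neg, Prod.snd_neg, Prod.smul_mk]
      norm_num
      split_ifs <;> first | rfl | (exfalso; omega) | simp
  · rw [if_neg (fun h => hn h.1)]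
    fin_cases i <;>
    · simp only [elemZ, Matrix.cons_val, Fin.reduceFinMk, Fin.zero_eta, Fin.isValue, Fin.mk_one,
        Matrix.cons_val_zero, Matrix.cons_val_one, hadd, coeff_kummerGen, h4, hn, false_and,
        if_false, add_zero]

variable {ω} in
theorem TorusRing.evalAt_smul (c : ℂ) (f : TorusRing ω) (l : ℕ) (x : ℝ × ℝ) :
    (c • f).evalAt l x = c * f.evalAt l x := by
  rw [TorusRing.evalAt, TorusRing.evalAt, ← tsum_mul_left]
  exact tsum_congr fun k => by rw [TorusRing.coeff_smul]; ring

theorem evalAt_coordX (i : Fin 4) (n : ℕ) (x : ℝ × ℝ) :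
    (coordX ω i).1.evalAt n x = if n = 1 then thetaX ω (evenClass i) x else 0 := by
  by_cases hn : n = 1
  · subst hn
    rw [if_pos rfl, thetaX, TorusRing.evalAt,
      ← tsum_ite_dvd_eq (fun k => gauss ω 1 k * torusChar x k) two_ne_zero]
    refine tsum_congr fun k => ?_
    rw [coeff_coordX]
    split_ifs <;> simp_all
  · rw [if_neg hn]
    refine (tsum_congr fun k => ?_).trans tsum_zero
    rw [coeff_coordX, if_neg fun h => hn h.1, zero_mul, zero_mul]

/-- Together with `torusChar_two_smul` this is the reason for `Z_r(x) = X_r(2x)`. -/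
theorem gauss_four_two_smul (k : ℤ × ℤ) : gauss ω 4 ((2 : ℤ) • k) = gauss ω 1 k := by
  simp only [gauss, quadForm, Prod.smul_fst, Prod.smul_snd, smul_eq_mul]
  congr 2
  push_cast
  ring

theorem evalAt_elemZ (i : Fin 4) (n : ℕ) (x : ℝ × ℝ) :
    (elemZ ω i).1.evalAt n x = if n = 4 then thetaX ω (evenClass i) ((2 : ℝ) • x) else 0 := by
  by_cases hn : n = 4
  · subst hn
    have e : thetaX ω (evenClass i) ((2 : ℝ) • x) = ∑' u : ℤ × ℤ,
        gauss ω 4 (2 • evenClass i + (4 : ℤ) • u) * torusChar x (2 • evenClass i + (4 : ℤ) • u) :=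
      tsum_congr fun u => by
        have : 2 • evenClass i + (4 : ℤ) • u = (2 : ℤ) • (evenClass i + (2 : ℤ) • u) := by module
        rw [this, gauss_four_two_smul, torusChar_two_smul]
    rw [if_pos rfl, e, TorusRing.evalAt,
      ← tsum_ite_dvd_eq (fun k => gauss ω 4 k * torusChar x k) four_ne_zero]
    refine tsum_congr fun k => ?_
    rw [coeff_elemZ]
    split_ifs <;> simp_all
  · rw [if_neg hn]
    refine (tsum_congr fun k => ?_).trans tsum_zero
    rw [coeff_elemZ, if_neg fun h => hn h.1, zero_mul, zero_mul]

/-- The evaluation at `x` as a homomorphism of `ℂ`-algebras. -/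
def evalAlg (x : ℝ × ℝ) : kummerRing ω →ₐ[ℂ] PowerSeries ℂ :=
  AlgHom.ofLinearMap
    { toFun := fun f => TorusRing.evalSeries ω x f.1
      map_add' := fun f g => map_add (TorusRing.evalSeries ω x) f.1 g.1
      map_smul' := fun c f => by
        ext n
        rw [TorusRing.coeff_evalSeries, map_smul, TorusRing.coeff_evalSeries]
        exact TorusRing.evalAt_smul c f.1 n x }
    (map_one (TorusRing.evalSeries ω x))
    (fun f g => map_mul (TorusRing.evalSeries ω x) f.1 g.1)

variable {ω} in
theorem coeff_evalAlg (x : ℝ × ℝ) (f : kummerRing ω) (n : ℕ) :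
    PowerSeries.coeff n (evalAlg ω x f) = f.1.evalAt n x := TorusRing.coeff_evalSeries x f.1 n

variable {ω} in
theorem ext_evalAlg {f g : kummerRing ω} (h : ∀ x, evalAlg ω x f = evalAlg ω x g) : f = g :=
  Subtype.ext (TorusRing.ext_evalAt fun l x => by
    rw [← coeff_evalAlg, ← coeff_evalAlg, h])

theorem evalAlg_coordX (i : Fin 4) (x : ℝ × ℝ) :
    evalAlg ω x (coordX ω i) = thetaX ω (evenClass i) x • (PowerSeries.X : PowerSeries ℂ) ^ 1 := by
  ext n
  rw [coeff_evalAlg, evalAt_coordX, map_smul, PowerSeries.coeff_X_pow]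
  simp

theorem evalAlg_elemZ (i : Fin 4) (x : ℝ × ℝ) :
    evalAlg ω x (elemZ ω i) =
      thetaX ω (evenClass i) ((2 : ℝ) • x) • (PowerSeries.X : PowerSeries ℂ) ^ 4 := by
  ext n
  rw [coeff_evalAlg, evalAt_elemZ, map_smul, PowerSeries.coeff_X_pow]
  simp

/-! ### The parameters as theta constants -/

theorem theta_two_mul (a b : ℤ) :
    theta ω (2 * a) (2 * b) 2 = ∑' p : ℤ × ℤ, gauss ω 1 ((a, b) + (4 : ℤ) • p) := by
  refine tsum_congr fun p => ?_
  rw [← Complex.exp_add, ← Complex.exp_add, gauss]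
  congr 1
  simp only [quadForm, Prod.fst_add, Prod.snd_add, Prod.smul_fst, Prod.smul_snd, smul_eq_mul]
  push_cast
  ring

/-- The partial theta constants `∑ exp (2πi Q(k)/4)`, `k ≡ (a, b)` modulo `4`. -/
def gaussSum (a b : ℤ) : ℂ := ∑' p : ℤ × ℤ, gauss ω 1 ((a, b) + (4 : ℤ) • p)

theorem gauss_neg (l : ℕ) (k : ℤ × ℤ) : gauss ω l (-k) = gauss ω l k := by
  simp [gauss, quadForm]

theorem gaussSum_neg (a b : ℤ) : gaussSum ω (-a) (-b) = gaussSum ω a b := by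
  rw [gaussSum, ← (Equiv.neg (ℤ × ℤ)).tsum_eq]
  refine tsum_congr fun p => ?_
  rw [← gauss_neg]
  congr 1
  simp [add_comm]

theorem gaussSum_add (a b c d : ℤ) : gaussSum ω (a + 4 * c) (b + 4 * d) = gaussSum ω a b := by
  rw [gaussSum, ← (Equiv.subRight ((c, d) : ℤ × ℤ)).tsum_eq]
  refine tsum_congr fun p => ?_
  congr 1
  ext <;> simp <;> ring

theorem thetaX_zero (a b : ℤ) : thetaX ω (a, b) 0 = gaussSum ω a b + gaussSum ω (a + 2) b +
    gaussSum ω a (b + 2) + gaussSum ω (a + 2) (b + 2) := by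
  have h := summable_parity (summable_gauss ω one_pos) (a, b)
  have e : thetaX ω (a, b) 0 = ∑' u : ℤ × ℤ, gauss ω 1 ((a, b) + (2 : ℤ) • u) :=
    tsum_congr fun u => by rw [torusChar_zero_left, mul_one]
  rw [e, tsum_eq_sum_parity h, Fin.sum_univ_four]
  congr 1
  · congr 1
    · congr 1
      all_goals
        refine tsum_congr fun u => congrArg _ ?_
        ext <;> simp [evenClass] <;> ring
    · refine tsum_congr fun u => congrArg _ ?_
      ext <;> simp [evenClass] <;> ring
  · refine tsum_congr fun u => congrArg _ ?_
    ext <;> simp [evenClass] <;> ring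

/-- The parameters `(g, h, j, k)`. -/
def kummerParam : Fin 4 → ℂ := ![paramG ω, paramH ω, paramJ ω, paramK ω]

/-- A class modulo two splits into four classes modulo four. For a nonzero class, `k ↦ -k` exchanges
these in pairs, whence the factor two; for the zero class it fixes all four, and the factor `1/2` in
`g` compensates. -/
theorem thetaX_evenClass_zero (i : Fin 4) : thetaX ω (evenClass i) 0 = 2 * kummerParam ω i := by
  have e : ∀ a b : ℤ, theta ω (2 * a) (2 * b) 2 = gaussSum ω a b := theta_two_mul ω
  have n1 := gaussSum_neg ω 1 0
  have n2 := gaussSum_neg ω 0 1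
  have n3 := gaussSum_neg ω 1 1
  have n4 := gaussSum_neg ω 3 1
  have n5 := gaussSum_neg ω 1 2
  have n6 := gaussSum_neg ω 2 1
  have p1 := gaussSum_add ω (-1) 0 1 0
  have p2 := gaussSum_add ω 0 (-1) 0 1
  have p3 := gaussSum_add ω (-1) (-1) 1 1
  have p4 := gaussSum_add ω (-3) (-1) 1 1
  have p5 := gaussSum_add ω (-1) (-2) 1 1
  have p6 := gaussSum_add ω (-2) (-1) 1 1
  norm_num at n1 n2 n3 n4 n5 n6 p1 p2 p3 p4 p5 p6
  fin_cases i
  · show thetaX ω (0, 0) 0 = 2 * paramG ω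
    have e0 := e 0 0
    have e1 := e 2 0
    have e2 := e 0 2
    have e3 := e 2 2
    norm_num at e0 e1 e2 e3
    rw [thetaX_zero, paramG, e0, e1, e2, e3]
    ring_nf
  · show thetaX ω (1, 0) 0 = 2 * paramH ω
    have e0 := e 1 0
    have e1 := e 1 2
    norm_num at e0 e1
    rw [thetaX_zero, paramH, e0, e1]
    norm_num
    rw [p1, n1, p5, n5]
    ring
  · show thetaX ω (0, 1) 0 = 2 * paramJ ω
    have e0 := e 0 1
    have e1 := e 2 1
    norm_num at e0 e1
    rw [thetaX_zero, paramJ, e0, e1]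
    norm_num
    rw [p2, n2, p6, n6]
    ring
  · show thetaX ω (1, 1) 0 = 2 * paramK ω
    have e0 := e 1 1
    have e1 := e 3 1
    norm_num at e0 e1
    rw [thetaX_zero, paramK, e0, e1]
    norm_num
    rw [p3, n3, p4, n4]
    ring

theorem thetaX_evenClass_add (i j : Fin 4) (x : ℝ × ℝ) :
    thetaX ω (evenClass i + evenClass j) x = thetaX ω (evenClass (i ^^^ j)) x := by
  obtain ⟨m, hm⟩ : ∃ m, evenClass i + evenClass j = evenClass (i ^^^ j) + (2 : ℤ) • m := by
    fin_cases i <;> fin_cases j <;>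
      first
      | exact ⟨(0, 0), by decide⟩
      | exact ⟨(1, 0), by decide⟩
      | exact ⟨(0, 1), by decide⟩
      | exact ⟨(1, 1), by decide⟩
  rw [hm, thetaX_add_two_smul]

theorem riemann_relation_evenClass {a b c : Fin 4}
    (h : evenClass a + evenClass b = evenClass c) (x : ℝ × ℝ) :
    ∑ i, thetaX ω (evenClass i) x * (thetaX ω (evenClass (i ^^^ a)) x *
      (thetaX ω (evenClass (i ^^^ b)) x * thetaX ω (evenClass (i ^^^ c)) x)) =
    ∑ i, thetaX ω (evenClass i) ((2 : ℝ) • x) * (2 * kummerParam ω (i ^^^ a) *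
      (2 * kummerParam ω (i ^^^ b) * (2 * kummerParam ω (i ^^^ c)))) := by
  have := riemann_relation ω (evenClass a) (evenClass b) x
  simpa only [h, thetaX_evenClass_add, thetaX_evenClass_zero] using this

/-- Riemann's relation for the pairs of classes `(0,0)`, `(0,1)`, `(0,2)`, `(0,3)`, `(1,2)`. Its
left side counts the monomials once, twice or, for `W₄`, four times, hence the divisors at the end.
-/
theorem quarticW_coordX (i : Fin 5) : quarticW (coordX ω) i =
    ∑ j, matrixM (paramG ω) (paramH ω) (paramJ ω) (paramK ω) j i • elemZ ω j := by
  refine ext_evalAlg fun x => ?_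
  have r0 := riemann_relation_evenClass ω (a := 0) (b := 0) (c := 0) (by decide) x
  have r1 := riemann_relation_evenClass ω (a := 0) (b := 1) (c := 1) (by decide) x
  have r2 := riemann_relation_evenClass ω (a := 0) (b := 2) (c := 2) (by decide) x
  have r3 := riemann_relation_evenClass ω (a := 0) (b := 3) (c := 3) (by decide) x
  have r4 := riemann_relation_evenClass ω (a := 1) (b := 2) (c := 3) (by decide) x
  have x11 : (1 ^^^ 1 : Fin 4) = 0 := rfl
  have x12 : (1 ^^^ 2 : Fin 4) = 3 := rfl
  have x13 : (1 ^^^ 3 : Fin 4) = 2 := rfl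
  have x21 : (2 ^^^ 1 : Fin 4) = 3 := rfl
  have x22 : (2 ^^^ 2 : Fin 4) = 0 := rfl
  have x23 : (2 ^^^ 3 : Fin 4) = 1 := rfl
  have x31 : (3 ^^^ 1 : Fin 4) = 2 := rfl
  have x32 : (3 ^^^ 2 : Fin 4) = 1 := rfl
  have x33 : (3 ^^^ 3 : Fin 4) = 0 := rfl
  have x0 : ∀ i : Fin 4, i ^^^ 0 = i := by decide
  have x0' : ∀ i : Fin 4, 0 ^^^ i = i := by decide
  have k0 : kummerParam ω 0 = paramG ω := rfl
  have k1 : kummerParam ω 1 = paramH ω := rfl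
  have k2 : kummerParam ω 2 = paramJ ω := rfl
  have k3 : kummerParam ω 3 = paramK ω := rfl
  simp only [Fin.sum_univ_four, x0, x0', x11, x12, x13, x21, x22, x23, x31, x32, x33,
    k0, k1, k2, k3] at r0 r1 r2 r3 r4
  have hL : evalAlg ω x (quarticW (coordX ω) i) =
      quarticW (fun a => thetaX ω (evenClass a) x) i • (PowerSeries.X : PowerSeries ℂ) ^ 4 := by
    fin_cases i <;>
    · simp only [quarticW, Matrix.cons_val, Fin.reduceFinMk, Fin.zero_eta, Fin.mk_one,
        Matrix.cons_val_zero, Matrix.cons_val_one, map_add, map_mul, map_pow, evalAlg_coordX,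
        pow_one, smul_pow, smul_mul_smul_comm, add_smul, ← pow_add]
      try ring_nf
  have hR : evalAlg ω x (∑ j, matrixM (paramG ω) (paramH ω) (paramJ ω) (paramK ω) j i •
      elemZ ω j) = (∑ j, matrixM (paramG ω) (paramH ω) (paramJ ω) (paramK ω) j i *
        thetaX ω (evenClass j) ((2 : ℝ) • x)) • (PowerSeries.X : PowerSeries ℂ) ^ 4 := by
    rw [map_sum, Finset.sum_smul]
    exact Finset.sum_congr rfl fun j _ => by rw [map_smul, evalAlg_elemZ, smul_smul]
  rw [hL, hR]
  congr 1
  rw [Fin.sum_univ_four]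
  fin_cases i
  · simp [quarticW, matrixM]
    linear_combination r0
  · simp [quarticW, matrixM]
    linear_combination r1 / 2
  · simp [quarticW, matrixM]
    linear_combination r2 / 2
  · simp [quarticW, matrixM]
    linear_combination r3 / 2
  · simp [quarticW, matrixM]
    linear_combination r4 / 4

end KummerMirror
end

noncomputable section
namespace KummerMirror
open MvPolynomial

/-! ### The Heisenberg group -/

variable (ω : SymplecticForm)

/-- The character `k ↦ (-1)^{σ₁ k₁ + σ₂ k₂}` of `ℤ²`. -/
def signChar (σ k : ℤ × ℤ) : ℂ := (-1) ^ (σ.1 * k.1 + σ.2 * k.2)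

theorem signChar_add (σ k m : ℤ × ℤ) : signChar σ (k + m) = signChar σ k * signChar σ m := by
  rw [signChar, signChar, signChar, ← zpow_add₀ (by norm_num)]
  congr 1
  simp only [Prod.fst_add, Prod.snd_add]
  ring

theorem signChar_two_smul (σ k : ℤ × ℤ) : signChar σ ((2 : ℤ) • k) = 1 :=
  Even.neg_one_zpow ⟨σ.1 * k.1 + σ.2 * k.2, by
    simp only [Prod.smul_fst, Prod.smul_snd, smul_eq_mul]; ring⟩

theorem signChar_zero (σ : ℤ × ℤ) : signChar σ 0 = 1 := by simp [signChar]

/-- The automorphism `y^l_k ↦ (-1)^{σ·k} y^l_k` of `R(T)`. -/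
def signHom (σ : ℤ × ℤ) : TorusRing ω →ₐ[ℂ] TorusRing ω :=
  AlgHom.ofLinearMap
    { toFun := fun f => TorusRing.mk (fun l k => signChar σ k * f.coeff l k) (by
        obtain ⟨h1, h2, N, h3⟩ := f.mem
        refine ⟨fun l k n => ?_, fun k hk => ?_, N, fun l hl k => ?_⟩
        · show signChar σ _ * f.coeff l _ = signChar σ k * f.coeff l k
          rw [h1, signChar_add, mul_smul, signChar_two_smul, mul_one]
        · show signChar σ k * f.coeff 0 k = 0
          rw [h2 k hk, mul_zero]
        · show signChar σ k * f.coeff l k = 0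
          rw [h3 l hl, mul_zero])
      map_add' := fun f g => TorusRing.ext fun l k => mul_add _ _ _
      map_smul' := fun c f => TorusRing.ext fun l k => mul_left_comm _ _ _ }
    (TorusRing.ext fun l k => by
      show signChar σ k * (1 : TorusRing ω).coeff l k = _
      rw [TorusRing.coeff_one]
      split_ifs with h
      · rw [h.2, signChar_zero, mul_one]
      · exact mul_zero _)
    (fun f g => TorusRing.ext fun n k => by
      show signChar σ k * (f * g).coeff n k = TorusRing.coeff (TorusRing.mk _ _ * TorusRing.mk _ _) n k
      rw [TorusRing.coeff_mul, TorusRing.coeff_mul, Finset.mul_sum]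
      refine Finset.sum_congr rfl fun p _ => ?_
      rw [← tsum_mul_left]
      refine tsum_congr fun a => ?_
      have : signChar σ k = signChar σ a * signChar σ (k - a) := by
        rw [← signChar_add, add_sub_cancel]
      rw [this, TorusRing.coeff_mk, TorusRing.coeff_mk]
      ring)

theorem coeff_signHom (σ : ℤ × ℤ) (f : TorusRing ω) (l : ℕ) (k : ℤ × ℤ) :
    (signHom ω σ f).coeff l k = signChar σ k * f.coeff l k := rfl

/-- Moving `a` by `lτ` and `c` by `mτ` translates the `x`-coordinates of all three corners by `τ/2`,
which leaves the area unchanged. -/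
theorem weight_add_smul {l m : ℕ} (hl : 0 < l) (hm : 0 < m) (a c τ : ℤ × ℤ) :
    weight ω l m (a + (l : ℤ) • τ) (c + (m : ℤ) • τ) = weight ω l m a c := by
  unfold weight
  rw [rho_iterate_pt, rho_iterate_pt]
  congr 2
  have key : ∀ u v : Vec, u - v = ⟨u.x₁ - v.x₁, u.y₁ - v.y₁, u.x₂ - v.x₂, u.y₂ - v.y₂⟩ :=
    fun _ _ => rfl
  simp only [SymplecticForm.triangleArea, SymplecticForm.eval, key, pt, shiftY,
    Prod.fst_add, Prod.snd_add, Prod.smul_fst, Prod.smul_snd, smul_eq_mul]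
  have h1 : (l : ℂ) ≠ 0 := by exact_mod_cast hl.ne'
  have h2 : (m : ℂ) ≠ 0 := by exact_mod_cast hm.ne'
  have h3 : (l : ℂ) + m ≠ 0 := by exact_mod_cast (by omega : l + m ≠ 0)
  push_cast
  field_simp
  ring

/-- The automorphism `y^l_k ↦ y^l_{k - lτ}` of `R(T)`. -/
def shiftHom (τ : ℤ × ℤ) : TorusRing ω →ₐ[ℂ] TorusRing ω :=
  AlgHom.ofLinearMap
    { toFun := fun f => TorusRing.mk (fun l k => f.coeff l (k + (l : ℤ) • τ)) (by
        obtain ⟨h1, h2, N, h3⟩ := f.mem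
        refine ⟨fun l k n => ?_, fun k hk => h2 _ (by simpa using hk), N, fun l hl k => h3 l hl _⟩
        show f.coeff l (k + (2 * l : ℤ) • n + (l : ℤ) • τ) = _
        rw [add_right_comm, h1])
      map_add' := fun f g => rfl
      map_smul' := fun c f => rfl }
    (TorusRing.ext fun l k => by
      show (1 : TorusRing ω).coeff l (k + (l : ℤ) • τ) = _
      rw [TorusRing.coeff_one, TorusRing.coeff_one]
      by_cases h : l = 0
      · subst h; simp
      · simp [h])
    (fun f g => TorusRing.ext fun n k => by
      show (f * g).coeff n (k + (n : ℤ) • τ) =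
        TorusRing.coeff (TorusRing.mk _ _ * TorusRing.mk _ _) n k
      rw [TorusRing.coeff_mul, TorusRing.coeff_mul]
      refine Finset.sum_congr rfl fun p hp => ?_
      have hp' : p.1 + p.2 = n := Finset.HasAntidiagonal.mem_antidiagonal.1 hp
      rw [← (Equiv.addRight ((p.1 : ℤ) • τ)).tsum_eq]
      refine tsum_congr fun a => ?_
      have e : k + (n : ℤ) • τ - (a + (p.1 : ℤ) • τ) = k - a + (p.2 : ℤ) • τ := by
        rw [← hp']; push_cast; module
      simp only [Equiv.coe_addRight, TorusRing.coeff_mk]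
      rw [e]
      rcases Nat.eq_zero_or_pos p.1 with h0 | hl
      · by_cases ha : a = 0
        · subst ha
          simp [h0, weight_zero_left]
        · simp [h0, f.mem.2.1 a ha]
      rcases Nat.eq_zero_or_pos p.2 with h0 | hm
      · by_cases ha : k - a = 0
        · rw [ha]
          simp [h0, weight_zero_right]
        · simp [h0, g.mem.2.1 _ ha]
      rw [weight_add_smul ω hl hm])

theorem coeff_shiftHom (τ : ℤ × ℤ) (f : TorusRing ω) (l : ℕ) (k : ℤ × ℤ) :
    (shiftHom ω τ f).coeff l k = f.coeff l (k + (l : ℤ) • τ) := rfl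

/-- The generators `X₀, …, X₃` in `R(T)`. -/
def genX (i : Fin 4) : TorusRing ω := (coordX ω i).1

/-- The elements `Z₀, …, Z₃` in `R(T)`. -/
def genZ (i : Fin 4) : TorusRing ω := (elemZ ω i).1

theorem signHom_genX (σ : ℤ × ℤ) (i : Fin 4) :
    signHom ω σ (genX ω i) = signChar σ (evenClass i) • genX ω i := by
  refine TorusRing.ext fun l k => ?_
  rw [coeff_signHom, TorusRing.coeff_smul, genX, coeff_coordX]
  split_ifs with h
  · obtain ⟨-, ⟨y, hy⟩, ⟨z, hz⟩⟩ := h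
    have : k = evenClass i + (2 : ℤ) • (y, z) := Prod.ext
      (show k.1 = (evenClass i).1 + 2 * y by linarith)
      (show k.2 = (evenClass i).2 + 2 * z by linarith)
    rw [this, signChar_add, signChar_two_smul, mul_one]
  · rw [mul_zero, mul_zero]

/-- The lifts on which `Z_r` is supported are divisible by two. Invariance under shifts, below,
holds since in degree four a shift is by `4τ`. -/
theorem signHom_genZ (σ : ℤ × ℤ) (i : Fin 4) : signHom ω σ (genZ ω i) = genZ ω i := by
  refine TorusRing.ext fun l k => ?_
  rw [coeff_signHom, genZ, coeff_elemZ]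
  split_ifs with h
  · obtain ⟨-, ⟨y, hy⟩, ⟨z, hz⟩⟩ := h
    rw [Prod.smul_fst] at hy
    rw [Prod.smul_snd] at hz
    rw [nsmul_eq_mul, Nat.cast_ofNat] at hy hz
    have : k = (2 : ℤ) • (evenClass i + (2 : ℤ) • (y, z)) := Prod.ext
      (show k.1 = 2 * ((evenClass i).1 + 2 * y) by linarith)
      (show k.2 = 2 * ((evenClass i).2 + 2 * z) by linarith)
    rw [this, signChar_two_smul, mul_one]
  · rw [mul_zero]

theorem shiftHom_genX (i j : Fin 4) :
    shiftHom ω (evenClass j) (genX ω i) = genX ω (i ^^^ j) := by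
  refine TorusRing.ext fun l k => ?_
  rw [coeff_shiftHom, genX, genX, coeff_coordX, coeff_coordX]
  refine if_congr (and_congr_right fun hl => ?_) rfl rfl
  subst hl
  obtain ⟨a, b⟩ := k
  fin_cases i <;> fin_cases j <;>
  · simp [evenClass]
    try omega

theorem shiftHom_genZ (τ : ℤ × ℤ) (i : Fin 4) : shiftHom ω τ (genZ ω i) = genZ ω i := by
  refine TorusRing.ext fun l k => ?_
  rw [coeff_shiftHom, genZ, coeff_elemZ, coeff_elemZ]
  refine if_congr (and_congr_right fun hl => ?_) rfl rfl
  subst hl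
  simp only [Prod.fst_add, Prod.snd_add, Prod.smul_fst, Prod.smul_snd, smul_eq_mul]
  omega

/-! ### Polynomials in the generators -/

theorem aeval_mul_of_isHomogeneous {σ A : Type*} [CommRing A] [Algebra ℂ A] {n : ℕ}
    {p : MvPolynomial σ ℂ} (hp : p.IsHomogeneous n) (c : A) (y : σ → A) :
    aeval (fun i => c * y i) p = c ^ n * aeval y p := by
  rw [aeval_def, aeval_def, eval₂_eq, eval₂_eq, Finset.mul_sum]
  refine Finset.sum_congr rfl fun d hd => ?_
  have hd' : ∑ i ∈ d.support, d i = n := by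
    rw [← hp.degree_eq_sum_deg_support hd]
  simp only [mul_pow, Finset.prod_mul_distrib, Finset.prod_pow_eq_pow_sum, hd']
  ring

/-- The values at `x` of the theta functions of order two. -/
def thetaVec (x : ℝ × ℝ) (i : Fin 4) : ℂ := thetaX ω (evenClass i) x

theorem thetaVec_zero (i : Fin 4) : thetaVec ω 0 i = 2 * kummerParam ω i :=
  thetaX_evenClass_zero ω i

theorem aeval_genX (p : MvPolynomial (Fin 4) ℂ) : aeval (genX ω) p = (aeval (coordX ω) p).1 :=
  (comp_aeval_apply (coordX ω) (kummerRing ω).val p).symm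

theorem aeval_genZ (p : MvPolynomial (Fin 4) ℂ) : aeval (genZ ω) p = (aeval (elemZ ω) p).1 :=
  (comp_aeval_apply (elemZ ω) (kummerRing ω).val p).symm

variable {ω} in
theorem evalAt_aeval {n d : ℕ} {p : MvPolynomial (Fin 4) ℂ} (hp : p.IsHomogeneous n)
    {y : Fin 4 → kummerRing ω} {t : Fin 4 → ℂ} {x : ℝ × ℝ}
    (h : ∀ i, evalAlg ω x (y i) = t i • (PowerSeries.X : PowerSeries ℂ) ^ d) (l : ℕ) :
    (aeval y p).1.evalAt l x = if l = d * n then eval t p else 0 := by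
  have h' : ∀ i, evalAlg ω x (y i) =
      (PowerSeries.X : PowerSeries ℂ) ^ d * algebraMap ℂ (PowerSeries ℂ) (t i) := fun i => by
    rw [h, Algebra.smul_def, mul_comm]
  rw [← coeff_evalAlg, comp_aeval_apply]
  simp only [h']
  rw [aeval_mul_of_isHomogeneous hp, ← pow_mul,
    show aeval (fun i => algebraMap ℂ (PowerSeries ℂ) (t i)) p = _ from
      aeval_algebraMap_apply (PowerSeries ℂ) t p, mul_comm, ← Algebra.smul_def, map_smul, PowerSeries.coeff_X_pow, smul_eq_mul, mul_ite, mul_one, mul_zero]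
  rfl

theorem evalAt_aeval_genX {n : ℕ} {p : MvPolynomial (Fin 4) ℂ} (hp : p.IsHomogeneous n)
    (l : ℕ) (x : ℝ × ℝ) :
    (aeval (genX ω) p).evalAt l x = if l = n then eval (thetaVec ω x) p else 0 := by
  rw [aeval_genX, evalAt_aeval hp (fun i => evalAlg_coordX ω i x), one_mul]
  rfl

theorem aeval_genX_eq_zero_iff {n : ℕ} {p : MvPolynomial (Fin 4) ℂ} (hp : p.IsHomogeneous n) :
    aeval (genX ω) p = 0 ↔ ∀ x, eval (thetaVec ω x) p = 0 := by
  refine ⟨fun h x => ?_, fun h => TorusRing.ext_evalAt fun l x => ?_⟩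
  · have := evalAt_aeval_genX ω hp n x
    rw [h, if_pos rfl, ← TorusRing.coeff_evalSeries, map_zero, map_zero] at this
    exact this.symm
  · rw [evalAt_aeval_genX ω hp, h, ite_self, ← TorusRing.coeff_evalSeries, map_zero, map_zero]

/-- The `Z_r` are the `X_r` evaluated at `2x`, and doubling is surjective on `ℝ²`. -/
theorem aeval_genZ_eq_zero_iff {n : ℕ} {p : MvPolynomial (Fin 4) ℂ} (hp : p.IsHomogeneous n) :
    aeval (genZ ω) p = 0 ↔ aeval (genX ω) p = 0 := by
  have e : ∀ l x, (aeval (genZ ω) p).evalAt l x =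
      if l = 4 * n then eval (thetaVec ω ((2 : ℝ) • x)) p else 0 := fun l x => by
    rw [aeval_genZ, evalAt_aeval hp (fun i => evalAlg_elemZ ω i x)]
    rfl
  rw [aeval_genX_eq_zero_iff ω hp]
  refine ⟨fun h x => ?_, fun h => TorusRing.ext_evalAt fun l x => ?_⟩
  · have := e (4 * n) ((1 / 2 : ℝ) • x)
    rw [h, if_pos rfl, ← TorusRing.coeff_evalSeries, map_zero, map_zero, smul_smul] at this
    norm_num at this
    exact this.symm
  · rw [e, h, ite_self, ← TorusRing.coeff_evalSeries, map_zero, map_zero]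

/-! ### Joint eigenspaces of the Heisenberg group -/

/-- The Weil pairing on `(ℤ/2)²` as a sign. -/
def classSign (i j : Fin 4) : ℤ :=
  (-1) ^ ((evenClass i).1 * (evenClass j).1 + (evenClass i).2 * (evenClass j).2).natAbs

theorem signChar_evenClass (i j : Fin 4) : signChar (evenClass i) (evenClass j) = classSign i j := by
  fin_cases i <;> fin_cases j <;> norm_num [signChar, evenClass, classSign]

theorem classSign_xor (i j k : Fin 4) : classSign i (j ^^^ k) = classSign i j * classSign i k := by
  revert i j k; decide

theorem classSign_zero_right (i : Fin 4) : classSign i 0 = 1 := by revert i; decide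

theorem classSign_zero_left (i : Fin 4) : classSign 0 i = 1 := by revert i; decide

/-- The joint eigenspace of the Heisenberg group with character `(κ, σ)`. -/
def heisSpace (κ σ : Fin 4) : Submodule ℂ (TorusRing ω) where
  carrier := {y | ∀ τ, signHom ω (evenClass τ) y = (classSign τ σ : ℂ) • y ∧
    shiftHom ω (evenClass τ) y = (classSign κ τ : ℂ) • y}
  add_mem' hy hz τ := by
    rw [map_add, map_add, (hy τ).1, (hy τ).2, (hz τ).1, (hz τ).2, smul_add, smul_add]
    exact ⟨rfl, rfl⟩
  zero_mem' τ := by rw [map_zero, map_zero, smul_zero, smul_zero]; exact ⟨rfl, rfl⟩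
  smul_mem' c y hy τ := by
    rw [map_smul, map_smul, (hy τ).1, (hy τ).2, smul_comm c, smul_comm c]
    exact ⟨rfl, rfl⟩

/-- The four generating operators are combined with weights `1, 2, 4, 8` into one operator whose
eigenvalues on the sixteen spaces are distinct. -/
theorem iSupIndep_heisSpace : iSupIndep fun p : Fin 4 × Fin 4 => heisSpace ω p.1 p.2 := by
  let T : Module.End ℂ (TorusRing ω) := (signHom ω (evenClass 1)).toLinearMap +
    (2 : ℂ) • (signHom ω (evenClass 2)).toLinearMap +
    (4 : ℂ) • (shiftHom ω (evenClass 1)).toLinearMap +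
    (8 : ℂ) • (shiftHom ω (evenClass 2)).toLinearMap
  let μ : Fin 4 × Fin 4 → ℤ := fun p => classSign 1 p.2 + 2 * classSign 2 p.2 +
    4 * classSign p.1 1 + 8 * classSign p.1 2
  have hμ : Function.Injective fun p => (μ p : ℂ) := Int.cast_injective.comp (by decide)
  refine (T.eigenspaces_iSupIndep.comp hμ).mono fun p y hy => ?_
  rw [Function.comp_apply, Module.End.mem_eigenspace_iff]
  simp only [T, LinearMap.add_apply, LinearMap.smul_apply, AlgHom.toLinearMap_apply, (hy _).1,
    (hy _).2, smul_smul, ← add_smul, μ]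
  push_cast
  rfl

/-- The quadrics `∑ (-1)^{κ·a} X_a X_{a+σ}`. -/
def heisQuadric (κ σ : Fin 4) : MvPolynomial (Fin 4) ℂ :=
  ∑ a, (classSign κ a : ℂ) • (X a * X (a ^^^ σ))

theorem isHomogeneous_heisQuadric (κ σ : Fin 4) : (heisQuadric κ σ).IsHomogeneous 2 :=
  IsHomogeneous.sum _ _ _ fun a _ => (homogeneousSubmodule (Fin 4) ℂ 2).smul_mem _
    ((isHomogeneous_X ℂ a).mul (isHomogeneous_X ℂ (a ^^^ σ)))

theorem aeval_heisQuadric (κ σ : Fin 4) : aeval (genX ω) (heisQuadric κ σ) =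
    ∑ a, (classSign κ a : ℂ) • (genX ω a * genX ω (a ^^^ σ)) := by
  simp [heisQuadric]

theorem heisQuadric_mem (κ σ : Fin 4) : aeval (genX ω) (heisQuadric κ σ) ∈ heisSpace ω κ σ := by
  intro τ
  rw [aeval_heisQuadric, map_sum, map_sum, Finset.smul_sum, Finset.smul_sum]
  constructor
  · refine Finset.sum_congr rfl fun a _ => ?_
    rw [map_smul, map_mul, signHom_genX, signHom_genX, signChar_evenClass, signChar_evenClass,
      classSign_xor, smul_mul_smul_comm, smul_smul, smul_smul]
    congr 1
    have : classSign τ a * classSign τ a = 1 := by revert τ a; decide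
    have h : (classSign τ a : ℂ) * classSign τ a = 1 := by exact_mod_cast this
    push_cast
    linear_combination (classSign κ a : ℂ) * classSign τ σ * h
  · have hinv : Function.Involutive fun a : Fin 4 => a ^^^ τ := by
      intro a; revert τ a; decide
    rw [← Equiv.sum_comp hinv.toPerm]
    refine Finset.sum_congr rfl fun a _ => ?_
    rw [map_smul, map_mul, shiftHom_genX, shiftHom_genX, Function.Involutive.coe_toPerm, smul_smul]
    have h1 : a ^^^ τ ^^^ τ = a := hinv a
    have h2 : a ^^^ τ ^^^ σ ^^^ τ = a ^^^ σ := by clear h1 hinv; revert a τ σ; decide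
    rw [h1, h2, classSign_xor]
    push_cast
    ring_nf

/-- At the origin the ten quadrics with `classSign κ σ = 1` take, up to factors four and eight, the
ten values that the parameter conditions require to be nonzero. -/
theorem heisQuadric_ne_zero (H : IsKummerParameter (paramG ω) (paramH ω) (paramJ ω) (paramK ω))
    {κ σ : Fin 4} (hp : classSign κ σ = 1) : aeval (genX ω) (heisQuadric κ σ) ≠ 0 := by
  intro h0
  have h1 := (aeval_genX_eq_zero_iff ω (isHomogeneous_heisQuadric κ σ)).1 h0 0
  have x11 : (1 ^^^ 1 : Fin 4) = 0 := rfl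
  have x12 : (1 ^^^ 2 : Fin 4) = 3 := rfl
  have x13 : (1 ^^^ 3 : Fin 4) = 2 := rfl
  have x21 : (2 ^^^ 1 : Fin 4) = 3 := rfl
  have x22 : (2 ^^^ 2 : Fin 4) = 0 := rfl
  have x23 : (2 ^^^ 3 : Fin 4) = 1 := rfl
  have x31 : (3 ^^^ 1 : Fin 4) = 2 := rfl
  have x32 : (3 ^^^ 2 : Fin 4) = 1 := rfl
  have x33 : (3 ^^^ 3 : Fin 4) = 0 := rfl
  have x0 : ∀ i : Fin 4, i ^^^ 0 = i := by decide
  have x0' : ∀ i : Fin 4, 0 ^^^ i = i := by decide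
  have k0 : kummerParam ω 0 = paramG ω := rfl
  have k1 : kummerParam ω 1 = paramH ω := rfl
  have k2 : kummerParam ω 2 = paramJ ω := rfl
  have k3 : kummerParam ω 3 = paramK ω := rfl
  simp only [heisQuadric, Fin.sum_univ_four] at h1
  obtain ⟨c1, c2, c3, c4, c5, c6, c7, c8, c9, c10⟩ := H
  fin_cases κ <;> fin_cases σ <;> first
  | exact absurd hp (by decide)
  | (simp [x11, x12, x13, x21, x22, x23, x31, x32, x33, x0, x0', k0, k1, k2, k3, classSign,
      evenClass, thetaVec_zero, -mul_eq_zero] at h1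
     first
     | exact c1 (by linear_combination h1 / 8)
     | exact c2 (by linear_combination h1 / 8)
     | exact c3 (by linear_combination h1 / 8)
     | exact c4 (by linear_combination h1 / 8)
     | exact c5 (by linear_combination h1 / 8)
     | exact c6 (by linear_combination h1 / 8)
     | exact c7 (by linear_combination h1 / 4)
     | exact c8 (by linear_combination h1 / 4)
     | exact c9 (by linear_combination h1 / 4)
     | exact c10 (by linear_combination h1 / 4))

end KummerMirror
end

noncomputable section
namespace KummerMirror
open MvPolynomial

/-! ### Growth of the subring generated in degree one -/

variable (ω : SymplecticForm)

instance finite_homogeneousSubmodule (m : ℕ) :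
    Module.Finite ℂ (homogeneousSubmodule (Fin 4) ℂ m) :=
  Module.Finite.iff_fg.2 (homogeneousSubmodule_fg (Fin 4) ℂ m)

/-- The forms of degree `m` in four elements of a commutative algebra. -/
def formsIn {A : Type} [CommRing A] [Algebra ℂ A] (y : Fin 4 → A) (m : ℕ) : Submodule ℂ A :=
  (homogeneousSubmodule (Fin 4) ℂ m).map (aeval y).toLinearMap

instance finite_formsIn {A : Type} [CommRing A] [Algebra ℂ A] (y : Fin 4 → A) (m : ℕ) :
    Module.Finite ℂ (formsIn y m) := Module.Finite.map _ _

/-- The forms of degree `m` that vanish at four elements of a commutative algebra. -/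
def relationsIn {A : Type} [CommRing A] [Algebra ℂ A] (y : Fin 4 → A) (m : ℕ) :
    Submodule ℂ (MvPolynomial (Fin 4) ℂ) :=
  homogeneousSubmodule (Fin 4) ℂ m ⊓ LinearMap.ker (aeval y).toLinearMap

theorem mem_relationsIn {A : Type} [CommRing A] [Algebra ℂ A] {y : Fin 4 → A} {m : ℕ}
    {p : MvPolynomial (Fin 4) ℂ} : p ∈ relationsIn y m ↔ p.IsHomogeneous m ∧ aeval y p = 0 :=
  Iff.rfl

theorem finrank_formsIn_add {A : Type} [CommRing A] [Algebra ℂ A] (y : Fin 4 → A) (m : ℕ) :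
    Module.finrank ℂ (formsIn y m) + Module.finrank ℂ (relationsIn y m) =
      Module.finrank ℂ (homogeneousSubmodule (Fin 4) ℂ m) := by
  have h := ((aeval y).toLinearMap.domRestrict
    (homogeneousSubmodule (Fin 4) ℂ m)).finrank_range_add_finrank_ker
  rw [LinearMap.range_domRestrict] at h
  rw [← h]
  congr 1
  rw [relationsIn, LinearMap.ker_domRestrict, ← Submodule.map_comap_subtype,
    Submodule.finrank_map_subtype_eq]

theorem finrank_formsIn_genZ (m : ℕ) :
    Module.finrank ℂ (formsIn (genZ ω) m) = Module.finrank ℂ (formsIn (genX ω) m) := by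
  have h1 := finrank_formsIn_add (genZ ω) m
  have h2 := finrank_formsIn_add (genX ω) m
  have h3 : relationsIn (genZ ω) m = relationsIn (genX ω) m := by
    ext p
    rw [mem_relationsIn, mem_relationsIn]
    exact and_congr_right fun hp => aeval_genZ_eq_zero_iff ω hp
  rw [h3] at h1
  omega

section

variable {ω} (H : IsKummerParameter (paramG ω) (paramH ω) (paramJ ω) (paramK ω))
include H

/-- With a one-dimensional kernel in `ℂ⁵` the matrix `M` is surjective, so `W = M Z` can be solved
for each `Z_r`. -/
theorem exists_quartic_genZ : ∃ ζ : Fin 4 → MvPolynomial (Fin 4) ℂ,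
    (∀ r, (ζ r).IsHomogeneous 4) ∧ ∀ r, aeval (genX ω) (ζ r) = genZ ω r := by
  set M := matrixM (paramG ω) (paramH ω) (paramJ ω) (paramK ω) with hM
  have hsurj : Function.Surjective M.mulVecLin := by
    rw [← LinearMap.range_eq_top]
    refine Submodule.eq_top_of_finrank_eq ?_
    have h1 := M.mulVecLin.finrank_range_add_finrank_ker
    rw [ker_matrixM H, finrank_span_singleton] at h1
    · simp at h1 ⊢
      omega
    · intro h0
      have := congrFun h0 0
      simp [quarticCoeff] at this
  choose v hv using fun r : Fin 4 => hsurj (Pi.single r 1)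
  refine ⟨fun r => ∑ i, v r i • quarticW X i, fun r => IsHomogeneous.sum _ _ _ fun i _ =>
    (homogeneousSubmodule (Fin 4) ℂ 4).smul_mem _ (isHomogeneous_quarticW i), fun r => ?_⟩
  have e : ∀ i, aeval (genX ω) (quarticW (X : Fin 4 → MvPolynomial (Fin 4) ℂ) i) =
      ∑ s, M s i • genZ ω s := fun i => by
    have h1 : aeval (coordX ω) (quarticW (X : Fin 4 → MvPolynomial (Fin 4) ℂ) i) =
        quarticW (coordX ω) i := by
      fin_cases i <;> simp [quarticW]
    rw [aeval_genX, h1]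
    refine (congrArg (kummerRing ω).val (quarticW_coordX ω i)).trans ?_
    rw [map_sum]
    rfl
  rw [map_sum]
  simp only [map_smul, e, Finset.smul_sum, smul_smul]
  rw [Finset.sum_comm]
  simp only [← Finset.sum_smul]
  have h2 : ∀ s, ∑ i, v r i * M s i = (Pi.single r 1 : Fin 4 → ℂ) s := fun s => by
    rw [← hv r, Matrix.mulVecLin_apply, Matrix.mulVec, dotProduct]
    exact Finset.sum_congr rfl fun i _ => mul_comm _ _
  simp only [h2]
  rw [Finset.sum_eq_single r]
  · simp
  · intro s _ hs
    rw [Pi.single_eq_of_ne hs, zero_smul]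
  · simp

theorem formsIn_genZ_le (m : ℕ) : formsIn (genZ ω) m ≤ formsIn (genX ω) (4 * m) := by
  obtain ⟨ζ, h1, h2⟩ := exists_quartic_genZ H
  rintro _ ⟨p, hp, rfl⟩
  refine ⟨aeval ζ p, IsHomogeneous.aeval (n := 4) (show p.IsHomogeneous m from hp) ζ h1, ?_⟩
  show aeval (genX ω) (aeval ζ p) = aeval (genZ ω) p
  rw [comp_aeval_apply]
  simp only [h2]

end

theorem signHom_of_mem_formsIn_genZ {m : ℕ} {f : TorusRing ω} (hf : f ∈ formsIn (genZ ω) m)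
    (τ : ℤ × ℤ) : signHom ω τ f = f := by
  obtain ⟨p, -, rfl⟩ := hf
  show signHom ω τ (aeval (genZ ω) p) = aeval (genZ ω) p
  rw [comp_aeval_apply]
  simp only [signHom_genZ]

theorem shiftHom_of_mem_formsIn_genZ {m : ℕ} {f : TorusRing ω} (hf : f ∈ formsIn (genZ ω) m)
    (τ : ℤ × ℤ) : shiftHom ω τ f = f := by
  obtain ⟨p, -, rfl⟩ := hf
  show shiftHom ω τ (aeval (genZ ω) p) = aeval (genZ ω) p
  rw [comp_aeval_apply]
  simp only [shiftHom_genZ]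

/-- Eight nonzero quartics with distinct Heisenberg characters. -/
def heisQuartic (q : Fin 2 × Fin 4) : MvPolynomial (Fin 4) ℂ :=
  heisQuadric (q.1.castLE (by norm_num)) 0 * heisQuadric 0 q.2

theorem heisQuartic_mul_mem (q : Fin 2 × Fin 4) {m : ℕ} {f : TorusRing ω}
    (hf : f ∈ formsIn (genZ ω) m) :
    aeval (genX ω) (heisQuartic q) * f ∈ heisSpace ω (q.1.castLE (by norm_num)) q.2 := by
  intro τ
  have h1 := heisQuadric_mem ω (q.1.castLE (by norm_num)) 0 τ
  have h2 := heisQuadric_mem ω 0 q.2 τ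
  rw [classSign_zero_right, Int.cast_one, one_smul] at h1
  rw [classSign_zero_left, Int.cast_one, one_smul] at h2
  rw [heisQuartic, map_mul, map_mul, map_mul, map_mul, map_mul, signHom_of_mem_formsIn_genZ ω hf,
    shiftHom_of_mem_formsIn_genZ ω hf, h1.1, h1.2, h2.1, h2.2]
  constructor
  · rw [mul_smul_comm, smul_mul_assoc]
  · rw [smul_mul_assoc, smul_mul_assoc]

/-- The products `b q * A` are copies of `A`, the ring being a domain, and lie in independent
subspaces; hence their sum inside `B` is direct. -/
theorem card_mul_finrank_le {R ι : Type} [CommRing R] [IsDomain R] [Algebra ℂ R] [Fintype ι]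
    {V : ι → Submodule ℂ R} (hV : iSupIndep V) {b : ι → R} (hb : ∀ q, b q ≠ 0)
    {A B : Submodule ℂ R} [Module.Finite ℂ A] [Module.Finite ℂ B]
    (h : ∀ q, ∀ f ∈ A, b q * f ∈ V q ∧ b q * f ∈ B) :
    Fintype.card ι * Module.finrank ℂ A ≤ Module.finrank ℂ B := by
  let L : (ι → A) →ₗ[ℂ] R :=
    ∑ q, (LinearMap.mulLeft ℂ (b q)).comp (A.subtype.comp (LinearMap.proj q))
  have hL : ∀ f, L f = ∑ q, b q * (f q : R) := fun f => by
    simp [L, LinearMap.sum_apply]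
  have hinj : Function.Injective L := by
    rw [← LinearMap.ker_eq_bot, LinearMap.ker_eq_bot']
    intro f hf
    rw [hL] at hf
    have := (iSupIndep_iff_finsetSum_eq_zero_imp_eq_zero _).1 hV Finset.univ
      (fun q => b q * (f q : R)) (fun q _ => (h q _ (f q).2).1) hf
    funext q
    exact Subtype.ext ((mul_eq_zero.1 (this q (Finset.mem_univ q))).resolve_left (hb q))
  have hle : LinearMap.range L ≤ B := by
    rintro _ ⟨f, rfl⟩
    rw [hL]
    exact Submodule.sum_mem _ fun q _ => (h q _ (f q).2).2
  have h1 := LinearMap.finrank_range_of_inj hinj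
  have h2 := Submodule.finrank_mono hle
  rw [h1, Module.finrank_pi_fintype, Finset.sum_const] at h2
  exact h2

theorem heisQuartic_ne_zero
    (H : IsKummerParameter (paramG ω) (paramH ω) (paramJ ω) (paramK ω)) (q : Fin 2 × Fin 4) :
    aeval (genX ω) (heisQuartic q) ≠ 0 := by
  have h1 := heisQuadric_ne_zero ω H (classSign_zero_right (q.1.castLE (by norm_num)))
  have h2 := heisQuadric_ne_zero ω H (classSign_zero_left q.2)
  intro h
  rw [heisQuartic, map_mul] at h
  rcases mul_eq_zero.1 h with h | h
  · exact h1 h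
  · exact h2 h

/-- Forms of degree `m` in the `Z_r` are invariant, have the same dimension as those in the `X_i`,
and have degree `4m` in the `X_i`. Multiplication by the eight quartics separates them by character
and adds four to the degree. -/
theorem eight_mul_finrank_le (H : IsKummerParameter (paramG ω) (paramH ω) (paramJ ω) (paramK ω))
    (m : ℕ) : 8 * Module.finrank ℂ (formsIn (genX ω) m) ≤
      Module.finrank ℂ (formsIn (genX ω) (4 * m + 4)) := by
  rw [← finrank_formsIn_genZ]
  have hind : iSupIndep fun q : Fin 2 × Fin 4 => heisSpace ω (q.1.castLE (by norm_num)) q.2 :=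
    (iSupIndep_heisSpace ω).comp (f := fun q : Fin 2 × Fin 4 => (q.1.castLE (by norm_num), q.2))
      (by decide)
  refine card_mul_finrank_le hind (b := fun q => aeval (genX ω) (heisQuartic q)) (fun q => ?_)
    fun q f hf => ⟨heisQuartic_mul_mem ω q hf, ?_⟩
  · exact heisQuartic_ne_zero ω H q
  · obtain ⟨p, hp, hpf⟩ := formsIn_genZ_le H m hf
    refine ⟨heisQuartic q * p, ?_, ?_⟩
    · have := ((isHomogeneous_heisQuadric (q.1.castLE (by norm_num)) 0).mul
        (isHomogeneous_heisQuadric 0 q.2)).mul (show p.IsHomogeneous (4 * m) from hp)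
      rw [add_comm (4 * m)]
      exact this
    · rw [← hpf]
      exact map_mul (aeval (genX ω)) _ _

end KummerMirror
end

noncomputable section
namespace KummerMirror
open MvPolynomial

/-! ### Dimensions of spaces of forms -/

theorem finrank_homogeneousSubmodule (m : ℕ) :
    Module.finrank ℂ (homogeneousSubmodule (Fin 4) ℂ m) = (m + 3).choose 3 := by
  rw [homogeneousSubmodule_eq_finsupp_supported]
  have e : {d : Fin 4 →₀ ℕ | d.degree = m} =
      ((Finset.univ : Finset (Fin 4)).finsuppAntidiag m : Set (Fin 4 →₀ ℕ)) := by
    ext d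
    simp [Finset.mem_finsuppAntidiag, Finsupp.degree_eq_sum]
  rw [e, (AddMonoidAlgebra.supportedEquivFinsupp _).finrank_eq, Module.finrank_finsupp_self]
  simp only [Finset.coe_sort_coe, Fintype.card_coe]
  rw [Finset.card_finsuppAntidiag_nat_eq_choose, Finset.card_univ, Fintype.card_fin,
    show 4 + m - 1 = m + 3 by omega]
  exact Nat.choose_symm_add

theorem six_mul_finrank_homogeneousSubmodule (m : ℕ) :
    6 * (Module.finrank ℂ (homogeneousSubmodule (Fin 4) ℂ m) : ℤ) =
      (m + 1) * (m + 2) * (m + 3) := by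
  have h := Nat.choose_mul_factorial_mul_factorial (show 3 ≤ m + 3 by omega)
  rw [Nat.add_sub_cancel, ← finrank_homogeneousSubmodule, show (m + 3).factorial =
    (m + 3) * ((m + 2) * ((m + 1) * m.factorial)) by simp [Nat.factorial_succ], 
    show (3 : ℕ).factorial = 6 by rfl] at h
  have h2 : (0 : ℤ) < m.factorial := by exact_mod_cast m.factorial_pos
  have h3 := congrArg (fun n : ℕ => (n : ℤ)) h
  push_cast at h3
  refine mul_right_cancel₀ h2.ne' ?_
  linarith

/-- The multiples of `G` by forms of degree `m`. -/
def multiplesOf (G : MvPolynomial (Fin 4) ℂ) (m : ℕ) : Submodule ℂ (MvPolynomial (Fin 4) ℂ) :=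
  (homogeneousSubmodule (Fin 4) ℂ m).map (LinearMap.mulLeft ℂ G)

instance finite_multiplesOf (G : MvPolynomial (Fin 4) ℂ) (m : ℕ) :
    Module.Finite ℂ (multiplesOf G m) := Module.Finite.map _ _

theorem finrank_multiplesOf {G : MvPolynomial (Fin 4) ℂ} (hG : G ≠ 0) (m : ℕ) :
    Module.finrank ℂ (multiplesOf G m) = Module.finrank ℂ (homogeneousSubmodule (Fin 4) ℂ m) :=
  (Submodule.equivMapOfInjective (LinearMap.mulLeft ℂ G) (mul_right_injective₀ hG) _).finrank_eq.symm

theorem isHomogeneous_of_mul {G q : MvPolynomial (Fin 4) ℂ} {a n : ℕ} (hG : G.IsHomogeneous a)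
    (h0 : G ≠ 0) (h : (G * q).IsHomogeneous (a + n)) : q.IsHomogeneous n := by
  have e := DirectSum.coe_decompose_mul_add_of_left_mem (homogeneousSubmodule (Fin 4) ℂ)
    (a := G) (b := q) (j := n) hG
  rw [DirectSum.decompose_of_mem_same _ h] at e
  rw [mul_left_cancel₀ h0 e]
  exact (DirectSum.decompose (homogeneousSubmodule (Fin 4) ℂ) q n).2

/-- A prime that does not divide `H` must divide the cofactor in `H * q = G * p`. -/
theorem multiplesOf_inf_le {G H : MvPolynomial (Fin 4) ℂ} {a b : ℕ} (hG : G.IsHomogeneous a)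
    (hp : Prime G) (hGH : ¬ G ∣ H) (m : ℕ) :
    multiplesOf G (m + b) ⊓ multiplesOf H (m + a) ≤ multiplesOf (G * H) m := by
  rintro _ ⟨⟨p, hp1, rfl⟩, ⟨q, hq, hpq⟩⟩
  have hpq' : H * q = G * p := hpq
  obtain ⟨r, rfl⟩ := (hp.dvd_or_dvd (Dvd.intro p hpq'.symm : G ∣ H * q)).resolve_left hGH
  have hr : r.IsHomogeneous m := isHomogeneous_of_mul hG hp.ne_zero
    (by rw [add_comm]; exact hq)
  exact ⟨r, hr, by
    show G * H * r = G * p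
    rw [← hpq']; ring⟩

/-- Bézout in terms of dimensions: inclusion and exclusion for the multiples of `G` and `H` in
degree `n = m + a + b` leave at most `ab(n + 2) - ab(a + b)/2`, which is linear in `n`. -/
theorem finrank_le_of_multiplesOf_le {G H : MvPolynomial (Fin 4) ℂ} {a b m : ℕ}
    (hG : G.IsHomogeneous a) (hp : Prime G) (hGH : ¬ G ∣ H)
    {V : Submodule ℂ (MvPolynomial (Fin 4) ℂ)} [Module.Finite ℂ V]
    (h1 : multiplesOf G (m + b) ≤ V) (h2 : multiplesOf H (m + a) ≤ V) :
    Module.finrank ℂ (homogeneousSubmodule (Fin 4) ℂ (m + a + b)) ≤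
      Module.finrank ℂ V + a * b * (m + a + b + 2) := by
  have hH0 : H ≠ 0 := fun h => hGH (h ▸ dvd_zero G)
  have e1 := Submodule.finrank_sup_add_finrank_inf_eq (multiplesOf G (m + b)) (multiplesOf H (m + a))
  have e2 := Submodule.finrank_mono (multiplesOf_inf_le (b := b) hG hp hGH m)
  have e3 := Submodule.finrank_mono (sup_le h1 h2)
  rw [finrank_multiplesOf hp.ne_zero, finrank_multiplesOf hH0] at e1
  rw [finrank_multiplesOf (mul_ne_zero hp.ne_zero hH0)] at e2
  have d0 := six_mul_finrank_homogeneousSubmodule m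
  have d1 := six_mul_finrank_homogeneousSubmodule (m + b)
  have d2 := six_mul_finrank_homogeneousSubmodule (m + a)
  have d3 := six_mul_finrank_homogeneousSubmodule (m + a + b)
  zify at e1 e2 e3 ⊢
  push_cast at d1 d2 d3
  have hpos : (0 : ℤ) ≤ a * b * (a + b) := by positivity
  nlinarith

/-- Iterating `m ↦ 4m + 4` from zero multiplies `3m + 4` by four and `d` by at least eight, so `d`
grows at least like the power `3/2` of `m` along this sequence. -/
theorem exists_growth_gt {d : ℕ → ℕ} (h0 : 0 < d 0) (h : ∀ m, 8 * d m ≤ d (4 * m + 4)) (c N : ℕ) :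
    ∃ m, N ≤ m ∧ c * (m + 2) < d m := by
  have key : ∀ n, ∃ m, 3 * m + 4 = 4 ^ (n + 1) ∧ 8 ^ n ≤ d m := by
    intro n
    induction n with
    | zero => exact ⟨0, by norm_num, by rw [pow_zero]; exact h0⟩
    | succ n ih =>
      obtain ⟨m, hm, hd⟩ := ih
      exact ⟨4 * m + 4, by rw [pow_succ]; omega, by
        rw [pow_succ]; exact le_trans (by omega) (h m)⟩
  obtain ⟨m, hm, hd⟩ := key (4 * c + N + 1)
  have e1 : 4 * c + N + 1 < 2 ^ (4 * c + N + 1) := Nat.lt_two_pow_self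
  have e2 : 4 * c + N + 1 < 4 ^ (4 * c + N + 1) := Nat.lt_pow_self (by norm_num)
  have e3 : (8 : ℕ) ^ (4 * c + N + 1) = 2 ^ (4 * c + N + 1) * 4 ^ (4 * c + N + 1) := by
    rw [← mul_pow]; norm_num
  rw [pow_succ] at hm
  refine ⟨m, by omega, lt_of_lt_of_le ?_ hd⟩
  rw [e3]
  set t := 4 ^ (4 * c + N + 1)
  set s := 2 ^ (4 * c + N + 1)
  have h1 : m + 2 ≤ 2 * t := by omega
  calc c * (m + 2) ≤ c * (2 * t) := Nat.mul_le_mul_left _ h1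
    _ = (2 * c) * t := by ring
    _ < s * t := Nat.mul_lt_mul_of_pos_right (by omega) (by omega)

end KummerMirror
end

noncomputable section
namespace KummerMirror
open MvPolynomial

/-! ### The ideal of relations -/

variable (ω : SymplecticForm)

theorem kummerQuartic_ne_zero (g h j k : ℂ) : kummerQuartic g h j k ≠ 0 := by
  intro h0
  have := eval_kummerQuartic g h j k ![1, 0, 0, 0]
  rw [h0, map_zero] at this
  simp at this

theorem aeval_coordX_eq_zero_iff (p : MvPolynomial (Fin 4) ℂ) :
    aeval (coordX ω) p = 0 ↔ aeval (genX ω) p = 0 := by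
  rw [aeval_genX]
  exact (ZeroMemClass.coe_eq_zero).symm

/-- `coordHom` is graded, so its kernel is a homogeneous ideal. -/
theorem homogeneousComponent_mem_ker {p : MvPolynomial (Fin 4) ℂ} (hp : aeval (genX ω) p = 0)
    (n : ℕ) : aeval (genX ω) (homogeneousComponent n p) = 0 := by
  have h := (HomogeneousIdeal.comap (coordHom ω) ⊥).isHomogeneous
  rw [← aeval_coordX_eq_zero_iff] at hp ⊢
  exact homogeneousComponent_mem_of_mem h (p := p) hp n

theorem exists_homogeneousComponent_ne_zero {p : MvPolynomial (Fin 4) ℂ} (hp : p ≠ 0) :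
    ∃ n ≤ p.totalDegree, homogeneousComponent n p ≠ 0 := by
  by_contra! h
  refine hp ?_
  rw [← sum_homogeneousComponent p]
  exact Finset.sum_eq_zero fun n hn => h n (Nat.lt_succ_iff.1 (Finset.mem_range.1 hn))

instance finite_relationsIn (m : ℕ) : Module.Finite ℂ (relationsIn (genX ω) m) :=
  Submodule.finiteDimensional_of_le (inf_le_left (b := LinearMap.ker _))

theorem finrank_formsIn_zero_pos : 0 < Module.finrank ℂ (formsIn (genX ω) 0) := by
  have : (1 : TorusRing ω) ∈ formsIn (genX ω) 0 := 
    ⟨1, isHomogeneous_one _ _, map_one (aeval (genX ω))⟩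
  have : Nontrivial (formsIn (genX ω) 0) :=
    ⟨⟨⟨1, this⟩, 0, fun h => one_ne_zero (congrArg Subtype.val h)⟩⟩
  exact Module.finrank_pos

section

variable {ω} (H : IsKummerParameter (paramG ω) (paramH ω) (paramJ ω) (paramK ω))
include H

theorem aeval_kummerQuartic :
    aeval (coordX ω) (kummerQuartic (paramG ω) (paramH ω) (paramJ ω) (paramK ω)) = 0 := by
  have h1 : ∀ i, aeval (coordX ω) (quarticW (X : Fin 4 → MvPolynomial (Fin 4) ℂ) i) =
      quarticW (coordX ω) i := fun i => by
    fin_cases i <;> simp [quarticW]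
  rw [kummerQuartic, map_sum]
  simp only [map_smul, h1, quarticW_coordX, Finset.smul_sum, smul_smul]
  rw [Finset.sum_comm]
  simp only [← Finset.sum_smul]
  refine Finset.sum_eq_zero fun s _ => ?_
  have := congrFun (matrixM_mulVec_quarticCoeff H) s
  rw [Matrix.mulVec, dotProduct] at this
  rw [Finset.sum_congr rfl fun i _ => mul_comm _ _, this]
  exact zero_smul _ _

/-- If `G` did not divide `p`, the multiples of both would leave at most `ab(n + 2)` dimensions in
degree `n` for the forms in the `X_i`, against their superlinear growth. -/
theorem dvd_of_relation {G p : MvPolynomial (Fin 4) ℂ} {a b : ℕ} (hG : G.IsHomogeneous a)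
    (hGp : Prime G) (hG0 : aeval (genX ω) G = 0) (hp : p.IsHomogeneous b)
    (hp0 : aeval (genX ω) p = 0) : G ∣ p := by
  by_contra hd
  obtain ⟨n, hn, hlt⟩ := exists_growth_gt (d := fun m => Module.finrank ℂ (formsIn (genX ω) m))
    (finrank_formsIn_zero_pos ω) (eight_mul_finrank_le ω H) (a * b) (a + b)
  obtain ⟨m, rfl⟩ := Nat.exists_eq_add_of_le' hn
  rw [← add_assoc] at hlt
  have h1 : multiplesOf G (m + b) ≤ relationsIn (genX ω) (m + a + b) := by
    rintro _ ⟨q, hq, rfl⟩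
    refine mem_relationsIn.2 ⟨?_, ?_⟩
    · have := hG.mul (show q.IsHomogeneous (m + b) from hq)
      rwa [show a + (m + b) = m + a + b by ring] at this
    · show aeval (genX ω) (G * q) = 0
      rw [map_mul, hG0, zero_mul]
  have h2 : multiplesOf p (m + a) ≤ relationsIn (genX ω) (m + a + b) := by
    rintro _ ⟨q, hq, rfl⟩
    refine mem_relationsIn.2 ⟨?_, ?_⟩
    · have := hp.mul (show q.IsHomogeneous (m + a) from hq)
      rwa [show b + (m + a) = m + a + b by ring] at this
    · show aeval (genX ω) (p * q) = 0
      rw [map_mul, hp0, zero_mul]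
  have h3 := finrank_le_of_multiplesOf_le hG hGp hd h1 h2
  have h4 := finrank_formsIn_add (genX ω) (m + a + b)
  omega

/-- `G` is a nonzero homogeneous relation of least degree. As the torus ring is a domain, a factor
of `G` is again a relation, which by minimality leaves only a constant for the other factor;
irreducible elements are prime by unique factorization. -/
theorem exists_prime_relation : ∃ (a : ℕ) (G : MvPolynomial (Fin 4) ℂ), G.IsHomogeneous a ∧
    Prime G ∧ aeval (genX ω) G = 0 ∧ ∀ p, aeval (genX ω) p = 0 → G ∣ p := by
  classical
  have hex : ∃ a, ∃ G : MvPolynomial (Fin 4) ℂ, G ≠ 0 ∧ G.IsHomogeneous a ∧ aeval (genX ω) G = 0 :=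
    ⟨4, _, kummerQuartic_ne_zero _ _ _ _, isHomogeneous_kummerQuartic _ _ _ _,
      (aeval_coordX_eq_zero_iff ω _).1 (aeval_kummerQuartic H)⟩
  obtain ⟨G, hG0, hG, hGr⟩ := Nat.find_spec hex
  set a := Nat.find hex
  -- Factors of `G` are not known to be homogeneous, so minimality is extended to all relations
  -- through their homogeneous components.
  have hmin : ∀ p : MvPolynomial (Fin 4) ℂ, p ≠ 0 → aeval (genX ω) p = 0 → a ≤ p.totalDegree := by
    intro p hp hpr
    obtain ⟨n, hn, hnp⟩ := exists_homogeneousComponent_ne_zero hp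
    exact (Nat.find_min' hex ⟨_, hnp, homogeneousComponent_isHomogeneous n p,
      homogeneousComponent_mem_ker ω hpr n⟩).trans hn
  have hunit : ∀ p q : MvPolynomial (Fin 4) ℂ, G = p * q → aeval (genX ω) p = 0 → IsUnit q := by
    intro p q h hp
    have hp0 : p ≠ 0 := by rintro rfl; exact hG0 (by rw [h, zero_mul])
    have hq0 : q ≠ 0 := by rintro rfl; exact hG0 (by rw [h, mul_zero])
    have h1 := hmin p hp0 hp
    have h2 := hG.totalDegree hG0
    rw [h, totalDegree_mul_of_isDomain hp0 hq0] at h2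
    have h3 := totalDegree_eq_zero_iff_eq_C.1 (show q.totalDegree = 0 by omega)
    rw [h3]
    refine (isUnit_iff_ne_zero.2 fun h4 => hq0 ?_).map C
    rw [h3, h4, map_zero]
  have hirr : Irreducible G := by
    refine ⟨fun hu => ?_, fun p q h => ?_⟩
    · have := hu.map (aeval (genX ω))
      rw [hGr] at this
      exact not_isUnit_zero this
    · have h1 : aeval (genX ω) p * aeval (genX ω) q = 0 := by rw [← map_mul, ← h, hGr]
      rcases mul_eq_zero.1 h1 with h2 | h2
      · exact Or.inr (hunit p q h h2)
      · exact Or.inl (hunit q p (by rw [h, mul_comm]) h2)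
  refine ⟨a, G, hG, hirr.prime, hGr, fun p hp => ?_⟩
  rw [← sum_homogeneousComponent p]
  exact Finset.dvd_sum fun n _ => dvd_of_relation H hG hirr.prime hGr
    (homogeneousComponent_isHomogeneous n p) (homogeneousComponent_mem_ker ω hp n)

end

/-! ### The degree of the prime relation is even -/

/-- The action of the sign changes on polynomials. -/
def polySign (σ : Fin 4) : MvPolynomial (Fin 4) ℂ →ₐ[ℂ] MvPolynomial (Fin 4) ℂ :=
  aeval fun i => (classSign σ i : ℂ) • X i

/-- The action of the translations of `(ℤ/2)²` on polynomials. -/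
def polyShift (τ : Fin 4) : MvPolynomial (Fin 4) ℂ →ₐ[ℂ] MvPolynomial (Fin 4) ℂ :=
  aeval fun i => X (i ^^^ τ)

theorem aeval_polySign (σ : Fin 4) (p : MvPolynomial (Fin 4) ℂ) :
    aeval (genX ω) (polySign σ p) = signHom ω (evenClass σ) (aeval (genX ω) p) := by
  rw [polySign, comp_aeval_apply, comp_aeval_apply]
  simp only [map_smul, aeval_X, signHom_genX, signChar_evenClass]

theorem aeval_polyShift (τ : Fin 4) (p : MvPolynomial (Fin 4) ℂ) :
    aeval (genX ω) (polyShift τ p) = shiftHom ω (evenClass τ) (aeval (genX ω) p) := by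
  rw [polyShift, comp_aeval_apply, comp_aeval_apply]
  simp only [aeval_X, shiftHom_genX]

theorem polySign_polySign (σ : Fin 4) (p : MvPolynomial (Fin 4) ℂ) :
    polySign σ (polySign σ p) = p := by
  conv_rhs => rw [← aeval_X_left_apply p]
  rw [polySign, comp_aeval_apply]
  congr 2
  funext i
  have : classSign σ i * classSign σ i = 1 := by revert σ i; decide
  rw [map_smul, aeval_X, smul_smul, ← Int.cast_mul, this, Int.cast_one, one_smul]

theorem polyShift_polyShift (τ : Fin 4) (p : MvPolynomial (Fin 4) ℂ) :
    polyShift τ (polyShift τ p) = p := by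
  conv_rhs => rw [← aeval_X_left_apply p]
  rw [polyShift, comp_aeval_apply]
  congr 2
  funext i
  have : i ^^^ τ ^^^ τ = i := by revert τ i; decide
  rw [aeval_X, this]

theorem isHomogeneous_polySign (σ : Fin 4) {p : MvPolynomial (Fin 4) ℂ} {n : ℕ}
    (hp : p.IsHomogeneous n) : (polySign σ p).IsHomogeneous n := by
  have := hp.aeval (n := 1) (fun i => (classSign σ i : ℂ) • (X i : MvPolynomial (Fin 4) ℂ))
    fun i => (homogeneousSubmodule (Fin 4) ℂ 1).smul_mem _ (isHomogeneous_X ℂ i)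
  rwa [one_mul] at this

theorem isHomogeneous_polyShift (τ : Fin 4) {p : MvPolynomial (Fin 4) ℂ} {n : ℕ}
    (hp : p.IsHomogeneous n) : (polyShift τ p).IsHomogeneous n := by
  have := hp.aeval (n := 1) (fun i => (X (i ^^^ τ) : MvPolynomial (Fin 4) ℂ))
    fun i => isHomogeneous_X ℂ _
  rwa [one_mul] at this

/-- On linear forms this sign change and this translation anticommute. -/
theorem polySign_polyShift {p : MvPolynomial (Fin 4) ℂ} {n : ℕ} (hp : p.IsHomogeneous n) :
    polySign 1 (polyShift 1 p) = (-1) ^ n * polyShift 1 (polySign 1 p) := by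
  rw [polySign, polyShift, comp_aeval_apply, comp_aeval_apply, ← aeval_mul_of_isHomogeneous hp]
  congr 2
  funext i
  have : classSign 1 (i ^^^ 1) = -classSign 1 i := by revert i; decide
  rw [map_smul, aeval_X, aeval_X, this, Int.cast_neg, neg_smul, neg_one_mul]

theorem exists_eq_C_mul_of_dvd {G p : MvPolynomial (Fin 4) ℂ} {a : ℕ} (hG : G.IsHomogeneous a)
    (h0 : G ≠ 0) (hp : p.IsHomogeneous a) (h : G ∣ p) : ∃ c, p = C c * G := by
  obtain ⟨q, rfl⟩ := h
  have hq : q.IsHomogeneous 0 := isHomogeneous_of_mul hG h0 hp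
  have := totalDegree_eq_zero_iff_eq_C.1 (Nat.le_zero.1 hq.totalDegree_le)
  exact ⟨coeff 0 q, by rw [← this, mul_comm]⟩

/-- Both operators preserve relations and degree, so they multiply `G` by scalars, which are nonzero
because the operators are involutions. Scalars commute, so the sign `(-1) ^ a` must be one. -/
theorem even_degree_of_prime_relation {G : MvPolynomial (Fin 4) ℂ} {a : ℕ} (hG : G.IsHomogeneous a)
    (h0 : G ≠ 0) (hr : aeval (genX ω) G = 0) (hd : ∀ p, aeval (genX ω) p = 0 → G ∣ p) :
    Even a := by
  obtain ⟨c, hc⟩ := exists_eq_C_mul_of_dvd hG h0 (isHomogeneous_polySign 1 hG)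
    (hd _ (by rw [aeval_polySign, hr, map_zero]))
  obtain ⟨c', hc'⟩ := exists_eq_C_mul_of_dvd hG h0 (isHomogeneous_polyShift 1 hG)
    (hd _ (by rw [aeval_polyShift, hr, map_zero]))
  have h1 := polySign_polyShift hG
  have hC : ∀ (f : MvPolynomial (Fin 4) ℂ →ₐ[ℂ] MvPolynomial (Fin 4) ℂ) (x : ℂ), f (C x) = C x :=
    fun f x => f.commutes x
  rw [hc', hc, map_mul, map_mul, hC, hC, hc, hc'] at h1
  by_contra hodd
  rw [(Nat.not_even_iff_odd.1 hodd).neg_one_pow] at h1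
  have h2 : C (2 * c * c') * G = 0 := by
    rw [map_mul, map_mul, map_ofNat]
    linear_combination h1
  have h3 := (mul_eq_zero.1 h2).resolve_right h0
  rw [← map_zero (C : ℂ →+* MvPolynomial (Fin 4) ℂ), (C_injective _ _).eq_iff] at h3
  rcases mul_eq_zero.1 h3 with h4 | h4
  · rw [(mul_eq_zero.1 h4).resolve_left two_ne_zero, map_zero, zero_mul] at hc
    rw [← polySign_polySign 1 G, hc, map_zero] at h0
    exact h0 rfl
  · rw [h4, map_zero, zero_mul] at hc'
    rw [← polyShift_polyShift 1 G, hc', map_zero] at h0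
    exact h0 rfl

/-! ### Identification of the ideal of relations -/

section

variable {ω} (H : IsKummerParameter (paramG ω) (paramH ω) (paramJ ω) (paramK ω))
include H

/-- The ten even quadrics have nonzero images in distinct eigenspaces. They give ten independent
elements, which is the dimension of all quadratic forms. -/
theorem relationsIn_two : relationsIn (genX ω) 2 = ⊥ := by
  have hind : iSupIndep fun p : {p : Fin 4 × Fin 4 // classSign p.1 p.2 = 1} => heisSpace ω p.1.1 p.1.2 :=
    (iSupIndep_heisSpace ω).comp Subtype.val_injective
  have h := card_mul_finrank_le hind
    (b := fun p : {p : Fin 4 × Fin 4 // classSign p.1 p.2 = 1} => aeval (genX ω) (heisQuadric p.1.1 p.1.2))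
    (fun p => heisQuadric_ne_zero ω H p.2) (A := ℂ ∙ (1 : TorusRing ω)) (B := formsIn (genX ω) 2)
    fun p f hf => by
      obtain ⟨c, rfl⟩ := Submodule.mem_span_singleton.1 hf
      rw [mul_smul_comm, mul_one]
      exact ⟨Submodule.smul_mem _ _ (heisQuadric_mem ω _ _), Submodule.smul_mem _ _
        ⟨_, isHomogeneous_heisQuadric _ _, rfl⟩⟩
  have hcard : Fintype.card {p : Fin 4 × Fin 4 // classSign p.1 p.2 = 1} = 10 := by decide
  rw [hcard, finrank_span_singleton one_ne_zero] at h
  have h1 := finrank_formsIn_add (genX ω) 2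
  rw [finrank_homogeneousSubmodule, show Nat.choose (2 + 3) 3 = 10 from rfl] at h1
  exact Submodule.finrank_eq_zero.1 (by omega)

/-- The prime relation divides `F`, so its degree is at most four; it is even, not zero because a
prime is not a unit, and not two. Hence `F` is a constant multiple of it. -/
theorem ker_aeval_coordX : RingHom.ker (aeval (R := ℂ) (coordX ω)) =
    Ideal.span {kummerQuartic (paramG ω) (paramH ω) (paramJ ω) (paramK ω)} := by
  obtain ⟨a, G, hG, hGp, hGr, hd⟩ := exists_prime_relation H
  set F := kummerQuartic (paramG ω) (paramH ω) (paramJ ω) (paramK ω)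
  have hF : F.IsHomogeneous 4 := isHomogeneous_kummerQuartic _ _ _ _
  have hF0 : F ≠ 0 := kummerQuartic_ne_zero _ _ _ _
  have hFr := (aeval_coordX_eq_zero_iff ω _).1 (aeval_kummerQuartic H)
  have ha : a ≤ 4 := by
    have := totalDegree_le_of_dvd_of_isDomain (hd _ hFr) hF0
    rwa [hG.totalDegree hGp.ne_zero, hF.totalDegree hF0] at this
  have heven := even_degree_of_prime_relation ω hG hGp.ne_zero hGr hd
  have ha0 : a ≠ 0 := by
    rintro rfl
    have h1 := totalDegree_eq_zero_iff_eq_C.1 (Nat.le_zero.1 hG.totalDegree_le)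
    refine hGp.not_isUnit ?_
    rw [h1]
    refine (isUnit_iff_ne_zero.2 fun h4 => hGp.ne_zero ?_).map C
    rw [h1, h4, map_zero]
  have ha2 : a ≠ 2 := by
    rintro rfl
    have : G ∈ relationsIn (genX ω) 2 := ⟨hG, hGr⟩
    rw [relationsIn_two H] at this
    exact hGp.ne_zero this
  have ha4 : a = 4 := by
    obtain ⟨b, hb⟩ := heven
    omega
  subst ha4
  obtain ⟨c, hc⟩ := exists_eq_C_mul_of_dvd hG hGp.ne_zero hF (hd _ hFr)
  have hc0 : c ≠ 0 := by
    rintro rfl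
    exact hF0 (by rw [hc, map_zero, zero_mul])
  ext p
  rw [RingHom.mem_ker, Ideal.mem_span_singleton, aeval_coordX_eq_zero_iff, hc,
    ((isUnit_iff_ne_zero.2 hc0).map C).mul_left_dvd]
  refine ⟨hd p, ?_⟩
  rintro ⟨q, rfl⟩
  rw [map_mul, hGr, zero_mul]

end

end KummerMirror
end

noncomputable section
namespace KummerMirror
open MvPolynomial

/-! ### Generation in degree one -/

variable (ω : SymplecticForm)

/-- Representatives of `(ℤ/2l)²` modulo `± 1`. -/
def halfPeriods (l : ℕ) : Finset (ℤ × ℤ) :=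
  Finset.Ioo (0 : ℤ) l ×ˢ Finset.Ico (0 : ℤ) (2 * l) ∪ {0, (l : ℤ)} ×ˢ Finset.Icc (0 : ℤ) l

/-- The bound comes from `2l(l - 1) + 2(l + 1) = 2l² + 2`. -/
theorem card_halfPeriods_le {l : ℕ} (hl : 0 < l) : (halfPeriods l).card ≤ 2 * l ^ 2 + 2 := by
  refine (Finset.card_union_le _ _).trans ?_
  rw [Finset.card_product, Finset.card_product, Int.card_Ioo, Int.card_Ico, Int.card_Icc,
    Finset.card_pair (by exact_mod_cast hl.ne)]
  obtain ⟨m, rfl⟩ := Nat.exists_eq_add_of_le' hl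
  have e1 : (((m + 1 : ℕ) : ℤ) - 0 - 1).toNat = m := by push_cast; omega
  have e2 : (2 * ((m + 1 : ℕ) : ℤ) - 0).toNat = 2 * (m + 1) := by push_cast; omega
  have e3 : (((m + 1 : ℕ) : ℤ) + 1 - 0).toNat = m + 2 := by push_cast; omega
  rw [e1, e2, e3]
  nlinarith

theorem exists_mem_halfPeriods {l : ℕ} (hl : 0 < l) (k : ℤ × ℤ) :
    ∃ t ∈ halfPeriods l, ∃ n : ℤ × ℤ, k = t + (2 * l : ℤ) • n ∨ -k = t + (2 * l : ℤ) • n := by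
  have h2 : (0 : ℤ) < 2 * l := by omega
  have hmem : ∀ a b : ℤ, (a, b) ∈ halfPeriods l ↔ (0 < a ∧ a < l ∧ 0 ≤ b ∧ b < 2 * l) ∨
      ((a = 0 ∨ a = l) ∧ 0 ≤ b ∧ b ≤ l) := fun a b => by
    simp [halfPeriods, and_assoc]
  have key : ∀ k : ℤ × ℤ, k = (k.1 % (2 * l), k.2 % (2 * l)) +
      (2 * l : ℤ) • (k.1 / (2 * l), k.2 / (2 * l)) := fun k => by
    ext
    · simpa using (Int.emod_add_mul_ediv k.1 (2 * l)).symm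
    · simpa using (Int.emod_add_mul_ediv k.2 (2 * l)).symm
  by_cases h : (k.1 % (2 * l), k.2 % (2 * l)) ∈ halfPeriods l
  · exact ⟨_, h, _, Or.inl (key k)⟩
  -- If the residue of `k` is not among the representatives, that of `-k` is: negation maps a first
  -- residue above `l` below `l`, and on the fixed first residues `0` and `l` it does the same for
  -- the second.
  refine ⟨((-k).1 % (2 * l), (-k).2 % (2 * l)), ?_, _, Or.inr (key (-k))⟩
  rw [hmem] at h ⊢
  have a1 := Int.emod_nonneg k.1 h2.ne'
  have a2 := Int.emod_lt_of_pos k.1 h2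
  have b1 := Int.emod_nonneg k.2 h2.ne'
  have b2 := Int.emod_lt_of_pos k.2 h2
  have hneg : ∀ x : ℤ, (-x) % (2 * l) = if x % (2 * l) = 0 then 0 else 2 * l - x % (2 * l) := by
    intro x
    rw [Int.neg_emod]
    simp only [Int.dvd_iff_emod_eq_zero, Int.natAbs_of_nonneg h2.le]
  rw [Prod.fst_neg, Prod.snd_neg, hneg, hneg]
  split_ifs <;> omega

/-- The coefficients of an element of degree `l` at finitely many points. -/
def coeffMap (l : ℕ) (S : Finset (ℤ × ℤ)) : kummerRing.grading ω l →ₗ[ℂ] S → ℂ where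
  toFun f k := f.1.1.coeff l k
  map_add' _ _ := rfl
  map_smul' _ _ := rfl

theorem coeffMap_injective {l : ℕ} (hl : 0 < l) :
    Function.Injective (coeffMap ω l (halfPeriods l)) := by
  rw [← LinearMap.ker_eq_bot, LinearMap.ker_eq_bot']
  intro f hf
  refine Subtype.ext (kummerRing.ext fun n k => ?_)
  by_cases hn : n = l
  · subst hn
    obtain ⟨t, ht, m, h | h⟩ := exists_mem_halfPeriods hl k
    · rw [h, f.1.1.mem.1]
      exact congrFun hf ⟨t, ht⟩
    · rw [← f.1.2 n k, h, f.1.1.mem.1]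
      exact congrFun hf ⟨t, ht⟩
  · exact f.2 n k hn

theorem coeffMap_injective_zero : Function.Injective (coeffMap ω 0 {0}) := by
  rw [← LinearMap.ker_eq_bot, LinearMap.ker_eq_bot']
  intro f hf
  refine Subtype.ext (kummerRing.ext fun n k => ?_)
  by_cases hn : n = 0
  · subst hn
    by_cases hk : k = 0
    · subst hk
      exact congrFun hf ⟨0, Finset.mem_singleton_self _⟩
    · exact f.1.1.mem.2.1 k hk
  · exact f.2 n k hn

instance finite_grading (l : ℕ) : Module.Finite ℂ (kummerRing.grading ω l) := by
  rcases Nat.eq_zero_or_pos l with rfl | hl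
  · exact Module.Finite.of_injective _ (coeffMap_injective_zero ω)
  · exact Module.Finite.of_injective _ (coeffMap_injective ω hl)

theorem finrank_grading_le {l : ℕ} (hl : 0 < l) :
    Module.finrank ℂ (kummerRing.grading ω l) ≤ 2 * l ^ 2 + 2 := by
  have := LinearMap.finrank_le_finrank_of_injective (coeffMap_injective ω hl)
  rw [Module.finrank_fintype_fun_eq_card, Fintype.card_coe] at this
  exact this.trans (card_halfPeriods_le hl)

theorem finrank_grading_zero_le : Module.finrank ℂ (kummerRing.grading ω 0) ≤ 1 := by
  have := LinearMap.finrank_le_finrank_of_injective (coeffMap_injective_zero ω)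
  rwa [Module.finrank_fintype_fun_eq_card, Fintype.card_coe, Finset.card_singleton] at this

section

variable {ω} (H : IsKummerParameter (paramG ω) (paramH ω) (paramJ ω) (paramK ω))
include H

theorem relationsIn_le_multiplesOf (l : ℕ) : relationsIn (coordX ω) (4 + l) ≤
    multiplesOf (kummerQuartic (paramG ω) (paramH ω) (paramJ ω) (paramK ω)) l := by
  rintro p ⟨hp, hp0⟩
  have hp1 : p ∈ RingHom.ker (aeval (R := ℂ) (coordX ω)) := hp0
  rw [ker_aeval_coordX H, Ideal.mem_span_singleton] at hp1
  obtain ⟨q, rfl⟩ := hp1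
  exact ⟨q, isHomogeneous_of_mul (isHomogeneous_kummerQuartic _ _ _ _)
    (kummerQuartic_ne_zero _ _ _ _) hp, rfl⟩

theorem relationsIn_eq_bot {l : ℕ} (hl : l < 4) : relationsIn (coordX ω) l = ⊥ := by
  rw [eq_bot_iff]
  rintro p ⟨hp, hp0⟩
  have hp1 : p ∈ RingHom.ker (aeval (R := ℂ) (coordX ω)) := hp0
  rw [ker_aeval_coordX H, Ideal.mem_span_singleton] at hp1
  by_contra hne
  have h0 : p ≠ 0 := hne
  have h1 := totalDegree_le_of_dvd_of_isDomain hp1 h0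
  rw [(isHomogeneous_kummerQuartic _ _ _ _).totalDegree (kummerQuartic_ne_zero _ _ _ _),
    (show p.IsHomogeneous l from hp).totalDegree h0] at h1
  omega

/-- For `l ≥ 4` the relations are at most the multiples of `F`, and the binomial coefficients `(l+3
choose 3) - (l-1 choose 3)` differ by exactly `2l² + 2`. For `l < 4` there are no relations. -/
theorem le_finrank_formsIn {l : ℕ} (hl : 0 < l) :
    2 * l ^ 2 + 2 ≤ Module.finrank ℂ (formsIn (coordX ω) l) := by
  have h1 := finrank_formsIn_add (coordX ω) l
  by_cases h4 : l < 4
  · rw [relationsIn_eq_bot H h4, finrank_bot, add_zero, finrank_homogeneousSubmodule] at h1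
    rw [h1]
    interval_cases l <;> decide
  · obtain ⟨m, rfl⟩ := Nat.exists_eq_add_of_le (not_lt.1 h4)
    have h2 := Submodule.finrank_mono (relationsIn_le_multiplesOf H m)
    rw [finrank_multiplesOf (kummerQuartic_ne_zero _ _ _ _)] at h2
    have d0 := six_mul_finrank_homogeneousSubmodule m
    have d1 := six_mul_finrank_homogeneousSubmodule (4 + m)
    zify at h1 h2 ⊢
    push_cast at d1
    nlinarith

/-- The upper bound from the orbits of `±1` meets the lower bound from the ideal of relations;
degree zero, where both bounds are one, is separate. -/
theorem formsIn_coordX (l : ℕ) : formsIn (coordX ω) l = kummerRing.grading ω l := by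
  refine Submodule.eq_of_le_of_finrank_le ?_ ?_
  · rintro _ ⟨p, hp, rfl⟩
    exact (coordHom ω).map_mem hp
  · rcases Nat.eq_zero_or_pos l with rfl | hl
    · refine (finrank_grading_zero_le ω).trans ?_
      have h1 := finrank_formsIn_add (coordX ω) 0
      rw [relationsIn_eq_bot H (by norm_num), finrank_bot, add_zero,
        finrank_homogeneousSubmodule] at h1
      rw [h1]
      decide
    · exact (finrank_grading_le ω hl).trans (le_finrank_formsIn H hl)

theorem aeval_coordX_surjective : Function.Surjective (aeval (R := ℂ) (coordX ω)) := by
  classical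
  intro f
  rw [← AlgHom.mem_range, ← DirectSum.sum_support_decompose (kummerRing.grading ω) f]
  refine Subalgebra.sum_mem _ fun l _ => ?_
  obtain ⟨p, -, hp⟩ := (formsIn_coordX H l).ge (DirectSum.decompose (kummerRing.grading ω) f l).2
  exact ⟨p, hp⟩

theorem adjoin_coordX : Algebra.adjoin ℂ (Set.range (coordX ω)) = ⊤ := by
  rw [Algebra.adjoin_range_eq_range_aeval, AlgHom.range_eq_top]
  exact aeval_coordX_surjective H

end

end KummerMirror
end

noncomputable section
namespace KummerMirror

/-! ### `Proj` of a surjective homomorphism of graded rings -/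

section Proj

open AlgebraicGeometry CategoryTheory HomogeneousLocalization

universe u

variable {A B σ τ : Type u} [CommRing A] [SetLike σ A] [AddSubgroupClass σ A]
  [CommRing B] [SetLike τ B] [AddSubgroupClass τ B] {𝒜 : ℕ → σ} {ℬ : ℕ → τ}
  [GradedRing 𝒜] [GradedRing ℬ] {f : 𝒜 →+*ᵍ ℬ}

theorem irrelevant_le_map_of_surjective (hsurj : ∀ n, ∀ b ∈ ℬ n, ∃ a ∈ 𝒜 n, f a = b) :
    HomogeneousIdeal.irrelevant ℬ ≤ (HomogeneousIdeal.irrelevant 𝒜).map f := by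
  refine (HomogeneousIdeal.irrelevant_le _).mpr fun i hi b hb => ?_
  obtain ⟨a, ha, rfl⟩ := hsurj i b hb
  exact Ideal.mem_map_of_mem f (HomogeneousIdeal.mem_irrelevant_of_mem 𝒜 hi ha)

theorem away_map_surjective (hsurj : ∀ n, ∀ b ∈ ℬ n, ∃ a ∈ 𝒜 n, f a = b) {d : ℕ} {s : A} (hs : s ∈ 𝒜 d) :
    Function.Surjective (Away.map f s) := by
  intro z
  obtain ⟨n, b, hb, rfl⟩ := Away.mk_surjective ℬ (f.map_mem hs) z
  obtain ⟨a, ha, rfl⟩ := hsurj _ b hb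
  exact ⟨Away.mk 𝒜 hs n a ha, Away.map_mk f s hs n a ha⟩

/-- The basic open set of `f s` is the full preimage of that of `s`, so over each affine chart the
map on `Proj` is `Spec` of a map of localizations. -/
theorem isPullback_awayι
    (hf : HomogeneousIdeal.irrelevant ℬ ≤ (HomogeneousIdeal.irrelevant 𝒜).map f)
    {d : ℕ} (hd : 0 < d) {s : A} (hs : s ∈ 𝒜 d) :
    IsPullback (Spec.map (CommRingCat.ofHom (Away.map f s)))
      (Proj.awayι ℬ (f s) (f.map_mem hs) hd) (Proj.awayι 𝒜 s hs hd) (Proj.map f hf) := by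
  refine IsOpenImmersion.isPullback _ _ _ _ (Proj.awayι_comp_map f hf hd s hs) ?_
  rw [Proj.opensRange_awayι, Proj.opensRange_awayι, Proj.map_preimage_basicOpen]

/-- Being a closed immersion is local on the target, and on each chart the map of degree-zero
localizations is surjective. -/
theorem isClosedImmersion_proj_map (hsurj : ∀ n, ∀ b ∈ ℬ n, ∃ a ∈ 𝒜 n, f a = b)
    (hf : HomogeneousIdeal.irrelevant ℬ ≤ (HomogeneousIdeal.irrelevant 𝒜).map f) :
    IsClosedImmersion (Proj.map f hf) := by
  rw [IsZariskiLocalAtTarget.iff_of_openCover (P := @IsClosedImmersion)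
    (Proj.affineOpenCover 𝒜).openCover]
  rintro ⟨⟨d, hd⟩, s, hs⟩
  have h1 := isPullback_awayι hf hd hs
  have h2 : IsClosedImmersion (Spec.map (CommRingCat.ofHom (Away.map f s))) :=
    IsClosedImmersion.spec_of_surjective _ (away_map_surjective hsurj hs)
  rw [← h1.flip.isoPullback_hom_snd,
    MorphismProperty.cancel_left_of_respectsIso @IsClosedImmersion] at h2
  exact h2

/-- A homogeneous prime containing `F` contains the whole kernel, so it is the preimage of its
image, and that image is again prime. -/
theorem range_proj_map {F : A} (hF : RingHom.ker (f : A →+* B) = Ideal.span {F})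
    (hfs : Function.Surjective f)
    (hf : HomogeneousIdeal.irrelevant ℬ ≤ (HomogeneousIdeal.irrelevant 𝒜).map f) :
    Set.range (Proj.map f hf) = ProjectiveSpectrum.zeroLocus 𝒜 {F} := by
  have hF0 : f F = 0 := by
    have : F ∈ RingHom.ker (f : A →+* B) := hF ▸ Ideal.mem_span_singleton_self F
    exact this
  suffices key : ∀ p : ProjectiveSpectrum 𝒜,
      (∃ q : ProjectiveSpectrum ℬ, ProjectiveSpectrum.comap f hf q = p) ↔
        F ∈ p.asHomogeneousIdeal.toIdeal by
    refine Set.ext fun p => (key p).trans ?_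
    exact Set.singleton_subset_iff.symm
  intro p
  constructor
  · rintro ⟨q, rfl⟩
    change f F ∈ q.asHomogeneousIdeal.toIdeal
    rw [hF0]
    exact zero_mem _
  · intro hp
    have hker : RingHom.ker (f : A →+* B) ≤ p.asHomogeneousIdeal.toIdeal := by
      rw [hF, Ideal.span_singleton_le_iff_mem]
      exact hp
    have hcm : (p.asHomogeneousIdeal.map f).comap f = p.asHomogeneousIdeal := by
      refine HomogeneousIdeal.ext ?_
      change Ideal.comap (f : A →+* B) (Ideal.map (f : A →+* B) p.asHomogeneousIdeal.toIdeal) = _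
      exact (Ideal.comap_map_of_surjective (f : A →+* B) hfs _).trans (sup_eq_left.2 hker)
    have hpr := p.isPrime
    let q : ProjectiveSpectrum ℬ :=
      { asHomogeneousIdeal := p.asHomogeneousIdeal.map f
        isPrime := Ideal.map_isPrime_of_surjective (f := (f : A →+* B)) hfs hker
        not_irrelevant_le := fun hle => p.not_irrelevant_le <| by
          rw [← hcm]
          refine (HomogeneousIdeal.irrelevant_le _).mpr fun i hi a ha => ?_
          exact hle (HomogeneousIdeal.mem_irrelevant_of_mem ℬ hi (f.map_mem ha)) }
    exact ⟨q, ProjectiveSpectrum.ext hcm⟩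

end Proj

/-! ### The mirror as a closed subscheme of projective space -/

section

variable {ω : SymplecticForm}
  (H : IsKummerParameter (paramG ω) (paramH ω) (paramJ ω) (paramK ω))
include H

theorem exists_coordHom_eq (l : ℕ) (b : kummerRing ω) (hb : b ∈ kummerRing.grading ω l) :
    ∃ a ∈ MvPolynomial.homogeneousSubmodule (Fin 4) ℂ l, coordHom ω a = b := by
  rw [← formsIn_coordX H] at hb
  exact hb

theorem coordHom_surjective : Function.Surjective (coordHom ω) :=
  fun b => aeval_coordX_surjective H b

theorem ker_coordHom : RingHom.ker (coordHom ω : MvPolynomial (Fin 4) ℂ →+* kummerRing ω) =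
    Ideal.span {kummerQuartic (paramG ω) (paramH ω) (paramJ ω) (paramK ω)} := by
  rw [← ker_aeval_coordX H]
  rfl

theorem proj_coordHom : ∃ hirr : HomogeneousIdeal.irrelevant (kummerRing.grading ω) ≤
        (HomogeneousIdeal.irrelevant (MvPolynomial.homogeneousSubmodule (Fin 4) ℂ)).map (coordHom ω),
      AlgebraicGeometry.IsClosedImmersion (AlgebraicGeometry.Proj.map (coordHom ω) hirr) ∧
      Set.range (AlgebraicGeometry.Proj.map (coordHom ω) hirr) =
        ProjectiveSpectrum.zeroLocus (MvPolynomial.homogeneousSubmodule (Fin 4) ℂ)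
          {kummerQuartic (paramG ω) (paramH ω) (paramJ ω) (paramK ω)} := by
  have hirr := irrelevant_le_map_of_surjective (exists_coordHom_eq H)
  refine ⟨hirr, ?_, ?_⟩
  · exact isClosedImmersion_proj_map (exists_coordHom_eq H) hirr
  · exact range_proj_map (ker_coordHom H) (coordHom_surjective H) hirr
end

end KummerMirror
end

theorem mainTheorem1 (ω : SymplecticForm)
    (hω : IsKummerParameter (paramG ω) (paramH ω) (paramJ ω) (paramK ω)) :
    Algebra.adjoin ℂ (Set.range (coordX ω)) = ⊤ ∧
    RingHom.ker (MvPolynomial.aeval (R := ℂ) (coordX ω)) =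
      Ideal.span {kummerQuartic (paramG ω) (paramH ω) (paramJ ω) (paramK ω)} ∧
    (∀ i, quarticW (coordX ω) i =
      ∑ j, matrixM (paramG ω) (paramH ω) (paramJ ω) (paramK ω) j i • elemZ ω j) ∧
    LinearMap.ker (matrixM (paramG ω) (paramH ω) (paramJ ω) (paramK ω)).mulVecLin =
      Submodule.span ℂ {quarticCoeff (paramG ω) (paramH ω) (paramJ ω) (paramK ω)} ∧
    IsKummerSurface (kummerQuartic (paramG ω) (paramH ω) (paramJ ω) (paramK ω)) ∧
    ∃ hirr : HomogeneousIdeal.irrelevant (kummerRing.grading ω) ≤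
        (HomogeneousIdeal.irrelevant (MvPolynomial.homogeneousSubmodule (Fin 4) ℂ)).map (coordHom ω),
      AlgebraicGeometry.IsClosedImmersion (AlgebraicGeometry.Proj.map (coordHom ω) hirr) ∧
      Set.range (AlgebraicGeometry.Proj.map (coordHom ω) hirr) =
        ProjectiveSpectrum.zeroLocus (MvPolynomial.homogeneousSubmodule (Fin 4) ℂ)
          {kummerQuartic (paramG ω) (paramH ω) (paramJ ω) (paramK ω)} :=
  ⟨adjoin_coordX hω, ker_aeval_coordX hω, quarticW_coordX ω, ker_matrixM hω,
    hω.isKummerSurface, proj_coordHom hω⟩
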